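/- **Setting.** Fix an integer $M\ge 2$. Let $z_i=(y_i,x_i)\in\mathbb R\times\mathbb R^p$, $i=1,\dots,n$, follow the linear model with changepoints $0=\tau_0^*<\tau_1^*<\dots<\tau_{K^*}^*<\tau_{K^*+1}^*=n$: $$y_i=x_i^\top f_k^*+\epsilon_i,\qquad i\in(\tau^*_{k-1},\tau^*_k],\ k=1,\dots,K^*+1,\qquad f_k^*\ne f_{k+1}^* .$$ The pairs $(x_i,\epsilon_i)$ are independent over $i$ and $\epsilon_i$ is independent of $x_i$; the $x_i$ are identically distributed with mean zero, invertible covariance matrix $\Sigma$ and $\|\Sigma^{-1/2}x_i\|_{\Psi_2}\le C_x$; the $\epsilon_i$ are identically distributed with mean zero, variance $\sigma_\epsilon^2$ and $\|\epsilon_i\|_{\Psi_2}\le C_\epsilon$; each $f_k^*$ has at most $s_n<p$ non-zero coordinates, all of absolute value at most $C_f$. Here $\|X\|_{\Psi_2}=\inf\{t>0:\mathbb E\exp(X^2/t^2)\le 2\}$ for a real variable, the supremum of $\|u^\top X\|_{\Psi_2}$ over unit vectors $u$ for a vector, and $\|v\|_\Sigma^2=v^\top\Sigma v$. The loss is $\ell(z_i;f)=(y_i-x_i^\top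 f)^2$, with $\bar\ell_i(f)=\mathbb E\,\ell(z_i;f)$; $f_I^\circ$ minimises $\sum_{i\in I}\bar\ell_i(f)$. Put $d_n=s_n\log^2p$ and, for $1\le k\le K^*$, $$\Delta_k=\{\bar\ell_{\tau_k^*}(f_{k+1}^*)-\bar\ell_{\tau_k^*}(f_k^*)\}\vee\{\bar\ell_{\tau_k^*+1}(f_k^*)-\bar\ell_{\tau_k^*+1}(f_{k+1}^*)\}\;\bigl(=\|f_k^*-f_{k+1}^*\|_\Sigma^2\bigr);$$ at the two boundaries $\Delta_0^{-1}$ and $\Delta_{K^*+1}^{-1}$ are read as $0$. Assume $d_n\ge c_0\log n$ and $\Delta_k\log n\le C_b\,d_n$ for $1\le k\le K^*$. **Estimator.** Let $J_m=\{i\in[n]:(i-1)\bmod M=m-1\}$, $m=1,\dots,M$. For an index set $A$ let $\hat f_A$ be the cross-validated lasso fit computed from $(z_i)_{i\in A}$: a minimiser of $\sum_{i\in A}(y_i-x_i^\top f)^2+\lambda\sqrt{|A|}\,\|f\|_1$ at $\lambda=\hat\lambda_A$, where $\hat\lambda_A$ minimises over a set $\Lambda\subset(0,\infty)$ the cross-validation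 criterion $\sum_{b=1}^B\sum_{i\in V_{A,b}}(y_i-x_i^\top\hat f_{A\setminus V_{A,b}}(\lambda))^2$, $\hat f_{A'}(\lambda)$ being the lasso fit on $A'$ with regularizer $\lambda$, for an arbitrary partition of $A$ into $B\ge2$ folds $V_{A,1},\dots,V_{A,B}$. Let $(\hat\tau_1,\dots,\hat\tau_{\hat K})$ be a minimiser of $$\sum_{k=1}^{K+1}\sum_{m=1}^M\ \sum_{i\in(\tau_{k-1},\tau_k]\cap J_m}\ell\bigl(z_i;\hat f_{(\tau_{k-1},\tau_k]\setminus J_m}\bigr)+\gamma K$$ over all $K\ge0$ and $0=\tau_0<\tau_1<\dots<\tau_K<\tau_{K+1}=n$ with $\tau_k-\tau_{k-1}\ge d_{\mathsf m}$ for all $k$, where $d_{\mathsf m}=C_{\mathsf m}d_n$ and $\gamma=C_\gamma d_n$. **Conditions.** For constants $\widetilde C,C_{\rm acc},c,C_{\mathsf{snr}}$: (i) with probability at least $1-n^{-c}$, $\|\hat f_{I\setminus J_m}-f_I^\circ\|_\Sigma^2\le C_{\rm acc}\,d_n/|I|$ for all $m\in[M]$ and all nonempty $I=(s,e]\subset(0,n]$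 such that $|s-\tau^*_{k-1}|\le\widetilde C d_n\Delta_{k-1}^{-1}$ and $|e-\tau^*_k|\le\widetilde C d_n\Delta_k^{-1}$ for some $k\in[K^*+1]$; (ii) $\tau_k^*-\tau_{k-1}^*\ge C_{\mathsf{snr}}\,d_n(\Delta_{k-1}^{-1}\vee1+\Delta_k^{-1}\vee1)$ for all $k\in[K^*+1]$. **Claim.** For all positive $C_x,C_\epsilon,C_f,C_{\rm acc},c,c_0,C_b$ and all $M\ge2$ there are positive constants $\widetilde C,C_{\mathsf m},C_\gamma,C_{\mathsf{snr}},C$, depending on nothing else, such that in every model as above satisfying (i) and (ii), with probability at least $1-n^{-C}$ a minimiser exists and every minimiser satisfies $$\hat K=K^*\quad\text{and}\quad\max_{1\le k\le K^*}\ \min_{1\le j\le\hat K}\Delta_k\,|\tau_k^*-\hat\tau_j|\le\widetilde C\,s_n\log^2p .$$ -/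

import Mathlib

open MeasureTheory ProbabilityTheory
open scoped ENNReal

noncomputable section

/-- The sub-Gaussian norm `inf {t > 0 : E exp (X² / t²) ≤ 2}` of a real random variable, with values
in `[0, ∞]` (it is `∞` when no `t` qualifies). -/
def subGaussianNorm {Ω : Type*} [MeasurableSpace Ω] (μ : Measure Ω) (X : Ω → ℝ) : ℝ≥0∞ :=
  ⨅ (t : ℝ) (_ : 0 < t ∧ ∫⁻ ω, ENNReal.ofReal (Real.exp (X ω ^ 2 / t ^ 2)) ∂μ ≤ 2),
    ENNReal.ofReal t

/-- `‖v‖²_S = vᵀ S v`. -/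
def sqNorm {p : ℕ} (S : Matrix (Fin p) (Fin p) ℝ) (v : Fin p → ℝ) : ℝ :=
  v ⬝ᵥ S.mulVec v

/-- One observation `z = (y, x)`: a response and a covariate vector. -/
abbrev Obs (p : ℕ) : Type := ℝ × (Fin p → ℝ)

/-- The squared loss `ℓ(z; g) = (y - xᵀ g)²`. -/
def sqLoss {p : ℕ} (z : Obs p) (g : Fin p → ℝ) : ℝ :=
  (z.1 - z.2 ⬝ᵥ g) ^ 2

/-- The empirical loss `𝓛(z_A; g) = ∑_{i ∈ A} ℓ(z_i; g)`. -/
def empLoss {p : ℕ} (A : Finset ℕ) (z : ℕ → Obs p) (g : Fin p → ℝ) : ℝ :=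
  ∑ i ∈ A, sqLoss (z i) g

/-! ### Segmentations -/

/-- `0 = τ 0 < τ 1 < ⋯ < τ K < τ (K + 1) = n`: a segmentation of `(0, n]` with `K` changepoints.
Values of `τ` after `K + 1` play no role. -/
structure IsSegmentation (n K : ℕ) (τ : ℕ → ℕ) : Prop where
  zero : τ 0 = 0
  last : τ (K + 1) = n
  lt : ∀ k ≤ K, τ k < τ (k + 1)

/-- Segmentations all of whose segments have length at least `dm`. -/
def IsAdmissible (n : ℕ) (dm : ℝ) (K : ℕ) (τ : ℕ → ℕ) : Prop :=
  IsSegmentation n K τ ∧ ∀ k ≤ K, dm ≤ (τ (k + 1) : ℝ) - (τ k : ℝ)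

/-! ### The linear model with changepoints -/

/-- The high-dimensional linear model with changepoints. The sample is `z i = (y i, x i)`,
`1 ≤ i ≤ n`; the coefficient vector is `f k` on the segment `(τ (k - 1), τ k]`, `1 ≤ k ≤ K + 1`. -/
structure IsLinearModel {Ω : Type*} [MeasurableSpace Ω] (μ : Measure Ω) {n p : ℕ}
    (s K : ℕ) (τ : ℕ → ℕ) (f : ℕ → Fin p → ℝ) (S : Matrix (Fin p) (Fin p) ℝ) (σ : ℝ)
    (x : ℕ → Ω → Fin p → ℝ) (ε y : ℕ → Ω → ℝ) (Cx Ce Cf : ℝ) : Prop where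
  segmentation : IsSegmentation n K τ
  /-- the parameter really changes at each changepoint -/
  change : ∀ k ∈ Finset.Icc 1 K, f k ≠ f (k + 1)
  response : ∀ k ∈ Finset.Icc 1 (K + 1), ∀ i ∈ Finset.Ioc (τ (k - 1)) (τ k), ∀ ω,
    y i ω = x i ω ⬝ᵥ f k + ε i ω
  measurable_x : ∀ i ∈ Finset.Icc 1 n, Measurable (x i)
  measurable_ε : ∀ i ∈ Finset.Icc 1 n, Measurable (ε i)
  /-- the pairs `(x i, ε i)` are independent over `i` … -/
  indep : iIndepFun (fun (i : Finset.Icc 1 n) ω => (x i ω, ε i ω)) μ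
  /-- … and the noise is independent of the covariates -/
  indep_noise : ∀ i ∈ Finset.Icc 1 n, IndepFun (x i) (ε i) μ
  ident_x : ∀ i ∈ Finset.Icc 1 n, ∀ j ∈ Finset.Icc 1 n, IdentDistrib (x i) (x j) μ μ
  ident_ε : ∀ i ∈ Finset.Icc 1 n, ∀ j ∈ Finset.Icc 1 n, IdentDistrib (ε i) (ε j) μ μ
  mean_x : ∀ i ∈ Finset.Icc 1 n, ∀ a, ∫ ω, x i ω a ∂μ = 0
  cov_posDef : S.PosDef
  cov_x : ∀ i ∈ Finset.Icc 1 n, ∀ a b, ∫ ω, x i ω a * x i ω b ∂μ = S a b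
  /-- `‖S^{-1/2} x i‖_{Ψ₂} ≤ Cx`, that is, `‖uᵀ S^{-1/2} x i‖_{Ψ₂} ≤ Cx` for all unit vectors `u`,
  written with `v = S^{-1/2} u` -/
  subGaussian_x : ∀ i ∈ Finset.Icc 1 n, ∀ v : Fin p → ℝ,
    subGaussianNorm μ (fun ω => v ⬝ᵥ x i ω) ≤ ENNReal.ofReal (Cx * √(sqNorm S v))
  mean_ε : ∀ i ∈ Finset.Icc 1 n, ∫ ω, ε i ω ∂μ = 0
  var_ε : ∀ i ∈ Finset.Icc 1 n, ∫ ω, ε i ω ^ 2 ∂μ = σ ^ 2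
  subGaussian_ε : ∀ i ∈ Finset.Icc 1 n, subGaussianNorm μ (ε i) ≤ ENNReal.ofReal Ce
  sparse : ∀ k ∈ Finset.Icc 1 (K + 1), Nat.card {a : Fin p // f k a ≠ 0} ≤ s
  sparse_lt : s < p
  bounded : ∀ k ∈ Finset.Icc 1 (K + 1), ∀ a, |f k a| ≤ Cf

/-- The sample at the outcome `ω`. -/
def sample {Ω : Type*} {p : ℕ} (x : ℕ → Ω → Fin p → ℝ) (y : ℕ → Ω → ℝ) (ω : Ω) : ℕ → Obs p :=
  fun i => (y i ω, x i ω)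

/-- The expected loss of the `i`-th observation, for a fixed parameter `g`. -/
def expLoss {Ω : Type*} [MeasurableSpace Ω] (μ : Measure Ω) {p : ℕ}
    (x : ℕ → Ω → Fin p → ℝ) (y : ℕ → Ω → ℝ) (i : ℕ) (g : Fin p → ℝ) : ℝ :=
  ∫ ω, sqLoss (sample x y ω i) g ∂μ

/-- `g` is an oracle parameter of the index set `A`: it minimises the expected loss over `A`. -/
def IsOracle {Ω : Type*} [MeasurableSpace Ω] (μ : Measure Ω) {p : ℕ}
    (x : ℕ → Ω → Fin p → ℝ) (y : ℕ → Ω → ℝ) (A : Finset ℕ) (g : Fin p → ℝ) : Prop :=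
  IsMinOn (fun h => ∑ i ∈ A, expLoss μ x y i h) Set.univ g

/-- The signal `Δ_k` of the change at `τ k`, `1 ≤ k ≤ K`. -/
def signal {Ω : Type*} [MeasurableSpace Ω] (μ : Measure Ω) {p : ℕ}
    (x : ℕ → Ω → Fin p → ℝ) (y : ℕ → Ω → ℝ) (τ : ℕ → ℕ) (f : ℕ → Fin p → ℝ) (k : ℕ) : ℝ :=
  max (expLoss μ x y (τ k) (f (k + 1)) - expLoss μ x y (τ k) (f k))
    (expLoss μ x y (τ k + 1) (f k) - expLoss μ x y (τ k + 1) (f (k + 1)))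

/-- `Δ_k⁻¹`, with the value `0` at the two boundaries `k = 0` and `k = K + 1`, which are known
endpoints and not changepoints. -/
def signalInv {Ω : Type*} [MeasurableSpace Ω] (μ : Measure Ω) {p : ℕ}
    (x : ℕ → Ω → Fin p → ℝ) (y : ℕ → Ω → ℝ) (K : ℕ) (τ : ℕ → ℕ) (f : ℕ → Fin p → ℝ) (k : ℕ) : ℝ :=
  if 1 ≤ k ∧ k ≤ K then (signal μ x y τ f k)⁻¹ else 0

/-- The rate `s (log p)²`. -/
def rate (s p : ℕ) : ℝ :=
  (s : ℝ) * Real.log (p : ℝ) ^ 2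

/-- `(l, e]` is a nearly homogeneous segment: for some `k`, its endpoints are within
`Ct * d * Δ_{k-1}⁻¹` of `τ (k - 1)` and within `Ct * d * Δ_k⁻¹` of `τ k`. -/
def IsNearlyHomogeneous {Ω : Type*} [MeasurableSpace Ω] (μ : Measure Ω) {p : ℕ}
    (x : ℕ → Ω → Fin p → ℝ) (y : ℕ → Ω → ℝ) (n K : ℕ) (τ : ℕ → ℕ) (f : ℕ → Fin p → ℝ)
    (Ct d : ℝ) (l e : ℕ) : Prop :=
  l < e ∧ e ≤ n ∧ ∃ k ∈ Finset.Icc 1 (K + 1),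
    |(l : ℝ) - (τ (k - 1) : ℝ)| ≤ Ct * d * signalInv μ x y K τ f (k - 1) ∧
    |(e : ℝ) - (τ k : ℝ)| ≤ Ct * d * signalInv μ x y K τ f k

/-! ### The cross-validated lasso -/

/-- `lasso A lam z` is, for each index set `A` and each regularizer `lam ∈ Λ`, a minimiser of the
lasso criterion `𝓛(z_A; g) + lam √|A| ‖g‖₁`, computed from the observations in `A` only. -/
structure IsLasso {p : ℕ} (Λ : Set ℝ)
    (lasso : Finset ℕ → ℝ → (ℕ → Obs p) → (Fin p → ℝ)) : Prop where
  isMinOn : ∀ A, ∀ lam ∈ Λ, ∀ z,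
    IsMinOn (fun g : Fin p → ℝ => empLoss A z g + lam * √(A.card : ℝ) * ∑ a, |g a|) Set.univ
      (lasso A lam z)
  dependsOn : ∀ A, ∀ lam ∈ Λ, DependsOn (lasso A lam) (A : Set ℕ)

/-- `V A 0, …, V A (B - 1)` is a partition of each index set `A` into `B` disjoint folds. -/
structure IsFolding (B : ℕ) (V : Finset ℕ → ℕ → Finset ℕ) : Prop where
  two_le : 2 ≤ B
  cover : ∀ A, (Finset.range B).biUnion (V A) = A
  disjoint : ∀ A, ∀ b < B, ∀ b' < B, b ≠ b' → Disjoint (V A b) (V A b')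

/-- The cross-validation criterion `∑_b 𝓛(z_{V_{A,b}}; f̂_{A ∖ V_{A,b}}(lam))`. -/
def cvCriterion {p : ℕ} (B : ℕ) (V : Finset ℕ → ℕ → Finset ℕ)
    (lasso : Finset ℕ → ℝ → (ℕ → Obs p) → (Fin p → ℝ)) (A : Finset ℕ) (z : ℕ → Obs p)
    (lam : ℝ) : ℝ :=
  ∑ b ∈ Finset.range B, empLoss (V A b) z (lasso (A \ V A b) lam z)

/-- `fit` is the cross-validated lasso `f̂_A(λ̂_A)`, where `λ̂_A ∈ Λ` minimises the cross-validation
criterion over `Λ` and is computed from the observations in `A` only. -/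
def IsCVLasso {p : ℕ} (fit : Finset ℕ → (ℕ → Obs p) → (Fin p → ℝ)) : Prop :=
  ∃ (Λ : Set ℝ) (lasso : Finset ℕ → ℝ → (ℕ → Obs p) → (Fin p → ℝ))
    (B : ℕ) (V : Finset ℕ → ℕ → Finset ℕ) (lamHat : Finset ℕ → (ℕ → Obs p) → ℝ),
    (∀ lam ∈ Λ, 0 < lam) ∧ IsLasso Λ lasso ∧ IsFolding B V ∧
    (∀ A z, lamHat A z ∈ Λ ∧ IsMinOn (cvCriterion B V lasso A z) Λ (lamHat A z)) ∧
    (∀ A, DependsOn (lamHat A) (A : Set ℕ)) ∧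
    (∀ A z, fit A z = lasso A (lamHat A z) z) ∧
    (∀ A, Measurable (fit A))

/-! ### Cross-fitting -/

/-- The order-preserving split `J_m = {i ∈ [n] : (i - 1) mod M = m - 1}`, `m = 1, …, M`. -/
def splitSet (n M m : ℕ) : Finset ℕ :=
  (Finset.Icc 1 n).filter (fun i => (i - 1) % M = m - 1)

/-- The cross-fitted out-of-sample loss of the segment `(l, e]`. -/
def cfLoss {p : ℕ} (n M : ℕ) (fit : Finset ℕ → (ℕ → Obs p) → (Fin p → ℝ)) (z : ℕ → Obs p)
    (l e : ℕ) : ℝ :=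
  ∑ m ∈ Finset.Icc 1 M,
    empLoss (Finset.Ioc l e ∩ splitSet n M m) z (fit (Finset.Ioc l e \ splitSet n M m) z)

/-- The penalised total out-of-sample loss of the segmentation `(K, τ)`. -/
def totalCfLoss {p : ℕ} (n M : ℕ) (fit : Finset ℕ → (ℕ → Obs p) → (Fin p → ℝ)) (γ : ℝ)
    (z : ℕ → Obs p) (K : ℕ) (τ : ℕ → ℕ) : ℝ :=
  ∑ k ∈ Finset.Icc 1 (K + 1), cfLoss n M fit z (τ (k - 1)) (τ k) + γ * (K : ℝ)

/-- `(K, τ)` is an output of the complete search: it minimises the total out-of-sample loss over all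
segmentations with minimal segment length `dm`. -/
def IsCfEstimate {p : ℕ} (n M : ℕ) (fit : Finset ℕ → (ℕ → Obs p) → (Fin p → ℝ)) (dm γ : ℝ)
    (z : ℕ → Obs p) (K : ℕ) (τ : ℕ → ℕ) : Prop :=
  IsAdmissible n dm K τ ∧ ∀ (K' : ℕ) (τ' : ℕ → ℕ), IsAdmissible n dm K' τ' →
    totalCfLoss n M fit γ z K τ ≤ totalCfLoss n M fit γ z K' τ'

/-! ### The conditions on accuracy and spacing -/

/-- With probability at least `1 - n^{-c}`, the fits on all nearly homogeneous segments satisfy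
`‖f̂_{I ∖ J_m} - f_I°‖²_S ≤ Ca s (log p)² / |I|`. -/
def PredictiveAccuracy {Ω : Type*} [MeasurableSpace Ω] (μ : Measure Ω) {p : ℕ}
    (x : ℕ → Ω → Fin p → ℝ) (y : ℕ → Ω → ℝ) (n M s K : ℕ) (τ : ℕ → ℕ) (f : ℕ → Fin p → ℝ)
    (S : Matrix (Fin p) (Fin p) ℝ) (fit : Finset ℕ → (ℕ → Obs p) → (Fin p → ℝ))
    (Ct Ca c : ℝ) : Prop :=
  ENNReal.ofReal (1 - (n : ℝ) ^ (-c)) ≤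
    μ {ω | ∀ m ∈ Finset.Icc 1 M, ∀ l e : ℕ,
      IsNearlyHomogeneous μ x y n K τ f Ct (rate s p) l e →
      ∀ g, IsOracle μ x y (Finset.Ioc l e) g →
        sqNorm S (fit (Finset.Ioc l e \ splitSet n M m) (sample x y ω) - g) ≤
          Ca * rate s p / ((Finset.Ioc l e).card : ℝ)}

/-- `τ_k - τ_{k-1} ≥ Csnr s (log p)² (Δ_{k-1}⁻¹ ∨ 1 + Δ_k⁻¹ ∨ 1)` for `1 ≤ k ≤ K + 1`. -/
def Spacing {Ω : Type*} [MeasurableSpace Ω] (μ : Measure Ω) {p : ℕ}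
    (x : ℕ → Ω → Fin p → ℝ) (y : ℕ → Ω → ℝ) (s K : ℕ) (τ : ℕ → ℕ) (f : ℕ → Fin p → ℝ)
    (Csnr : ℝ) : Prop :=
  ∀ k ∈ Finset.Icc 1 (K + 1),
    Csnr * rate s p *
      (max (signalInv μ x y K τ f (k - 1)) 1 + max (signalInv μ x y K τ f k) 1) ≤
    (τ k : ℝ) - (τ (k - 1) : ℝ)

end

/-! ### Exponential moments of the excess loss of a single observation -/

section SubGaussian

variable {Ω : Type*} [MeasurableSpace Ω] {μ : Measure Ω}

/-! Against the true parameter b of an observation, a parameter g has excess loss U² + 2εU with U =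
xᵀ(b - g). The losses of the true parameters have the same total for every segmentation
(`totalCfLoss_eq`), so the search minimises the sum of the cross-fitted excess losses of the
segments plus the penalty.

Cross-fitting makes each fit independent of the observations on which it is evaluated. With g
frozen, suitable exponential moments of one excess are at most one; by independence the same holds
for products evaluated at the random fit, and Markov's inequality gives tails exp(-t). No uniformity
over parameters is needed, only a union over at most 4Mn³ events, with t of order log n
(`measure_not_heldOutBounds_le`). This yields three bounds. (a) Whatever the fit, the excess outside
the windows around the changepoints is at least -O(log n): the noise term is absorbed by the square.
(b) N held-out observations with a common parameter b have excess at least N‖b - g‖²/8 - O(log n),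
once N exceeds a multiple of log n. (c) If all ‖b - g‖² are at most R, the excess is at most 8Cx²
∑‖b - g‖² + O(R log n).

A segment that contains a window of C d/Δ_k observations on both sides of the k-th changepoint is
therefore expensive for every fit: one g cannot be close to both neighbouring parameters, and (b)
charges about C d/32 in total. Predictive accuracy enters only for nearly homogeneous segments.
There (c) bounds the cost by (c3 + c4 (D₁ + D₂)) d, where D₁, D₂ are the endpoint errors in units of
d/Δ.

What remains is deterministic (`SearchBounds.consistent`) and uses two window sizes Cs ≤ Cl. Call a
changepoint matched if an estimate lies in its small window; the two boundaries always are. Between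
two consecutive matched changepoints, replace the estimates by the true changepoints. The misaligned
ends cost up to 2 c4 Cs d, which a gain of order Cs d/32 need not outweigh, so one scale would not
do. A changepoint that has an estimate in its large window only already pays for the additional
segments. A changepoint without an estimate in its large window, or a superfluous estimate, would
save more than the misalignment costs, because Cl and γ are chosen after Cs. Optimality excludes
both, so the count is right between matched changepoints, and hence globally, with an estimate in
every large window. -/

theorem lintegral_exp_sq_le_two_of_subGaussianNorm_le {X : Ω → ℝ} {a t : ℝ} (ha : 0 < t)
    (hat : a < t) (h : subGaussianNorm μ X ≤ ENNReal.ofReal a) :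
    ∫⁻ ω, ENNReal.ofReal (Real.exp (X ω ^ 2 / t ^ 2)) ∂μ ≤ 2 := by
  have h1 : subGaussianNorm μ X < ENNReal.ofReal t :=
    h.trans_lt ((ENNReal.ofReal_lt_ofReal_iff ha).2 hat)
  unfold subGaussianNorm at h1
  simp only [iInf_lt_iff] at h1
  obtain ⟨r, ⟨hr, hr2⟩, hrt⟩ := h1
  have hrt' : r < t := (ENNReal.ofReal_lt_ofReal_iff ha).1 hrt
  refine (lintegral_mono fun ω => ENNReal.ofReal_le_ofReal (Real.exp_le_exp.2 ?_)).trans hr2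
  gcongr

theorem integrable_of_lintegral_ofReal_le {f : Ω → ℝ} (hf : Measurable f) (h0 : ∀ ω, 0 ≤ f ω)
    {C : ℝ≥0∞} (hC : C ≠ ∞) (h : ∫⁻ ω, ENNReal.ofReal (f ω) ∂μ ≤ C) : Integrable f μ := by
  refine ⟨hf.aestronglyMeasurable, ?_⟩
  rw [hasFiniteIntegral_iff_ofReal (Filter.Eventually.of_forall h0)]
  exact h.trans_lt (lt_top_iff_ne_top.2 hC)

theorem integral_le_of_lintegral_ofReal_le {f : Ω → ℝ} (hf : Measurable f) (h0 : ∀ ω, 0 ≤ f ω)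
    {C : ℝ} (hC : 0 ≤ C) (h : ∫⁻ ω, ENNReal.ofReal (f ω) ∂μ ≤ ENNReal.ofReal C) :
    ∫ ω, f ω ∂μ ≤ C := by
  rw [integral_eq_lintegral_of_nonneg_ae (Filter.Eventually.of_forall h0)
    hf.aestronglyMeasurable]
  exact ENNReal.toReal_le_of_le_ofReal hC h

/-- The moments of a random variable whose squared exponential has mean at most two. -/
structure HasExpSqBound (μ : Measure Ω) (X : Ω → ℝ) (t : ℝ) : Prop where
  measurable : Measurable X
  pos : 0 < t
  bound : ∫⁻ ω, ENNReal.ofReal (Real.exp (X ω ^ 2 / t ^ 2)) ∂μ ≤ 2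

namespace HasExpSqBound

variable {X : Ω → ℝ} {t : ℝ}

theorem integrable_exp (h : HasExpSqBound μ X t) :
    Integrable (fun ω => Real.exp (X ω ^ 2 / t ^ 2)) μ :=
  integrable_of_lintegral_ofReal_le (by have := h.measurable; fun_prop)
    (fun ω => (Real.exp_pos _).le) ENNReal.ofNat_ne_top h.bound

theorem integral_exp_le (h : HasExpSqBound μ X t) :
    ∫ ω, Real.exp (X ω ^ 2 / t ^ 2) ∂μ ≤ 2 :=
  integral_le_of_lintegral_ofReal_le (by have := h.measurable; fun_prop)
    (fun ω => (Real.exp_pos _).le) (by norm_num) (by simpa using h.bound)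

theorem integrable_of_abs_le (h : HasExpSqBound μ X t) {f : Ω → ℝ} (hf : Measurable f) {C : ℝ}
    (hle : ∀ ω, |f ω| ≤ C * Real.exp (X ω ^ 2 / t ^ 2)) : Integrable f μ :=
  (h.integrable_exp.const_mul C).mono' hf.aestronglyMeasurable (Filter.Eventually.of_forall hle)

theorem integrable_sq (h : HasExpSqBound μ X t) : Integrable (fun ω => X ω ^ 2) μ := by
  refine h.integrable_of_abs_le (C := t ^ 2) (by have := h.measurable; fun_prop) fun ω => ?_
  have ht := h.pos
  have h1 := Real.add_one_le_exp (X ω ^ 2 / t ^ 2)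
  rw [abs_of_nonneg (sq_nonneg _)]
  calc X ω ^ 2 = t ^ 2 * (X ω ^ 2 / t ^ 2) := by field_simp
    _ ≤ _ := by gcongr; linarith

theorem integrable (h : HasExpSqBound μ X t) : Integrable X μ := by
  refine h.integrable_of_abs_le (C := t) h.measurable fun ω => ?_
  have ht := h.pos
  have h1 := Real.add_one_le_exp (X ω ^ 2 / t ^ 2)
  calc |X ω| = t * (|X ω| / t) := by field_simp
    _ ≤ _ := by
      gcongr
      have : X ω ^ 2 / t ^ 2 = (|X ω| / t) ^ 2 := by rw [div_pow, sq_abs]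
      rw [this] at h1 ⊢
      nlinarith [sq_nonneg (|X ω| / t - 1)]

theorem sq_sq_le (h : HasExpSqBound μ X t) (ω : Ω) :
    (X ω ^ 2) ^ 2 ≤ 2 * t ^ 4 * (Real.exp (X ω ^ 2 / t ^ 2) - 1) := by
  have ht := h.pos
  have h1 := Real.quadratic_le_exp_of_nonneg (x := X ω ^ 2 / t ^ 2) (by positivity)
  have h2 : 0 ≤ X ω ^ 2 / t ^ 2 := by positivity
  calc (X ω ^ 2) ^ 2 = 2 * t ^ 4 * ((X ω ^ 2 / t ^ 2) ^ 2 / 2) := by field_simp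
    _ ≤ _ := by gcongr; linarith

theorem integrable_sq_sq (h : HasExpSqBound μ X t) : Integrable (fun ω => (X ω ^ 2) ^ 2) μ := by
  refine h.integrable_of_abs_le (C := 2 * t ^ 4) (by have := h.measurable; fun_prop) fun ω => ?_
  rw [abs_of_nonneg (by positivity)]
  refine (h.sq_sq_le ω).trans ?_
  have := h.pos
  gcongr
  linarith

theorem integral_sq_sq_le [IsProbabilityMeasure μ] (h : HasExpSqBound μ X t) :
    ∫ ω, (X ω ^ 2) ^ 2 ∂μ ≤ 2 * t ^ 4 := by
  calc ∫ ω, (X ω ^ 2) ^ 2 ∂μ ≤ ∫ ω, 2 * t ^ 4 * (Real.exp (X ω ^ 2 / t ^ 2) - 1) ∂μ :=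
        integral_mono h.integrable_sq_sq
          ((h.integrable_exp.sub (integrable_const 1)).const_mul _) h.sq_sq_le
    _ = 2 * t ^ 4 * (∫ ω, Real.exp (X ω ^ 2 / t ^ 2) ∂μ - 1) := by
        rw [integral_const_mul, integral_sub h.integrable_exp (integrable_const 1)]
        simp
    _ ≤ 2 * t ^ 4 * 1 := by
        have := h.integral_exp_le
        have := h.pos
        gcongr
        linarith
    _ = _ := by ring

/-- Convexity of exp between 0 and X²/t², with weight a t². After integration the bound is exp(a
t²), which tends to one with a, where monotonicity alone would only give 2. -/
theorem exp_mul_sq_le (h : HasExpSqBound μ X t) {a : ℝ} (ha : 0 ≤ a) (hat : a * t ^ 2 ≤ 1)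
    (ω : Ω) : Real.exp (a * X ω ^ 2) ≤
      (1 - a * t ^ 2) + a * t ^ 2 * Real.exp (X ω ^ 2 / t ^ 2) := by
  have ht := h.pos
  have := convexOn_exp.2 (Set.mem_univ 0) (Set.mem_univ (X ω ^ 2 / t ^ 2))
    (sub_nonneg.2 hat) (by positivity : 0 ≤ a * t ^ 2) (by ring)
  simp only [smul_eq_mul, Real.exp_zero, mul_one, mul_zero, zero_add] at this
  rwa [show a * t ^ 2 * (X ω ^ 2 / t ^ 2) = a * X ω ^ 2 by field_simp] at this

theorem integrable_exp_mul_sq [IsProbabilityMeasure μ] (h : HasExpSqBound μ X t) {a : ℝ}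
    (ha : 0 ≤ a) (hat : a * t ^ 2 ≤ 1) : Integrable (fun ω => Real.exp (a * X ω ^ 2)) μ := by
  refine Integrable.mono' (((integrable_const (1 - a * t ^ 2)).add
    (h.integrable_exp.const_mul (a * t ^ 2)))) ?_ (Filter.Eventually.of_forall fun ω => ?_)
  · have := h.measurable
    exact Measurable.aestronglyMeasurable (by fun_prop)
  · rw [Real.norm_eq_abs, abs_of_pos (Real.exp_pos _)]
    exact h.exp_mul_sq_le ha hat ω

theorem integral_exp_mul_sq_le [IsProbabilityMeasure μ] (h : HasExpSqBound μ X t) {a : ℝ}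
    (ha : 0 ≤ a) (hat : a * t ^ 2 ≤ 1) :
    ∫ ω, Real.exp (a * X ω ^ 2) ∂μ ≤ Real.exp (a * t ^ 2) := by
  calc ∫ ω, Real.exp (a * X ω ^ 2) ∂μ
      ≤ ∫ ω, ((1 - a * t ^ 2) + a * t ^ 2 * Real.exp (X ω ^ 2 / t ^ 2)) ∂μ :=
        integral_mono (h.integrable_exp_mul_sq ha hat) ((integrable_const (1 - a * t ^ 2)).add
          (h.integrable_exp.const_mul (a * t ^ 2))) (h.exp_mul_sq_le ha hat)
    _ = (1 - a * t ^ 2) + a * t ^ 2 * ∫ ω, Real.exp (X ω ^ 2 / t ^ 2) ∂μ := by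
        rw [integral_add (integrable_const _) (h.integrable_exp.const_mul _), integral_const_mul]
        simp
    _ ≤ (1 - a * t ^ 2) + a * t ^ 2 * 2 := by
        have := h.integral_exp_le
        gcongr
    _ ≤ Real.exp (a * t ^ 2) := by linarith [Real.add_one_le_exp (a * t ^ 2)]

end HasExpSqBound

/-- The linear term is kept apart because it integrates to zero for a centred variable, leaving only
an exponential square. -/
theorem exp_le_add_exp_sq (x : ℝ) : Real.exp x ≤ x + Real.exp (x ^ 2) := by
  have h1 := Real.add_one_le_exp (x ^ 2)
  rcases le_or_gt |x| 1 with h | h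
  · have := (abs_le.1 (Real.abs_exp_sub_one_sub_id_le h)).2
    linarith
  · rcases lt_abs.1 h with h | h
    · have : Real.exp x ≤ Real.exp (x ^ 2) := Real.exp_le_exp.2 (by nlinarith)
      linarith
    · have : Real.exp x ≤ 1 := Real.exp_le_one_iff.2 (by linarith)
      nlinarith

/-- A centred sub-Gaussian variable has a Gaussian moment generating function. -/
theorem HasExpSqBound.integral_exp_mul_le [IsProbabilityMeasure μ] {X : Ω → ℝ} {t : ℝ}
    (h : HasExpSqBound μ X t) (hmean : ∫ ω, X ω ∂μ = 0) (b : ℝ) :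
    Integrable (fun ω => Real.exp (b * X ω)) μ ∧
      ∫ ω, Real.exp (b * X ω) ∂μ ≤ Real.exp (b ^ 2 * t ^ 2) := by
  have hX := h.measurable
  have ht := h.pos
  rcases le_or_gt (b ^ 2 * t ^ 2) 1 with hb | hb
  · have hi := h.integrable_exp_mul_sq (sq_nonneg b) hb
    have hle : ∀ ω, Real.exp (b * X ω) ≤ b * X ω + Real.exp (b ^ 2 * X ω ^ 2) := fun ω => by
      rw [← mul_pow]; exact exp_le_add_exp_sq _
    have hi2 : Integrable (fun ω => b * X ω + Real.exp (b ^ 2 * X ω ^ 2)) μ :=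
      (h.integrable.const_mul b).add hi
    have hi3 : Integrable (fun ω => Real.exp (b * X ω)) μ := by
      refine hi2.mono' (Measurable.aestronglyMeasurable (by fun_prop))
        (Filter.Eventually.of_forall fun ω => ?_)
      rw [Real.norm_eq_abs, abs_of_pos (Real.exp_pos _)]
      exact hle ω
    refine ⟨hi3, (integral_mono hi3 hi2 hle).trans ?_⟩
    rw [integral_add (h.integrable.const_mul b) hi, integral_const_mul, hmean]
    simpa using h.integral_exp_mul_sq_le (sq_nonneg b) hb
  -- For large b, use bX ≤ b²t²/2 + X²/(2t²). The second term contributes a factor exp(1/2), which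
  -- is at most exp(b²t²/2) because b²t² > 1; centring plays no role here.
  · have ha2 : 1 / (2 * t ^ 2) * t ^ 2 = 1 / 2 := by field_simp
    have hi := h.integrable_exp_mul_sq (a := 1 / (2 * t ^ 2)) (by positivity)
      (by rw [ha2]; norm_num)
    have hint := h.integral_exp_mul_sq_le (a := 1 / (2 * t ^ 2)) (by positivity)
      (by rw [ha2]; norm_num)
    have hle : ∀ ω, Real.exp (b * X ω) ≤
        Real.exp (b ^ 2 * t ^ 2 / 2) * Real.exp (1 / (2 * t ^ 2) * X ω ^ 2) := fun ω => by
      rw [← Real.exp_add]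
      refine Real.exp_le_exp.2 ?_
      have : 1 / (2 * t ^ 2) * X ω ^ 2 = (X ω / t) ^ 2 / 2 := by field_simp
      rw [this]
      have h2 : b * X ω = (b * t) * (X ω / t) := by field_simp
      rw [h2]
      nlinarith [sq_nonneg (b * t - X ω / t)]
    have hi2 := hi.const_mul (Real.exp (b ^ 2 * t ^ 2 / 2))
    have hi3 : Integrable (fun ω => Real.exp (b * X ω)) μ := by
      refine hi2.mono' (Measurable.aestronglyMeasurable (by fun_prop))
        (Filter.Eventually.of_forall fun ω => ?_)
      rw [Real.norm_eq_abs, abs_of_pos (Real.exp_pos _)]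
      exact hle ω
    refine ⟨hi3, (integral_mono hi3 hi2 hle).trans ?_⟩
    rw [integral_const_mul]
    refine (mul_le_mul_of_nonneg_left hint (Real.exp_pos _).le).trans ?_
    rw [← Real.exp_add, ha2]
    exact Real.exp_le_exp.2 (by linarith)

/-- Integrating out independent centred sub-Gaussian noise. -/
theorem lintegral_exp_sq_add_mul_le [IsProbabilityMeasure μ] {U E : Ω → ℝ} {t : ℝ}
    (hU : Measurable U) (hE : HasExpSqBound μ E t) (hmean : ∫ ω, E ω ∂μ = 0)
    (hind : IndepFun U E μ) (a b : ℝ) :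
    ∫⁻ ω, ENNReal.ofReal (Real.exp (a * U ω ^ 2 + b * (E ω * U ω))) ∂μ ≤
      ∫⁻ ω, ENNReal.ofReal (Real.exp ((a + b ^ 2 * t ^ 2) * U ω ^ 2)) ∂μ := by
  have hEm := hE.measurable
  have hprod := (indepFun_iff_map_prod_eq_prod_map_map hU.aemeasurable hEm.aemeasurable).1 hind
  have : IsProbabilityMeasure (μ.map U) := Measure.isProbabilityMeasure_map hU.aemeasurable
  have : IsProbabilityMeasure (μ.map E) := Measure.isProbabilityMeasure_map hEm.aemeasurable
  have hF : Measurable fun q : ℝ × ℝ =>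
      ENNReal.ofReal (Real.exp (a * q.1 ^ 2 + b * (q.2 * q.1))) := by fun_prop
  calc ∫⁻ ω, ENNReal.ofReal (Real.exp (a * U ω ^ 2 + b * (E ω * U ω))) ∂μ
      = ∫⁻ q, ENNReal.ofReal (Real.exp (a * q.1 ^ 2 + b * (q.2 * q.1)))
          ∂(μ.map fun ω => (U ω, E ω)) := by
        rw [lintegral_map hF (hU.prodMk hEm)]
    _ = ∫⁻ u, ∫⁻ e, ENNReal.ofReal (Real.exp (a * u ^ 2 + b * (e * u))) ∂(μ.map E) ∂(μ.map U) := by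
        rw [hprod, lintegral_prod _ hF.aemeasurable]
    _ ≤ ∫⁻ u, ENNReal.ofReal (Real.exp ((a + b ^ 2 * t ^ 2) * u ^ 2)) ∂(μ.map U) := by
        refine lintegral_mono fun u => ?_
        rw [lintegral_map (by fun_prop) hEm]
        obtain ⟨hi, hle⟩ := hE.integral_exp_mul_le hmean (b * u)
        calc ∫⁻ ω, ENNReal.ofReal (Real.exp (a * u ^ 2 + b * (E ω * u))) ∂μ
            = ∫⁻ ω, ENNReal.ofReal (Real.exp (a * u ^ 2) * Real.exp (b * u * E ω)) ∂μ := by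
              refine lintegral_congr fun ω => ?_
              rw [← Real.exp_add]
              congr 2
              ring
          _ = ENNReal.ofReal (∫ ω, Real.exp (a * u ^ 2) * Real.exp (b * u * E ω) ∂μ) :=
              (ofReal_integral_eq_lintegral_ofReal (hi.const_mul _)
                (Filter.Eventually.of_forall fun ω => by positivity)).symm
          _ ≤ _ := by
              refine ENNReal.ofReal_le_ofReal ?_
              rw [integral_const_mul]
              refine (mul_le_mul_of_nonneg_left hle (Real.exp_pos _).le).trans ?_
              rw [← Real.exp_add]
              exact Real.exp_le_exp.2 (by ring_nf; rfl)
    _ = _ := by rw [lintegral_map (by fun_prop) hU]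

theorem exp_neg_le_quadratic {v : ℝ} (hv : 0 ≤ v) : Real.exp (-v) ≤ 1 - v + v ^ 2 := by
  rcases le_or_gt v 1 with h | h
  · have := (abs_le.1 (Real.abs_exp_sub_one_sub_id_le (x := -v) (by rwa [abs_neg, abs_of_nonneg hv]))).2
    linarith [neg_sq v]
  · have : Real.exp (-v) ≤ 1 := Real.exp_le_one_iff.2 (by linarith)
    nlinarith

/-- Second-order expansion of exp(-v): the fourth moment is at most 2t⁴, and the condition on θ lets
the quadratic term consume at most half of the drift θr. -/
theorem HasExpSqBound.lintegral_exp_neg_le [IsProbabilityMeasure μ] {X : Ω → ℝ} {t r θ : ℝ}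
    (h : HasExpSqBound μ X t) (hr : ∫ ω, X ω ^ 2 ∂μ = r) (hθ : 0 ≤ θ)
    (hθt : θ * (4 * t ^ 4) ≤ r) :
    ∫⁻ ω, ENNReal.ofReal (Real.exp (-θ * X ω ^ 2)) ∂μ ≤ ENNReal.ofReal (Real.exp (-(θ * r / 2))) := by
  have hX := h.measurable
  have hle : ∀ ω, Real.exp (-θ * X ω ^ 2) ≤ 1 - θ * X ω ^ 2 + θ ^ 2 * (X ω ^ 2) ^ 2 := fun ω => by
    have := exp_neg_le_quadratic (v := θ * X ω ^ 2) (by positivity)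
    rw [← mul_pow, neg_mul]
    exact this
  have hi1 : Integrable (fun ω => 1 - θ * X ω ^ 2) μ :=
    (integrable_const 1).sub (h.integrable_sq.const_mul θ)
  have hi2 := h.integrable_sq_sq.const_mul (θ ^ 2)
  have hi3 : Integrable (fun ω => Real.exp (-θ * X ω ^ 2)) μ := by
    refine (hi1.add hi2).mono' (Measurable.aestronglyMeasurable (by fun_prop))
      (Filter.Eventually.of_forall fun ω => ?_)
    rw [Real.norm_eq_abs, abs_of_pos (Real.exp_pos _)]
    exact hle ω
  rw [← ofReal_integral_eq_lintegral_ofReal hi3 (Filter.Eventually.of_forall fun ω => by positivity)]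
  refine ENNReal.ofReal_le_ofReal ((integral_mono hi3 (hi1.add hi2) hle).trans ?_)
  have h4 := h.integral_sq_sq_le
  have hsum : ∫ ω, (1 - θ * X ω ^ 2 + θ ^ 2 * (X ω ^ 2) ^ 2) ∂μ =
      1 - θ * r + θ ^ 2 * ∫ ω, (X ω ^ 2) ^ 2 ∂μ := by
    rw [integral_add hi1 hi2, integral_sub (integrable_const 1) (h.integrable_sq.const_mul θ),
      integral_const_mul, integral_const_mul, hr]
    simp
  change ∫ ω, (1 - θ * X ω ^ 2 + θ ^ 2 * (X ω ^ 2) ^ 2) ∂μ ≤ _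
  rw [hsum]
  have h5 : θ ^ 2 * ∫ ω, (X ω ^ 2) ^ 2 ∂μ ≤ θ ^ 2 * (2 * t ^ 4) := by gcongr
  nlinarith [Real.add_one_le_exp (-(θ * r / 2))]

/-- The quadratic-plus-noise excess `U² + 2EU` has exponential moments on both sides. -/
structure ExcessConditions (μ : Measure Ω) (U E : Ω → ℝ) (Cx Ce r : ℝ) : Prop where
  measurable : Measurable U
  indep : IndepFun U E μ
  mean : ∫ ω, E ω ∂μ = 0
  noise : HasExpSqBound μ E (2 * Ce)
  second : ∫ ω, U ω ^ 2 ∂μ = r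
  sub : 0 < r → HasExpSqBound μ U (2 * Cx * √r)
  zero : r ≤ 0 → ∀ ω, U ω = 0

/-- The largest exponent that is used for the exponential moments of the excess loss. -/
noncomputable def expRate (Cx Ce : ℝ) : ℝ := 1 / (32 * Ce ^ 2 + 32 * Cx ^ 4 + 8 * Cx ^ 2)

theorem expRate_pos {Cx Ce : ℝ} (hCx : 0 < Cx) : 0 < expRate Cx Ce := by
  unfold expRate; positivity

/-- Each summand in the denominator of `expRate` serves one purpose: 32Ce² absorbs the noise into
the square, 32Cx⁴ controls the fourth moment in the drift bound, 8Cx² keeps exp(2lU²) integrable in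
the upper bound. -/
theorem mul_expRate_le {Cx Ce l : ℝ} (hCx : 0 < Cx) (hl : l ≤ expRate Cx Ce) (h0 : 0 ≤ l) :
    32 * Ce ^ 2 * l ≤ 1 ∧ 32 * Cx ^ 4 * l ≤ 1 ∧ 8 * Cx ^ 2 * l ≤ 1 := by
  have hp : 0 < 32 * Ce ^ 2 + 32 * Cx ^ 4 + 8 * Cx ^ 2 := by positivity
  unfold expRate at hl
  rw [le_div_iff₀ hp] at hl
  have h1 : 0 ≤ l * Ce ^ 2 := by positivity
  have h2 : 0 ≤ l * Cx ^ 4 := by positivity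
  have h3 : 0 ≤ l * Cx ^ 2 := by positivity
  refine ⟨?_, ?_, ?_⟩ <;> nlinarith

namespace ExcessConditions

variable [IsProbabilityMeasure μ] {U E : Ω → ℝ} {Cx Ce r l : ℝ}

/-- Integrating out the noise adds 16 l²Ce² U² to the exponent, at most half of lU². Half of the
square survives, and nothing about the size of U is needed. -/
theorem lintegral_exp_neg_excess_le (h : ExcessConditions μ U E Cx Ce r) (hCx : 0 < Cx)
    (h0 : 0 ≤ l) (hl : l ≤ expRate Cx Ce) :
    ∫⁻ ω, ENNReal.ofReal (Real.exp (-l * (U ω ^ 2 + 2 * (E ω * U ω)))) ∂μ ≤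
      ∫⁻ ω, ENNReal.ofReal (Real.exp (-(l / 2) * U ω ^ 2)) ∂μ := by
  have h1 := lintegral_exp_sq_add_mul_le h.measurable h.noise h.mean h.indep (-l) (-2 * l)
  obtain ⟨h2, -, -⟩ := mul_expRate_le hCx hl h0
  refine (le_of_eq (lintegral_congr fun ω => ?_)).trans (h1.trans (lintegral_mono fun ω =>
    ENNReal.ofReal_le_ofReal (Real.exp_le_exp.2 ?_)))
  · congr 2; ring
  · refine mul_le_mul_of_nonneg_right ?_ (sq_nonneg _)
    nlinarith

theorem lower (h : ExcessConditions μ U E Cx Ce r) (hCx : 0 < Cx)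
    (h0 : 0 ≤ l) (hl : l ≤ expRate Cx Ce) :
    ∫⁻ ω, ENNReal.ofReal (Real.exp (-l * (U ω ^ 2 + 2 * (E ω * U ω)))) ∂μ ≤ 1 := by
  refine (h.lintegral_exp_neg_excess_le hCx h0 hl).trans ?_
  calc _ ≤ ∫⁻ _, 1 ∂μ := by
        refine lintegral_mono fun ω => ?_
        rw [ENNReal.ofReal_le_one]
        refine Real.exp_le_one_iff.2 ?_
        have : 0 ≤ (l / 2) * U ω ^ 2 := by positivity
        linarith
    _ = 1 := by simp

/-- The surviving square has mean r and fourth moment of order r², so the expansion is useful only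
for l of order 1/r; this is the reason for the factor `max 1 r`. The resulting factor exp(-lr/4)
cancels the drift r/4 exactly. -/
theorem lower_drift (h : ExcessConditions μ U E Cx Ce r) (hCx : 0 < Cx)
    (h0 : 0 ≤ l) (hl : l * max 1 r ≤ expRate Cx Ce) :
    ∫⁻ ω, ENNReal.ofReal (Real.exp (l * (r / 4 - (U ω ^ 2 + 2 * (E ω * U ω))))) ∂μ ≤ 1 := by
  have hl1 : l ≤ expRate Cx Ce := (le_mul_of_one_le_right h0 (le_max_left _ _)).trans hl
  rcases lt_or_ge 0 r with hr | hr
  · have hlr : l * r ≤ expRate Cx Ce :=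
      (mul_le_mul_of_nonneg_left (le_max_right _ _) h0).trans hl
    obtain ⟨-, h3, -⟩ := mul_expRate_le hCx hlr (by positivity)
    have h2 := (h.lintegral_exp_neg_excess_le hCx h0 hl1).trans
      ((h.sub hr).lintegral_exp_neg_le h.second (by positivity : 0 ≤ l / 2) ?_)
    · have : ∀ ω, ENNReal.ofReal (Real.exp (l * (r / 4 - (U ω ^ 2 + 2 * (E ω * U ω))))) =
          ENNReal.ofReal (Real.exp (l * r / 4)) *
            ENNReal.ofReal (Real.exp (-l * (U ω ^ 2 + 2 * (E ω * U ω)))) := fun ω => by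
        rw [← ENNReal.ofReal_mul (Real.exp_pos _).le, ← Real.exp_add]
        congr 2; ring
      simp_rw [this]
      rw [lintegral_const_mul' _ _ ENNReal.ofReal_ne_top]
      refine (mul_le_mul_right h2 _).trans ?_
      rw [← ENNReal.ofReal_mul (Real.exp_pos _).le, ← Real.exp_add, ENNReal.ofReal_le_one]
      refine Real.exp_le_one_iff.2 ?_
      linarith
    · have : (2 * Cx * √r) ^ 4 = 16 * Cx ^ 4 * r ^ 2 := by
        rw [mul_pow, show √r ^ 4 = (√r ^ 2) ^ 2 by ring, Real.sq_sqrt hr.le]; ring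
      rw [this]
      nlinarith
  · have h1 : ∀ ω, U ω = 0 := h.zero hr
    calc _ ≤ ∫⁻ _, 1 ∂μ := by
          refine lintegral_mono fun ω => ?_
          rw [ENNReal.ofReal_le_one, h1 ω]
          refine Real.exp_le_one_iff.2 ?_
          have : l * r ≤ 0 := mul_nonpos_of_nonneg_of_nonpos h0 hr
          nlinarith
      _ = 1 := by simp

/-- The noise at most doubles the quadratic coefficient, and the moment generating function of 2lU²
at scale 2Cx√r is at most exp(8Cx² r l). -/
theorem upper (h : ExcessConditions μ U E Cx Ce r) (hCx : 0 < Cx)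
    (h0 : 0 ≤ l) (hl : l * max 1 r ≤ expRate Cx Ce) :
    ∫⁻ ω, ENNReal.ofReal (Real.exp (l * ((U ω ^ 2 + 2 * (E ω * U ω)) - 8 * Cx ^ 2 * r))) ∂μ ≤ 1 := by
  have hl1 : l ≤ expRate Cx Ce := (le_mul_of_one_le_right h0 (le_max_left _ _)).trans hl
  obtain ⟨h2, -, -⟩ := mul_expRate_le hCx hl1 h0
  have hr0 : 0 ≤ r := h.second ▸ integral_nonneg fun ω => sq_nonneg _
  rcases hr0.lt_or_eq with hr | hr
  · have hlr : l * r ≤ expRate Cx Ce :=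
      (mul_le_mul_of_nonneg_left (le_max_right _ _) h0).trans hl
    obtain ⟨-, -, h3⟩ := mul_expRate_le hCx hlr (by positivity)
    have hs := h.sub hr
    have ht : (2 * Cx * √r) ^ 2 = 4 * Cx ^ 2 * r := by
      rw [mul_pow, Real.sq_sqrt hr.le]; ring
    have hcond : 2 * l * (2 * Cx * √r) ^ 2 ≤ 1 := by rw [ht]; linarith
    have hi := hs.integrable_exp_mul_sq (by positivity : 0 ≤ 2 * l) hcond
    have hle := hs.integral_exp_mul_sq_le (by positivity : 0 ≤ 2 * l) hcond
    have h4 := lintegral_exp_sq_add_mul_le h.measurable h.noise h.mean h.indep l (2 * l)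
    have h5 : ∫⁻ ω, ENNReal.ofReal (Real.exp ((l + (2 * l) ^ 2 * (2 * Ce) ^ 2) * U ω ^ 2)) ∂μ ≤
        ENNReal.ofReal (Real.exp (8 * Cx ^ 2 * r * l)) := by
      calc _ ≤ ∫⁻ ω, ENNReal.ofReal (Real.exp (2 * l * U ω ^ 2)) ∂μ := by
            refine lintegral_mono fun ω => ENNReal.ofReal_le_ofReal (Real.exp_le_exp.2 ?_)
            refine mul_le_mul_of_nonneg_right ?_ (sq_nonneg _)
            nlinarith
        _ = ENNReal.ofReal (∫ ω, Real.exp (2 * l * U ω ^ 2) ∂μ) :=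
            (ofReal_integral_eq_lintegral_ofReal hi
              (Filter.Eventually.of_forall fun ω => by positivity)).symm
        _ ≤ _ := by
            refine ENNReal.ofReal_le_ofReal (hle.trans (Real.exp_le_exp.2 ?_))
            rw [ht]; linarith
    have : ∀ ω, ENNReal.ofReal
          (Real.exp (l * ((U ω ^ 2 + 2 * (E ω * U ω)) - 8 * Cx ^ 2 * r))) =
        ENNReal.ofReal (Real.exp (-(8 * Cx ^ 2 * r * l))) *
          ENNReal.ofReal (Real.exp (l * U ω ^ 2 + 2 * l * (E ω * U ω))) := fun ω => by
      rw [← ENNReal.ofReal_mul (Real.exp_pos _).le, ← Real.exp_add]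
      congr 2; ring
    simp_rw [this]
    rw [lintegral_const_mul' _ _ ENNReal.ofReal_ne_top]
    refine (mul_le_mul_right (h4.trans h5) _).trans ?_
    rw [← ENNReal.ofReal_mul (Real.exp_pos _).le, ← Real.exp_add]
    simp
  · have h1 : ∀ ω, U ω = 0 := h.zero hr.ge
    simp [h1, ← hr]

end ExcessConditions

end SubGaussian

/-! ### Chernoff bounds at an independent random parameter -/

section Decoupling

variable {Ω ι β 𝓖 : Type*} [MeasurableSpace Ω] [MeasurableSpace β] [MeasurableSpace 𝓖]
  {μ : Measure Ω}

/-- A product of nonnegative functions of independent observations and of an independent random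
parameter has mean at most one if this holds for each factor and each fixed parameter. -/
theorem lintegral_prod_le_one_of_indepFun {Z : ι → Ω → β} (hZ : ∀ i, Measurable (Z i))
    (hind : iIndepFun Z μ) {G : Ω → 𝓖} (hG : Measurable G) (T : Finset ι)
    (hGT : IndepFun G (fun ω (i : T) => Z i ω) μ) {φ : ι → 𝓖 → β → ℝ≥0∞}
    (hφ : ∀ i ∈ T, Measurable (Function.uncurry (φ i)))
    (hle : ∀ i ∈ T, ∀ g, ∫⁻ ω, φ i g (Z i ω) ∂μ ≤ 1) :
    ∫⁻ ω, ∏ i ∈ T, φ i (G ω) (Z i ω) ∂μ ≤ 1 := by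
  have : IsProbabilityMeasure μ := hind.isProbabilityMeasure
  have hV : Measurable fun ω (i : T) => Z i ω := measurable_pi_lambda _ fun i => hZ i
  have hprod := (indepFun_iff_map_prod_eq_prod_map_map hG.aemeasurable hV.aemeasurable).1 hGT
  have : IsProbabilityMeasure (μ.map G) := Measure.isProbabilityMeasure_map hG.aemeasurable
  have : IsProbabilityMeasure (μ.map fun ω (i : T) => Z i ω) :=
    Measure.isProbabilityMeasure_map hV.aemeasurable
  have hF : Measurable fun q : 𝓖 × (T → β) => ∏ i : T, φ i q.1 (q.2 i) := by
    refine Finset.measurable_prod _ fun i _ => ?_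
    exact (hφ i i.2).comp (measurable_fst.prodMk ((measurable_pi_apply i).comp measurable_snd))
  calc ∫⁻ ω, ∏ i ∈ T, φ i (G ω) (Z i ω) ∂μ
      = ∫⁻ ω, ∏ i : T, φ i (G ω) (Z i ω) ∂μ := by
        refine lintegral_congr fun ω => ?_
        exact (Finset.prod_coe_sort T fun i => φ i (G ω) (Z i ω)).symm
    _ = ∫⁻ q, ∏ i : T, φ i q.1 (q.2 i) ∂(μ.map fun ω => (G ω, fun i : T => Z i ω)) := by
        rw [lintegral_map hF (hG.prodMk hV)]
    _ = ∫⁻ g, ∫⁻ v, ∏ i : T, φ i g (v i) ∂(μ.map fun ω (i : T) => Z i ω) ∂(μ.map G) := by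
        rw [hprod, lintegral_prod _ hF.aemeasurable]
    _ ≤ ∫⁻ _, 1 ∂(μ.map G) := by
        refine lintegral_mono fun g => ?_
        have hφg : ∀ i : T, Measurable (φ i g) := fun i =>
          (hφ i i.2).comp (measurable_const.prodMk measurable_id)
        have hm : Measurable fun v : T → β => ∏ i : T, φ i g (v i) :=
          Finset.measurable_prod _ fun i _ => (hφg i).comp (measurable_pi_apply i)
        rw [lintegral_map hm hV]
        have hind' : iIndepFun (fun i : T => fun ω => φ i g (Z i ω)) μ :=
          (hind.precomp Subtype.val_injective).comp (fun i : T => φ i g) hφg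
        rw [lintegral_prod_eq_prod_lintegral_of_indepFun Finset.univ _ hind'
          fun i => (hφg i).comp (hZ i)]
        exact Finset.prod_le_one' fun i _ => hle i i.2 g
    _ = 1 := by simp

/-- Markov's inequality for the product of the exponentials. The bound exp(-t) pays neither for the
number of observations nor for the complexity of the set of parameters. -/
theorem measure_le_sum_le_exp {Z : ι → Ω → β} (hZ : ∀ i, Measurable (Z i))
    (hind : iIndepFun Z μ) {G : Ω → 𝓖} (hG : Measurable G) (T : Finset ι)
    (hGT : IndepFun G (fun ω (i : T) => Z i ω) μ) {ψ : ι → 𝓖 → β → ℝ}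
    (hψ : ∀ i ∈ T, Measurable (Function.uncurry (ψ i)))
    (hle : ∀ i ∈ T, ∀ g, ∫⁻ ω, ENNReal.ofReal (Real.exp (ψ i g (Z i ω))) ∂μ ≤ 1) (t : ℝ) :
    μ {ω | t ≤ ∑ i ∈ T, ψ i (G ω) (Z i ω)} ≤ ENNReal.ofReal (Real.exp (-t)) := by
  have h1 := lintegral_prod_le_one_of_indepFun hZ hind hG T hGT
    (φ := fun i g z => ENNReal.ofReal (Real.exp (ψ i g z)))
    (fun i hi => (Real.measurable_exp.comp (hψ i hi)).ennreal_ofReal) hle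
  have hm : Measurable fun ω => ∏ i ∈ T, ENNReal.ofReal (Real.exp (ψ i (G ω) (Z i ω))) := by
    refine Finset.measurable_prod _ fun i hi => ?_
    exact (Real.measurable_exp.comp ((hψ i hi).comp (hG.prodMk (hZ i)))).ennreal_ofReal
  have h2 := mul_meas_ge_le_lintegral (μ := μ) hm (ENNReal.ofReal (Real.exp t))
  have h3 : {ω | t ≤ ∑ i ∈ T, ψ i (G ω) (Z i ω)} ⊆ {ω | ENNReal.ofReal (Real.exp t) ≤
      ∏ i ∈ T, ENNReal.ofReal (Real.exp (ψ i (G ω) (Z i ω)))} := fun ω hω => by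
    simp only [Set.mem_ofPred_eq] at hω ⊢
    rw [← ENNReal.ofReal_prod_of_nonneg fun i _ => (Real.exp_pos _).le, ← Real.exp_sum]
    exact ENNReal.ofReal_le_ofReal (Real.exp_le_exp.2 hω)
  have h4 : ENNReal.ofReal (Real.exp t) *
      μ {ω | t ≤ ∑ i ∈ T, ψ i (G ω) (Z i ω)} ≤ 1 :=
    (mul_le_mul_right (measure_mono h3) _).trans (h2.trans h1)
  calc μ {ω | t ≤ ∑ i ∈ T, ψ i (G ω) (Z i ω)}
      = ENNReal.ofReal (Real.exp (-t)) * (ENNReal.ofReal (Real.exp t) *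
          μ {ω | t ≤ ∑ i ∈ T, ψ i (G ω) (Z i ω)}) := by
        rw [← mul_assoc, ← ENNReal.ofReal_mul (Real.exp_pos _).le, ← Real.exp_add]
        simp
    _ ≤ ENNReal.ofReal (Real.exp (-t)) * 1 := mul_le_mul_right h4 _
    _ = _ := mul_one _

end Decoupling

/-! ### The quadratic form of the covariance matrix -/

section SqNorm

variable {p : ℕ} {S : Matrix (Fin p) (Fin p) ℝ}

theorem sqNorm_nonneg (hS : S.PosDef) (v : Fin p → ℝ) : 0 ≤ sqNorm S v := by
  simpa [sqNorm] using hS.posSemidef.dotProduct_mulVec_nonneg v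

theorem sqNorm_pos (hS : S.PosDef) {v : Fin p → ℝ} (hv : v ≠ 0) : 0 < sqNorm S v := by
  simpa [sqNorm] using hS.dotProduct_mulVec_pos hv

theorem sqNorm_neg (v : Fin p → ℝ) : sqNorm S (-v) = sqNorm S v := by
  simp [sqNorm, Matrix.mulVec_neg]

theorem sqNorm_sub_comm (u v : Fin p → ℝ) : sqNorm S (u - v) = sqNorm S (v - u) := by
  rw [← sqNorm_neg, neg_sub]

theorem sqNorm_add_add_sqNorm_sub (u v : Fin p → ℝ) :
    sqNorm S (u + v) + sqNorm S (u - v) = 2 * sqNorm S u + 2 * sqNorm S v := by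
  simp only [sqNorm, Matrix.mulVec_add, Matrix.mulVec_sub, dotProduct_add, add_dotProduct,
    dotProduct_sub, sub_dotProduct]
  ring

theorem sqNorm_add_le (hS : S.PosDef) (u v : Fin p → ℝ) :
    sqNorm S (u + v) ≤ 2 * sqNorm S u + 2 * sqNorm S v := by
  linarith [sqNorm_add_add_sqNorm_sub (S := S) u v, sqNorm_nonneg hS (u - v)]

theorem sqNorm_sub_le (hS : S.PosDef) (u v w : Fin p → ℝ) :
    sqNorm S (u - w) ≤ 2 * sqNorm S (u - v) + 2 * sqNorm S (v - w) := by
  simpa using sqNorm_add_le hS (u - v) (v - w)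

theorem measurable_sqNorm : Measurable (sqNorm S) := by
  unfold sqNorm dotProduct Matrix.mulVec dotProduct
  fun_prop

theorem sqNorm_eq_sum (v : Fin p → ℝ) : sqNorm S v = ∑ a, ∑ b, v a * v b * S a b := by
  simp only [sqNorm, dotProduct, Matrix.mulVec, Finset.mul_sum]
  exact Finset.sum_congr rfl fun a _ => Finset.sum_congr rfl fun b _ => by ring

/-- The mean of finitely many vectors minimises the sum of the squared distances. -/
theorem sum_sqNorm_sub_mean_le (hS : S.PosDef) (A : Finset ℕ) (hA : A.Nonempty)
    (v : ℕ → Fin p → ℝ) (w : Fin p → ℝ) :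
    ∑ i ∈ A, sqNorm S (v i - (A.card : ℝ)⁻¹ • ∑ j ∈ A, v j) ≤ ∑ i ∈ A, sqNorm S (v i - w) := by
  set m := (A.card : ℝ)⁻¹ • ∑ j ∈ A, v j with hm
  have hcard : (A.card : ℝ) ≠ 0 := by simpa using hA.ne_empty
  have hsum : ∑ i ∈ A, (v i - m) = 0 := by
    rw [Finset.sum_sub_distrib, Finset.sum_const, hm, ← Nat.cast_smul_eq_nsmul ℝ, smul_smul,
      mul_inv_cancel₀ hcard, one_smul, sub_self]
  have hpoint : ∀ i, sqNorm S (v i - w) = sqNorm S (v i - m) +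
      ((v i - m) ⬝ᵥ S.mulVec (m - w) + (m - w) ⬝ᵥ S.mulVec (v i - m)) + sqNorm S (m - w) :=
    fun i => by
      have : v i - w = (v i - m) + (m - w) := by abel
      rw [this]
      simp only [sqNorm, Matrix.mulVec_add, dotProduct_add, add_dotProduct]
      ring
  have h1 : ∑ i ∈ A, ((v i - m) ⬝ᵥ S.mulVec (m - w) + (m - w) ⬝ᵥ S.mulVec (v i - m)) = 0 := by
    rw [Finset.sum_add_distrib, ← sum_dotProduct, ← dotProduct_sum, hsum]
    simp_rw [← Matrix.mulVecLin_apply]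
    rw [← map_sum, hsum]
    simp
  simp_rw [hpoint]
  rw [Finset.sum_add_distrib, Finset.sum_add_distrib, h1]
  have : 0 ≤ ∑ i ∈ A, sqNorm S (m - w) := Finset.sum_nonneg fun i _ => sqNorm_nonneg hS _
  linarith

end SqNorm

/-! ### Segmentations, and locality of the fits -/

section Segmentation

variable {n K : ℕ} {τ : ℕ → ℕ}

theorem IsSegmentation.lt_of_lt (h : IsSegmentation n K τ) {a b : ℕ} (hab : a < b)
    (hb : b ≤ K + 1) : τ a < τ b := by
  induction b, hab using Nat.le_induction with
  | base => exact h.lt a (by omega)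
  | succ b hab ih => exact (ih (by omega)).trans (h.lt b (by omega))

theorem IsSegmentation.le_of_le (h : IsSegmentation n K τ) {a b : ℕ} (hab : a ≤ b)
    (hb : b ≤ K + 1) : τ a ≤ τ b := by
  rcases hab.lt_or_eq with hlt | rfl
  · exact (h.lt_of_lt hlt hb).le
  · exact le_rfl

theorem IsSegmentation.le_last (h : IsSegmentation n K τ) {a : ℕ} (ha : a ≤ K + 1) : τ a ≤ n :=
  h.last ▸ h.le_of_le ha le_rfl

theorem IsSegmentation.exists_segment (h : IsSegmentation n K τ) {i : ℕ} (h0 : 0 < i)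
    (hn : i ≤ n) : ∃ k ∈ Finset.Icc 1 (K + 1), i ∈ Finset.Ioc (τ (k - 1)) (τ k) := by
  have hex : ∃ k, i ≤ τ k := ⟨K + 1, by rw [h.last]; exact hn⟩
  classical
  have hk := Nat.find_spec hex
  have hk1 : Nat.find hex ≠ 0 := fun h' => by rw [h', h.zero] at hk; omega
  refine ⟨Nat.find hex, ?_, ?_⟩
  · have := Nat.find_min' hex (show i ≤ τ (K + 1) by rw [h.last]; exact hn)
    exact Finset.mem_Icc.2 ⟨Nat.one_le_iff_ne_zero.2 hk1, this⟩
  · have := Nat.find_min hex (m := Nat.find hex - 1) (by omega)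
    exact Finset.mem_Ioc.2 ⟨not_le.1 this, hk⟩

theorem IsSegmentation.segment_unique (h : IsSegmentation n K τ) {i k k' : ℕ}
    (hk : k ∈ Finset.Icc 1 (K + 1)) (hk' : k' ∈ Finset.Icc 1 (K + 1))
    (hi : i ∈ Finset.Ioc (τ (k - 1)) (τ k)) (hi' : i ∈ Finset.Ioc (τ (k' - 1)) (τ k')) :
    k = k' := by
  simp only [Finset.mem_Icc, Finset.mem_Ioc] at *
  by_contra hne
  rcases Nat.lt_or_gt_of_ne hne with hlt | hlt
  · have := h.le_of_le (show k ≤ k' - 1 by omega) (by omega); omega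
  · have := h.le_of_le (show k' ≤ k - 1 by omega) (by omega); omega

/-- A function of the segments can be read as a function of the observations. -/
theorem IsSegmentation.exists_pointwise {α : Type*} [Inhabited α] (h : IsSegmentation n K τ)
    (f : ℕ → α) : ∃ g : ℕ → α, ∀ k ∈ Finset.Icc 1 (K + 1),
      ∀ i ∈ Finset.Ioc (τ (k - 1)) (τ k), g i = f k := by
  classical
  refine ⟨fun i => if hi : ∃ k ∈ Finset.Icc 1 (K + 1), i ∈ Finset.Ioc (τ (k - 1)) (τ k) then
    f hi.choose else default, fun k hk i hi => ?_⟩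
  have hex : ∃ k ∈ Finset.Icc 1 (K + 1), i ∈ Finset.Ioc (τ (k - 1)) (τ k) := ⟨k, hk, hi⟩
  simp only [dif_pos hex]
  rw [h.segment_unique hex.choose_spec.1 hk hex.choose_spec.2 hi]

end Segmentation

theorem IsCVLasso.measurable {p : ℕ} {fit : Finset ℕ → (ℕ → Obs p) → (Fin p → ℝ)}
    (h : IsCVLasso fit) (A : Finset ℕ) : Measurable (fit A) := by
  obtain ⟨Λ, lasso, B, V, lamHat, -, -, -, -, -, -, hm⟩ := h
  exact hm A

/-- The selected regularizer and the lasso at that regularizer both read only the data in A. This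
and measurability are the only properties of the cross-validated lasso that the argument uses. -/
theorem IsCVLasso.eq_of_eqOn {p : ℕ} {fit : Finset ℕ → (ℕ → Obs p) → (Fin p → ℝ)}
    (h : IsCVLasso fit) (A : Finset ℕ) {z z' : ℕ → Obs p} (hz : ∀ i ∈ A, z i = z' i) :
    fit A z = fit A z' := by
  obtain ⟨Λ, lasso, B, V, lamHat, -, hL, -, hmem, hdep, hfit, -⟩ := h
  rw [hfit, hfit, hdep A (x := z) (y := z') fun i hi => hz i hi]
  exact hL.dependsOn A _ (hmem A z').1 fun i hi => hz i hi

/-! ### Consequences of the linear model -/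

section Model

variable {Ω : Type*} [MeasurableSpace Ω] {μ : Measure Ω} {n p s K : ℕ} {τ : ℕ → ℕ}
  {f : ℕ → Fin p → ℝ} {S : Matrix (Fin p) (Fin p) ℝ} {σ : ℝ} {x : ℕ → Ω → Fin p → ℝ}
  {ε y : ℕ → Ω → ℝ} {Cx Ce Cf : ℝ}

/-- The excess loss of the parameter `g` over the parameter `b` which generated the observation
with covariates `w.1` and noise `w.2`. -/
def excess (b g : Fin p → ℝ) (w : (Fin p → ℝ) × ℝ) : ℝ :=
  (w.1 ⬝ᵥ (b - g)) ^ 2 + 2 * (w.2 * (w.1 ⬝ᵥ (b - g)))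

theorem measurable_excess (b : Fin p → ℝ) : Measurable (Function.uncurry (excess b)) := by
  unfold excess dotProduct Function.uncurry
  fun_prop

theorem sqLoss_sub_sqLoss {z : Obs p} {b g : Fin p → ℝ} {e : ℝ} (hz : z.1 = z.2 ⬝ᵥ b + e) :
    sqLoss z g - sqLoss z b = excess b g (z.2, e) := by
  simp only [sqLoss, excess, hz, dotProduct_sub]
  ring

theorem measurable_dotProduct_const {X : Ω → Fin p → ℝ} (hX : Measurable X) (v : Fin p → ℝ) :
    Measurable fun ω => X ω ⬝ᵥ v := by
  unfold dotProduct
  fun_prop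

namespace IsLinearModel

theorem hasExpSqBound_x (h : IsLinearModel μ (n := n) s K τ f S σ x ε y Cx Ce Cf) (hCx : 0 < Cx)
    {i : ℕ} (hi : i ∈ Finset.Icc 1 n) {v : Fin p → ℝ} (hv : 0 < sqNorm S v) :
    HasExpSqBound μ (fun ω => x i ω ⬝ᵥ v) (2 * Cx * √(sqNorm S v)) where
  measurable := measurable_dotProduct_const (h.measurable_x i hi) v
  pos := by positivity
  bound := by
    have h1 := h.subGaussian_x i hi v
    simp_rw [dotProduct_comm v] at h1
    have h2 : 0 < Cx * √(sqNorm S v) := by positivity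
    exact lintegral_exp_sq_le_two_of_subGaussianNorm_le (by positivity) (by linarith) h1

theorem hasExpSqBound_ε (h : IsLinearModel μ (n := n) s K τ f S σ x ε y Cx Ce Cf) (hCe : 0 < Ce)
    {i : ℕ} (hi : i ∈ Finset.Icc 1 n) : HasExpSqBound μ (ε i) (2 * Ce) where
  measurable := h.measurable_ε i hi
  pos := by positivity
  bound := lintegral_exp_sq_le_two_of_subGaussianNorm_le (by positivity) (by linarith)
    (h.subGaussian_ε i hi)

theorem integral_sq_x (h : IsLinearModel μ (n := n) s K τ f S σ x ε y Cx Ce Cf) (hCx : 0 < Cx)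
    {i : ℕ} (hi : i ∈ Finset.Icc 1 n) (v : Fin p → ℝ) :
    ∫ ω, (x i ω ⬝ᵥ v) ^ 2 ∂μ = sqNorm S v := by
  have hcoord : ∀ a, Integrable (fun ω => x i ω a ^ 2) μ := fun a => by
    have := (h.hasExpSqBound_x hCx hi (sqNorm_pos h.cov_posDef
      (v := Pi.single a (1 : ℝ)) (by simp))).integrable_sq
    simpa using this
  have hm : ∀ a, Measurable fun ω => x i ω a := fun a =>
    (measurable_pi_apply a).comp (h.measurable_x i hi)
  have hprod : ∀ a b, Integrable (fun ω => x i ω a * x i ω b) μ := fun a b => by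
    refine ((hcoord a).add (hcoord b)).mono' ((hm a).mul (hm b)).aestronglyMeasurable
      (Filter.Eventually.of_forall fun ω => ?_)
    simp only [Pi.add_apply, Real.norm_eq_abs, abs_mul]
    nlinarith [sq_nonneg (|x i ω a| - |x i ω b|), sq_abs (x i ω a), sq_abs (x i ω b),
      sq_nonneg (x i ω a), sq_nonneg (x i ω b)]
  have hexp : ∀ ω, (x i ω ⬝ᵥ v) ^ 2 = ∑ a, ∑ b, v a * v b * (x i ω a * x i ω b) := fun ω => by
    rw [sq, dotProduct, Finset.sum_mul_sum]
    exact Finset.sum_congr rfl fun a _ => Finset.sum_congr rfl fun b _ => by ring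
  simp_rw [hexp]
  rw [integral_finsetSum _ fun a _ => integrable_finsetSum _ fun b _ =>
    (hprod a b).const_mul _, sqNorm_eq_sum]
  refine Finset.sum_congr rfl fun a _ => ?_
  rw [integral_finsetSum _ fun b _ => (hprod a b).const_mul _]
  refine Finset.sum_congr rfl fun b _ => ?_
  rw [integral_const_mul, h.cov_x i hi]

theorem excessConditions (h : IsLinearModel μ (n := n) s K τ f S σ x ε y Cx Ce Cf) (hCx : 0 < Cx)
    (hCe : 0 < Ce) {i : ℕ} (hi : i ∈ Finset.Icc 1 n) (v : Fin p → ℝ) :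
    ExcessConditions μ (fun ω => x i ω ⬝ᵥ v) (ε i) Cx Ce (sqNorm S v) where
  measurable := measurable_dotProduct_const (h.measurable_x i hi) v
  indep := (h.indep_noise i hi).comp (measurable_dotProduct_const measurable_id v) measurable_id
  mean := h.mean_ε i hi
  noise := h.hasExpSqBound_ε hCe hi
  second := h.integral_sq_x hCx hi v
  sub := h.hasExpSqBound_x hCx hi
  zero := fun hle ω => by
    have : v = 0 := by
      by_contra hne
      exact absurd (sqNorm_pos h.cov_posDef hne) (not_lt.2 hle)
    simp [this]

/-- The cross term vanishes since the noise is centred and independent of the covariates. Hence the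
signal of a change is the squared distance of the adjacent parameters, and oracles are least-squares
centres. -/
theorem expLoss_eq [IsProbabilityMeasure μ]
    (h : IsLinearModel μ (n := n) s K τ f S σ x ε y Cx Ce Cf) (hCx : 0 < Cx)
    (hCe : 0 < Ce) {i k : ℕ} (hk : k ∈ Finset.Icc 1 (K + 1))
    (hi : i ∈ Finset.Ioc (τ (k - 1)) (τ k)) (g : Fin p → ℝ) :
    expLoss μ x y i g = sqNorm S (f k - g) + σ ^ 2 := by
  have hin : i ∈ Finset.Icc 1 n := by
    have := h.segmentation.le_last (Finset.mem_Icc.1 hk).2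
    simp only [Finset.mem_Ioc, Finset.mem_Icc] at hi ⊢
    omega
  have hc := h.excessConditions hCx hCe hin (f k - g)
  have hE := hc.noise
  have hloss : ∀ ω, sqLoss (sample x y ω i) g =
      (x i ω ⬝ᵥ (f k - g)) ^ 2 + 2 * (x i ω ⬝ᵥ (f k - g) * ε i ω) + ε i ω ^ 2 := fun ω => by
    simp only [sqLoss, sample, h.response k hk i hi ω, dotProduct_sub]
    ring
  have hU2 : Integrable (fun ω => (x i ω ⬝ᵥ (f k - g)) ^ 2) μ ∧
      Integrable (fun ω => x i ω ⬝ᵥ (f k - g)) μ := by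
    rcases lt_or_ge 0 (sqNorm S (f k - g)) with hr | hr
    · exact ⟨(hc.sub hr).integrable_sq, (hc.sub hr).integrable⟩
    · have := hc.zero hr
      simp [this]
  have hUE : Integrable (fun ω => x i ω ⬝ᵥ (f k - g) * ε i ω) μ :=
    hc.indep.integrable_mul hU2.2 hE.integrable
  have hUE0 : ∫ ω, x i ω ⬝ᵥ (f k - g) * ε i ω ∂μ = 0 := by
    rw [hc.indep.integral_fun_mul_eq_mul_integral hc.measurable.aestronglyMeasurable
      hE.measurable.aestronglyMeasurable, hc.mean, mul_zero]
  have hsum : Integrable (fun ω => (x i ω ⬝ᵥ (f k - g)) ^ 2 + 2 * (x i ω ⬝ᵥ (f k - g) * ε i ω)) μ :=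
    hU2.1.add (hUE.const_mul 2)
  unfold expLoss
  simp_rw [hloss]
  rw [integral_add hsum hE.integrable_sq,
    integral_add hU2.1 (hUE.const_mul 2), integral_const_mul, hUE0, hc.second, h.var_ε i hin]
  ring

theorem signal_eq [IsProbabilityMeasure μ]
    (h : IsLinearModel μ (n := n) s K τ f S σ x ε y Cx Ce Cf) (hCx : 0 < Cx)
    (hCe : 0 < Ce) {k : ℕ} (hk : k ∈ Finset.Icc 1 K) :
    signal μ x y τ f k = sqNorm S (f k - f (k + 1)) := by
  have hk' := Finset.mem_Icc.1 hk
  have hz : sqNorm S (0 : Fin p → ℝ) = 0 := by simp [sqNorm]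
  have h1 : ∀ g, expLoss μ x y (τ k) g = sqNorm S (f k - g) + σ ^ 2 := fun g =>
    h.expLoss_eq hCx hCe (by simp; omega) (by
      have := h.segmentation.lt_of_lt (show k - 1 < k by omega) (by omega)
      simp; omega) g
  have h2 : ∀ g, expLoss μ x y (τ k + 1) g = sqNorm S (f (k + 1) - g) + σ ^ 2 := fun g =>
    h.expLoss_eq hCx hCe (by simp; omega) (by
      have := h.segmentation.lt_of_lt (show k < k + 1 by omega) (by omega)
      simp; omega) g
  rw [signal, h1, h1, h2, h2, sub_self, sub_self, hz, sqNorm_sub_comm (f (k + 1))]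
  simp

theorem signal_pos [IsProbabilityMeasure μ]
    (h : IsLinearModel μ (n := n) s K τ f S σ x ε y Cx Ce Cf) (hCx : 0 < Cx)
    (hCe : 0 < Ce) {k : ℕ} (hk : k ∈ Finset.Icc 1 K) : 0 < signal μ x y τ f k := by
  rw [h.signal_eq hCx hCe hk]
  exact sqNorm_pos h.cov_posDef (sub_ne_zero.2 (h.change k hk))

/-- A bound on the upper tail of a sum over held-out observations, uniformly in the fit. -/
theorem measure_fit_tail_le
    (h : IsLinearModel μ (n := n) s K τ f S σ x ε y Cx Ce Cf) {b : ℕ → Fin p → ℝ}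
    (hb : ∀ i ∈ Finset.Icc 1 n, ∀ ω, y i ω = x i ω ⬝ᵥ b i + ε i ω)
    {fit : Finset ℕ → (ℕ → Obs p) → (Fin p → ℝ)} (hfit : IsCVLasso fit)
    {A T : Finset ℕ} (hA : A ⊆ Finset.Icc 1 n) (hT : T ⊆ Finset.Icc 1 n) (hAT : Disjoint A T)
    {ψ : ℕ → (Fin p → ℝ) → (Fin p → ℝ) × ℝ → ℝ}
    (hψ : ∀ i ∈ T, Measurable (Function.uncurry (ψ i)))
    (hle : ∀ i ∈ T, ∀ g, ∫⁻ ω, ENNReal.ofReal (Real.exp (ψ i g (x i ω, ε i ω))) ∂μ ≤ 1) (t : ℝ) :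
    μ {ω | t ≤ ∑ i ∈ T, ψ i (fit A (sample x y ω)) (x i ω, ε i ω)} ≤
      ENNReal.ofReal (Real.exp (-t)) := by
  classical
  let Z : Finset.Icc 1 n → Ω → (Fin p → ℝ) × ℝ := fun i ω => (x i ω, ε i ω)
  have hZ : ∀ i, Measurable (Z i) := fun i =>
    (h.measurable_x i i.2).prodMk (h.measurable_ε i i.2)
  let A' : Finset (Finset.Icc 1 n) := A.subtype _
  let T' : Finset (Finset.Icc 1 n) := T.subtype _
  have hAT' : Disjoint A' T' := by
    rw [Finset.disjoint_left]
    intro i hi hi'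
    exact Finset.disjoint_left.1 hAT (Finset.mem_subtype.1 hi) (Finset.mem_subtype.1 hi')
  -- Rebuilds the sample on A from the independent pairs (x, ε) and puts 0 elsewhere. The fit cannot
  -- see the difference, so it is a measurable function of the pairs in A alone, hence independent
  -- of those in T.
  let H : (A' → (Fin p → ℝ) × ℝ) → (ℕ → Obs p) := fun v i =>
    if hi : i ∈ A then
      ((v ⟨⟨i, hA hi⟩, Finset.mem_subtype.2 hi⟩).1 ⬝ᵥ b i +
        (v ⟨⟨i, hA hi⟩, Finset.mem_subtype.2 hi⟩).2,
        (v ⟨⟨i, hA hi⟩, Finset.mem_subtype.2 hi⟩).1)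
    else 0
  have hH : Measurable H := by
    refine measurable_pi_lambda _ fun i => ?_
    by_cases hi : i ∈ A
    · simp only [H, dif_pos hi, dotProduct]
      fun_prop
    · simp only [H, dif_neg hi]
      fun_prop
  let G : Ω → Fin p → ℝ := fun ω => fit A (H fun i : A' => Z i ω)
  have hG : ∀ ω, fit A (sample x y ω) = G ω := fun ω => hfit.eq_of_eqOn A fun i hi => by
    simp only [sample, H, dif_pos hi, Z, hb i (hA hi) ω]
  have hGm : Measurable G := (hfit.measurable A).comp
    (hH.comp (measurable_pi_lambda _ fun i => hZ i))
  have hind : IndepFun G (fun ω (i : T') => Z i ω) μ :=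
    (h.indep.indepFun_finset A' T' hAT' hZ).comp ((hfit.measurable A).comp hH) measurable_id
  have key := measure_le_sum_le_exp hZ h.indep hGm T' hind (ψ := fun i => ψ i)
    (fun i hi => hψ i (Finset.mem_subtype.1 hi)) (fun i hi => hle i (Finset.mem_subtype.1 hi)) t
  refine le_trans (le_of_eq ?_) key
  congr 1
  ext ω
  simp only [Set.mem_ofPred_eq, hG, T']
  rw [← Finset.sum_subtype_of_mem (p := (· ∈ Finset.Icc 1 n))
    (fun i => ψ i (G ω) (x i ω, ε i ω)) fun i hi => hT hi]

end IsLinearModel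

end Model

/-! ### Replacing a block of a segmentation -/

section Splice

/-- The sum of a segment cost over the first `K` segments of a segmentation. -/
def segSum (E : ℕ → ℕ → ℝ) (K : ℕ) (τ : ℕ → ℕ) : ℝ :=
  ∑ t ∈ Finset.range K, E (τ t) (τ (t + 1))

/-- Replace the points of `τ` between the indices `a` and `a + N` by `w 0, …, w q`. -/
def splice (τ w : ℕ → ℕ) (a q N t : ℕ) : ℕ :=
  if t ≤ a then τ t else if t ≤ a + q then w (t - a) else τ (t - q + N)

variable {τ w : ℕ → ℕ} {a q N : ℕ}

theorem splice_left {t : ℕ} (ht : t ≤ a) : splice τ w a q N t = τ t := by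
  simp [splice, ht]

theorem splice_mid (h0 : w 0 = τ a) {i : ℕ} (hi : i ≤ q) : splice τ w a q N (a + i) = w i := by
  rcases Nat.eq_zero_or_pos i with rfl | hpos
  · simp [splice, h0]
  · simp [splice, hi]; omega

theorem splice_right (h0 : w 0 = τ a) (hq : w q = τ (a + N)) (i : ℕ) :
    splice τ w a q N (a + q + i) = τ (a + N + i) := by
  rcases Nat.eq_zero_or_pos i with rfl | hpos
  · rw [add_zero, splice_mid h0 le_rfl, hq, add_zero]
  · unfold splice
    rw [if_neg (by omega), if_neg (by omega)]
    congr 1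
    omega

theorem segSum_add (E : ℕ → ℕ → ℝ) (m k : ℕ) (τ : ℕ → ℕ) :
    segSum E (m + k) τ = segSum E m τ + ∑ t ∈ Finset.range k, E (τ (m + t)) (τ (m + t + 1)) := by
  simp only [segSum, Finset.sum_range_add]

theorem segSum_splice (E : ℕ → ℕ → ℝ) (h0 : w 0 = τ a) (hq : w q = τ (a + N)) (r : ℕ) :
    segSum E (a + q + r) (splice τ w a q N) +
        ∑ t ∈ Finset.range N, E (τ (a + t)) (τ (a + t + 1)) =
      segSum E (a + N + r) τ + ∑ t ∈ Finset.range q, E (w t) (w (t + 1)) := by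
  have h1 : segSum E a (splice τ w a q N) = segSum E a τ := by
    refine Finset.sum_congr rfl fun t ht => ?_
    have := Finset.mem_range.1 ht
    rw [splice_left (by omega), splice_left (by omega)]
  have h2 : ∑ t ∈ Finset.range q, E (splice τ w a q N (a + t)) (splice τ w a q N (a + t + 1)) =
      ∑ t ∈ Finset.range q, E (w t) (w (t + 1)) := by
    refine Finset.sum_congr rfl fun t ht => ?_
    have := Finset.mem_range.1 ht
    rw [add_assoc, splice_mid h0 (by omega), splice_mid h0 (by omega)]
  have h3 : ∑ t ∈ Finset.range r, E (splice τ w a q N (a + q + t))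
        (splice τ w a q N (a + q + t + 1)) =
      ∑ t ∈ Finset.range r, E (τ (a + N + t)) (τ (a + N + t + 1)) := by
    refine Finset.sum_congr rfl fun t _ => ?_
    rw [add_assoc (a + q), splice_right h0 hq, splice_right h0 hq, add_assoc (a + N)]
  rw [segSum_add, segSum_add, segSum_add, segSum_add, h1, h2, h3]
  ring

theorem isAdmissible_splice {n K : ℕ} {dm : ℝ} (hdm : 0 < dm) (hτ : IsAdmissible n dm K τ)
    (h0 : w 0 = τ a) (hq : w q = τ (a + N)) (hN : a + N ≤ K + 1) (hq0 : 0 < q)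
    (hw : ∀ t < q, dm ≤ (w (t + 1) : ℝ) - (w t : ℝ)) :
    IsAdmissible n dm (K + q - N) (splice τ w a q N) := by
  obtain ⟨r, hr⟩ := Nat.exists_eq_add_of_le hN
  -- The truncated subtraction is harmless because q is positive and N ≤ K + 1.
  have hK : K + q - N + 1 = a + q + r := by omega
  have hlen : ∀ k ≤ K + q - N,
      dm ≤ (splice τ w a q N (k + 1) : ℝ) - (splice τ w a q N k : ℝ) := fun k hk => by
    rcases lt_or_ge k a with h | h
    · rw [splice_left (by omega), splice_left (by omega)]
      exact hτ.2 k (by omega)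
    · obtain ⟨i, rfl⟩ := Nat.exists_eq_add_of_le h
      rcases lt_or_ge i q with h' | h'
      · rw [add_assoc, splice_mid h0 (by omega), splice_mid h0 (by omega)]
        exact hw i h'
      · obtain ⟨t, rfl⟩ := Nat.exists_eq_add_of_le h'
        rw [← add_assoc, add_assoc (a + q), splice_right h0 hq, splice_right h0 hq, ← add_assoc]
        exact hτ.2 _ (by omega)
  refine ⟨⟨?_, ?_, fun k hk => ?_⟩, hlen⟩
  · rw [splice_left (Nat.zero_le _), hτ.1.zero]
  · rw [hK, splice_right h0 hq, ← hr, hτ.1.last]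
  · have := hlen k hk
    have h' : (splice τ w a q N k : ℝ) < splice τ w a q N (k + 1) := by linarith
    exact_mod_cast h'

end Splice

/-! ### Deterministic analysis of the penalised search -/

section Search

/-- The lower bound, in units of the rate, on the cost of a segment which contains a window around
the `k`-th changepoint: `bl` for the large window and `bs` for the small one. -/
noncomputable def windowGain (τ : ℕ → ℕ) (v : ℕ → ℝ) (d Cs Cl bs bl : ℝ) (l e k : ℕ) : ℝ :=
  if (l : ℝ) + Cl * d * v k < τ k ∧ (τ k : ℝ) + Cl * d * v k < e then bl
  else if (l : ℝ) + Cs * d * v k < τ k ∧ (τ k : ℝ) + Cs * d * v k < e then bs else 0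

/-- Deterministic bounds on the segment costs under which the penalised search succeeds. -/
structure SearchBounds (n K : ℕ) (τ : ℕ → ℕ) (v : ℕ → ℝ) (d : ℝ) (E : ℕ → ℕ → ℝ)
    (Cs Cl bs bl c2 c3 c4 Cγ : ℝ) : Prop where
  seg : IsSegmentation n K τ
  d_pos : 0 < d
  v_nonneg : ∀ k, 0 ≤ v k
  v_zero : v 0 = 0
  v_last : v (K + 1) = 0
  gap : ∀ j k, j < k → k ≤ K + 1 → (Cl + 1) * d * (v j + v k + 2) ≤ (τ k : ℝ) - τ j
  lower : ∀ l e, l < e → e ≤ n →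
    (∑ k ∈ Finset.Icc 1 K, windowGain τ v d Cs Cl bs bl l e k) * d - c2 * d ≤ E l e
  upper : ∀ k ∈ Finset.Icc 1 (K + 1), ∀ l e, l < e → e ≤ n → ∀ D₁ D₂, 0 ≤ D₁ → D₁ ≤ Cs →
    0 ≤ D₂ → D₂ ≤ Cs → |(l : ℝ) - τ (k - 1)| ≤ D₁ * d * v (k - 1) →
    |(e : ℝ) - τ k| ≤ D₂ * d * v k → E l e ≤ (c3 + c4 * (D₁ + D₂)) * d
  Cs_nonneg : 0 ≤ Cs
  Cs_le : Cs ≤ Cl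
  bs_nonneg : 0 ≤ bs
  -- Write H = c3 + c2 + 2 c4 Cs for the fixed loss of one replacement. The conditions below say
  -- that a changepoint missed at the small scale pays for one old and one new segment, and that a
  -- superfluous estimate, or a changepoint missed at the large scale, each yields a net saving of
  -- at least H + 1.
  bs_ge : c2 + c3 ≤ bs
  bs_le : bs ≤ bl
  H_nonneg : 0 ≤ c3 + c2 + 2 * c4 * Cs
  Cγ_ge : c2 + (c3 + c2 + 2 * c4 * Cs) + 1 ≤ Cγ
  bl_ge : Cγ + c3 + (c3 + c2 + 2 * c4 * Cs) + 1 ≤ bl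

/-- The index `t` of the segmentation `τh` is within `C d v k` of the `k`-th changepoint. -/
def IsNear (τ τh : ℕ → ℕ) (v : ℕ → ℝ) (d C : ℝ) (t k : ℕ) : Prop :=
  |(τh t : ℝ) - τ k| ≤ C * d * v k

namespace SearchBounds

variable {n K : ℕ} {τ : ℕ → ℕ} {v : ℕ → ℝ} {d : ℝ} {E : ℕ → ℕ → ℝ}
  {Cs Cl bs bl c2 c3 c4 Cγ : ℝ} {Kh : ℕ} {τh : ℕ → ℕ}

theorem isNear_mono (H : SearchBounds n K τ v d E Cs Cl bs bl c2 c3 c4 Cγ) {t k : ℕ}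
    (h : IsNear τ τh v d Cs t k) : IsNear τ τh v d Cl t k :=
  le_trans h (by
    have := H.d_pos
    have := H.v_nonneg k
    have := H.Cs_le
    gcongr)

/-- The spacing exceeds the two large windows by at least 2d. So points of distinct windows keep
their order, and replacements built from them satisfy the minimal length d. -/
theorem add_le_of_isNear (H : SearchBounds n K τ v d E Cs Cl bs bl c2 c3 c4 Cγ) {a b j k : ℕ}
    (hjk : j < k) (hk : k ≤ K + 1) (ha : IsNear τ τh v d Cl a j) (hb : IsNear τ τh v d Cl b k) :
    (τh a : ℝ) + d ≤ τh b := by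
  have h1 := H.gap j k hjk hk
  have h2 := (abs_le.1 ha).2
  have h3 := (abs_le.1 hb).1
  have h4 := H.Cs_nonneg.trans H.Cs_le
  have h5 : 0 ≤ Cl * d := mul_nonneg h4 H.d_pos.le
  have h6 : 0 ≤ d * v j := mul_nonneg H.d_pos.le (H.v_nonneg j)
  have h7 : 0 ≤ d * v k := mul_nonneg H.d_pos.le (H.v_nonneg k)
  have h8 := H.d_pos
  nlinarith

theorem windowGain_nonneg (H : SearchBounds n K τ v d E Cs Cl bs bl c2 c3 c4 Cγ) (l e k : ℕ) :
    0 ≤ windowGain τ v d Cs Cl bs bl l e k := by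
  unfold windowGain
  split_ifs
  · exact H.bs_nonneg.trans H.bs_le
  · exact H.bs_nonneg
  · exact le_rfl

theorem lt_of_isNear (H : SearchBounds n K τ v d E Cs Cl bs bl c2 c3 c4 Cγ)
    (hτh : IsSegmentation n Kh τh) {a b j k : ℕ} (haK : a ≤ Kh + 1)
    (hjk : j < k) (hk : k ≤ K + 1) (ha : IsNear τ τh v d Cl a j) (hb : IsNear τ τh v d Cl b k) :
    a < b := by
  by_contra hab
  have h1 := H.add_le_of_isNear hjk hk ha hb
  have h2 := hτh.le_of_le (not_lt.1 hab) haK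
  have h3 : (τh b : ℝ) ≤ τh a := by exact_mod_cast h2
  linarith [H.d_pos]

/-- A changepoint that is not close to any estimate lies well inside an estimated segment. -/
theorem exists_segment_of_not_isNear (H : SearchBounds n K τ v d E Cs Cl bs bl c2 c3 c4 Cγ)
    (hτh : IsSegmentation n Kh τh) {a b j k i : ℕ} (haK : a ≤ Kh + 1)
    (hji : j < i) (hik : i < k) (hk : k ≤ K + 1) (ha : IsNear τ τh v d Cs a j)
    (hb : IsNear τ τh v d Cs b k) :
    ∃ m, a ≤ m ∧ m + 1 ≤ b ∧ ∀ C, (∀ t ≤ Kh + 1, ¬ IsNear τ τh v d C t i) →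
      (τh m : ℝ) + C * d * v i < τ i ∧ (τ i : ℝ) + C * d * v i < τh (m + 1) := by
  have hCl := H.Cs_nonneg.trans H.Cs_le
  have h1 : (τh a : ℝ) + d ≤ τ i := by
    have h1 := H.gap j i hji (by omega)
    have h2 := (abs_le.1 (H.isNear_mono ha)).2
    have h5 : 0 ≤ Cl * d := mul_nonneg hCl H.d_pos.le
    nlinarith [mul_nonneg H.d_pos.le (H.v_nonneg j), mul_nonneg H.d_pos.le (H.v_nonneg i),
      mul_nonneg h5 (H.v_nonneg i), H.d_pos]
  have h2 : (τ i : ℝ) + d ≤ τh b := by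
    have h1 := H.gap i k hik (by omega)
    have h2 := (abs_le.1 (H.isNear_mono hb)).1
    have h5 : 0 ≤ Cl * d := mul_nonneg hCl H.d_pos.le
    nlinarith [mul_nonneg H.d_pos.le (H.v_nonneg i), mul_nonneg H.d_pos.le (H.v_nonneg k),
      mul_nonneg h5 (H.v_nonneg i), H.d_pos]
  have hd := H.d_pos
  have h1' : τh a < τ i := by
    have : (τh a : ℝ) < τ i := by linarith
    exact_mod_cast this
  have h2' : τ i < τh b := by
    have : (τ i : ℝ) < τh b := by linarith
    exact_mod_cast this
  obtain ⟨m, hm, hi⟩ := hτh.exists_segment (i := τ i) (by omega) (H.seg.le_last (by omega))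
  rw [Finset.mem_Icc] at hm
  rw [Finset.mem_Ioc] at hi
  have ham : a < m := by
    by_contra h
    have := hτh.le_of_le (not_lt.1 h) haK
    omega
  have hmb : m ≤ b := by
    by_contra h
    have := hτh.le_of_le (show b ≤ m - 1 by omega) (by omega)
    omega
  -- The segment is fixed before C, so that the small and the large scale refer to the same segment.
  refine ⟨m - 1, by omega, by omega, fun C hC => ?_⟩
  have e1 : m - 1 + 1 = m := by omega
  rw [e1]
  have h3 := hC (m - 1) (by omega)
  have h4 := hC m hm.2
  have h5 : (τh (m - 1) : ℝ) < τ i := by exact_mod_cast hi.1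
  have h6 : (τ i : ℝ) ≤ τh m := by exact_mod_cast hi.2
  unfold IsNear at h3 h4
  rw [not_le, abs_of_neg (by linarith)] at h3
  rw [not_le, abs_of_nonneg (by linarith)] at h4
  constructor <;> linarith

/-- Between two changepoints with close estimates, all the changepoints are estimated within the
large windows and the number of estimates is correct. -/
theorem between_of_isNear (H : SearchBounds n K τ v d E Cs Cl bs bl c2 c3 c4 Cγ)
    (hτh : IsAdmissible n d Kh τh)
    (hmin : ∀ K' τ', IsAdmissible n d K' τ' →
      segSum E (Kh + 1) τh + Cγ * d * Kh ≤ segSum E (K' + 1) τ' + Cγ * d * K')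
    {a b j k : ℕ} (haK : a ≤ Kh + 1) (hbK : b ≤ Kh + 1) (hjk : j < k) (hk : k ≤ K + 1)
    (ha : IsNear τ τh v d Cs a j) (hb : IsNear τ τh v d Cs b k)
    (hun : ∀ i, j < i → i < k → ∀ t ≤ Kh + 1, ¬ IsNear τ τh v d Cs t i) :
    b - a = k - j ∧ ∀ i, j < i → i < k → ∃ t ≤ Kh + 1, IsNear τ τh v d Cl t i := by
  classical
  have hd := H.d_pos
  have hCs := H.Cs_nonneg
  have hab : a < b := H.lt_of_isNear hτh.1 haK hjk hk (H.isNear_mono ha) (H.isNear_mono hb)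
  obtain ⟨N, rfl⟩ := Nat.exists_eq_add_of_lt hab
  obtain ⟨q, rfl⟩ := Nat.exists_eq_add_of_lt hjk
  rw [add_assoc] at hbK hjk hk hab
  rw [add_assoc a, add_assoc j] at hb
  rw [add_assoc a, add_assoc j, Nat.add_sub_cancel_left, Nat.add_sub_cancel_left]
  rw [add_assoc j] at hun
  -- the replacement
  let w : ℕ → ℕ := fun t => if t = 0 then τh a else if t = q + 1 then τh (a + (N + 1)) else τ (j + t)
  have hw0 : w 0 = τh a := rfl
  have hwq : w (q + 1) = τh (a + (N + 1)) := by simp [w]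
  -- Only the two outer points of the replacement are estimates; the inner ones are exact. The
  -- misalignment charge c4 Cs is thus paid twice in all, however many changepoints lie between.
  have hwnear : ∀ t ≤ q + 1, IsNear τ w v d
      ((if t = 0 then Cs else 0) + (if t = q + 1 then Cs else 0)) t (j + t) := fun t ht => by
    rcases Nat.eq_zero_or_pos t with rfl | hpos
    · simpa [w, IsNear] using ha
    · by_cases h : t = q + 1
      · subst h
        simpa [w, IsNear] using hb
      · simp [w, IsNear, h, hpos.ne']
  have hDle : ∀ t, 0 ≤ (if t = 0 then Cs else 0) + (if t = q + 1 then Cs else 0) ∧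
      (if t = 0 then Cs else 0) + (if t = q + 1 then Cs else 0) ≤ Cs := fun t => by
    split_ifs <;> first | omega | constructor <;> linarith
  have hwCs : ∀ t ≤ q + 1, IsNear τ w v d Cs t (j + t) := fun t ht =>
    (hwnear t ht).trans (by
      have := H.v_nonneg (j + t)
      gcongr
      exact (hDle t).2)
  have hwlen : ∀ t < q + 1, d ≤ (w (t + 1) : ℝ) - w t := fun t ht => by
    have := H.add_le_of_isNear (τh := w) (show j + t < j + (t + 1) by omega) (by omega)
      (H.isNear_mono (hwCs t (by omega))) (H.isNear_mono (hwCs (t + 1) (by omega)))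
    linarith
  have hadm := isAdmissible_splice hd hτh hw0 hwq hbK (Nat.succ_pos q) hwlen
  have hopt := hmin _ _ hadm
  obtain ⟨r, hr⟩ := Nat.exists_eq_add_of_le hbK
  have hsplice := segSum_splice E hw0 hwq r
  rw [← hr, show a + (q + 1) + r = Kh + (q + 1) - (N + 1) + 1 by omega] at hsplice
  have hKcast : ((Kh + (q + 1) - (N + 1) : ℕ) : ℝ) = (Kh : ℝ) + q - N := by
    rw [Nat.cast_sub (by omega)]; push_cast; ring
  rw [hKcast] at hopt
  -- upper bound on the new segments
  have hτmono : ∀ t ≤ Kh + 1, τh t ≤ n := fun t ht => hτh.1.le_last ht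
  have hwn : ∀ t < q + 1, w (t + 1) ≤ n := fun t ht => by
    by_cases h : t = q
    · rw [h, hwq]
      exact hτmono _ hbK
    · rw [show w (t + 1) = τ (j + (t + 1)) by simp [w, h]]
      exact H.seg.le_last (by omega)
  have hnew : ∑ t ∈ Finset.range (q + 1), E (w t) (w (t + 1)) ≤
      ((q + 1) * c3 + 2 * c4 * Cs) * d := by
    have hstep : ∀ t ∈ Finset.range (q + 1), E (w t) (w (t + 1)) ≤
        (c3 + c4 * ((if t = 0 then Cs else 0) + (if t = q then Cs else 0))) * d := fun t ht => by
      have ht := Finset.mem_range.1 ht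
      have h1 := hwnear t (by omega)
      have h2 := hwnear (t + 1) (by omega)
      have e1 : (if t = 0 then Cs else 0) + (if t = q + 1 then Cs else 0) =
          if t = 0 then Cs else 0 := by
        rw [if_neg (show ¬ t = q + 1 by omega), add_zero]
      have e2 : (if t + 1 = 0 then Cs else 0) + (if t + 1 = q + 1 then Cs else 0) =
          if t = q then Cs else 0 := by
        simp
      rw [e1] at h1
      rw [e2] at h2
      have hlt : w t < w (t + 1) := by
        have := hwlen t ht
        have h' : (w t : ℝ) < w (t + 1) := by linarith
        exact_mod_cast h'
      refine H.upper (j + (t + 1)) (by simp; omega) (w t) (w (t + 1)) hlt (hwn t ht) _ _ ?_ ?_ ?_ ?_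
        ?_ h2
      · split_ifs <;> linarith
      · split_ifs <;> linarith
      · split_ifs <;> linarith
      · split_ifs <;> linarith
      · exact h1
    refine (Finset.sum_le_sum hstep).trans (le_of_eq ?_)
    rw [← Finset.sum_mul, Finset.sum_add_distrib, ← Finset.mul_sum, Finset.sum_add_distrib,
      Finset.sum_ite_eq' (Finset.range (q + 1)) 0, Finset.sum_ite_eq' (Finset.range (q + 1)) q,
      if_pos (Finset.mem_range.2 (Nat.succ_pos q)), if_pos (Finset.mem_range.2 (Nat.lt_succ_self q)),
      Finset.sum_const, Finset.card_range, nsmul_eq_mul]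
    push_cast
    ring
  -- lower bound on the old segments
  let U := Finset.Ioo j (j + (q + 1))
  let near : ℕ → Prop := fun i => ∃ t ≤ Kh + 1, IsNear τ τh v d Cl t i
  let Ul := U.filter fun i => ¬ near i
  let Us := U.filter near
  have hU : Us.card + Ul.card = q := by
    rw [Finset.card_filter_add_card_filter_not, Nat.card_Ioo]
    omega
  have hUK : U ⊆ Finset.Icc 1 K := fun i hi => by
    simp only [U, Finset.mem_Ioo, Finset.mem_Icc] at hi ⊢; omega
  have hgain : ∀ i ∈ U, (if near i then bs else bl) ≤
      ∑ t ∈ Finset.range (N + 1),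
        windowGain τ v d Cs Cl bs bl (τh (a + t)) (τh (a + t + 1)) i := fun i hi => by
    have hi' := Finset.mem_Ioo.1 hi
    obtain ⟨m, ham, hmb, hm⟩ := H.exists_segment_of_not_isNear hτh.1 haK hi'.1 hi'.2 hk ha hb
    obtain ⟨t, rfl⟩ := Nat.exists_eq_add_of_le ham
    have hsingle : windowGain τ v d Cs Cl bs bl (τh (a + t)) (τh (a + t + 1)) i ≤
        ∑ t ∈ Finset.range (N + 1),
          windowGain τ v d Cs Cl bs bl (τh (a + t)) (τh (a + t + 1)) i :=
      Finset.single_le_sum (f := fun t =>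
        windowGain τ v d Cs Cl bs bl (τh (a + t)) (τh (a + t + 1)) i)
        (fun t _ => H.windowGain_nonneg _ _ _) (Finset.mem_range.2 (by omega))
    refine le_trans ?_ hsingle
    have hs := hm Cs (hun i hi'.1 hi'.2)
    unfold windowGain
    by_cases hn : near i
    · rw [if_pos hn]
      split_ifs
      · exact H.bs_le
      · exact le_rfl
    · rw [if_neg hn, if_pos]
      exact hm Cl fun t ht hnear => hn ⟨t, ht, hnear⟩
  have hold : (Us.card * bs + Ul.card * bl - (N + 1) * c2) * d ≤
      ∑ t ∈ Finset.range (N + 1), E (τh (a + t)) (τh (a + t + 1)) := by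
    have hstep : ∀ t ∈ Finset.range (N + 1),
        (∑ i ∈ U, windowGain τ v d Cs Cl bs bl (τh (a + t)) (τh (a + t + 1)) i) * d - c2 * d ≤
          E (τh (a + t)) (τh (a + t + 1)) := fun t ht => by
      have ht := Finset.mem_range.1 ht
      refine le_trans ?_ (H.lower _ _ (hτh.1.lt (a + t) (by omega)) (hτmono _ (by omega)))
      gcongr ?_ * d - _
      exact Finset.sum_le_sum_of_subset_of_nonneg hUK fun i _ _ => H.windowGain_nonneg _ _ _
    refine le_trans ?_ (Finset.sum_le_sum hstep)
    rw [Finset.sum_sub_distrib, ← Finset.sum_mul, Finset.sum_comm]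
    have h1 := Finset.sum_le_sum hgain
    rw [Finset.sum_ite, Finset.sum_const, Finset.sum_const, nsmul_eq_mul, nsmul_eq_mul] at h1
    have h2 := mul_le_mul_of_nonneg_right h1 hd.le
    simp only [Finset.sum_const, Finset.card_range, nsmul_eq_mul]
    push_cast
    linarith
  -- the changepoints with an estimate in the large window
  have hcount : Us.card ≤ N := by
    have hex : ∀ i, ∃ t, near i → t ≤ Kh + 1 ∧ IsNear τ τh v d Cl t i := fun i => by
      by_cases h : near i
      · obtain ⟨t, ht⟩ := h
        exact ⟨t, fun _ => ht⟩
      · exact ⟨0, fun h' => absurd h' h⟩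
    choose idx hidx using hex
    have hcard : Us.card ≤ (Finset.Ioo a (a + (N + 1))).card := by
      refine Finset.card_le_card_of_injOn idx (fun i hi => ?_) ?_
      · obtain ⟨hiU, hin⟩ := Finset.mem_filter.1 hi
        have hiU := Finset.mem_Ioo.1 hiU
        obtain ⟨h1, h2⟩ := hidx i hin
        simp only [Finset.coe_Ioo, Set.mem_Ioo]
        exact ⟨H.lt_of_isNear hτh.1 haK hiU.1 (by omega) (H.isNear_mono ha) h2,
          H.lt_of_isNear hτh.1 h1 hiU.2 hk h2 (H.isNear_mono hb)⟩
      · intro i hi i' hi' heq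
        obtain ⟨hiU, hin⟩ := Finset.mem_filter.1 hi
        obtain ⟨hiU', hin'⟩ := Finset.mem_filter.1 hi'
        have hiU := Finset.mem_Ioo.1 hiU
        have hiU' := Finset.mem_Ioo.1 hiU'
        obtain ⟨h1, h2⟩ := hidx i hin
        obtain ⟨h1', h2'⟩ := hidx i' hin'
        by_contra hne
        rcases Nat.lt_or_gt_of_ne hne with h | h
        · have := H.lt_of_isNear hτh.1 h1 h (by omega) h2 h2'
          omega
        · have := H.lt_of_isNear hτh.1 h1' h (by omega) h2' h2
          omega
    rw [Nat.card_Ioo] at hcard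
    omega
  -- e counts the inner estimates in excess of those needed for the changepoints in `Us`.
  obtain ⟨e, he⟩ := Nat.exists_eq_add_of_le hcount
  have hNr : (N : ℝ) = Us.card + e := by rw [he]; push_cast; ring
  have hqr : (q : ℝ) = Us.card + Ul.card := by rw [← hU]; push_cast; ring
  -- Divided by d, and with N = |Us| + e and q = |Us| + |Ul|, this reads |Us|(bs - c2 - c3) +
  -- |Ul|(bl - c3 - Cγ) + e(Cγ - c2) ≤ c3 + c2 + 2 c4 Cs. The first coefficient is nonnegative and
  -- the other two exceed the right side by at least 1, so |Ul| = e = 0.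
  have hfin : (Us.card * bs + Ul.card * bl - (N + 1) * c2) * d ≤
      ((q + 1) * c3 + 2 * c4 * Cs + Cγ * (q - N)) * d := by
    nlinarith
  have hfin' := le_of_mul_le_mul_right hfin hd
  rw [hNr, hqr] at hfin'
  have hs0 : (0 : ℝ) ≤ Us.card := Nat.cast_nonneg _
  have hl0 : (0 : ℝ) ≤ Ul.card := Nat.cast_nonneg _
  have he0 : (0 : ℝ) ≤ e := Nat.cast_nonneg _
  have hHn := H.H_nonneg
  have hlt : ((Ul.card + e : ℕ) : ℝ) < 1 := by
    push_cast
    by_contra hge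
    have hge := not_lt.1 hge
    have i1 := mul_le_mul_of_nonneg_left H.bl_ge hl0
    have i2 := mul_le_mul_of_nonneg_left H.bs_ge hs0
    have i3 := mul_le_mul_of_nonneg_left H.Cγ_ge he0
    nlinarith
  have hzero : Ul.card + e = 0 := by
    have : Ul.card + e < 1 := by exact_mod_cast hlt
    omega
  refine ⟨by omega, fun i hji hik => ?_⟩
  by_contra hn
  have : i ∈ Ul := Finset.mem_filter.2 ⟨Finset.mem_Ioo.2 ⟨hji, hik⟩, hn⟩
  have := Finset.card_pos.2 ⟨i, this⟩
  omega

/-- The search to the left always ends, since the boundary 0 belongs to both segmentations and is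
matched exactly. -/
theorem exists_last_near (H : SearchBounds n K τ v d E Cs Cl bs bl c2 c3 c4 Cγ)
    (hτh : IsSegmentation n Kh τh) {k : ℕ} (hk : 0 < k) :
    ∃ j < k, (∃ a ≤ Kh + 1, IsNear τ τh v d Cs a j) ∧
      ∀ i, j < i → i < k → ∀ t ≤ Kh + 1, ¬ IsNear τ τh v d Cs t i := by
  classical
  let P : ℕ → Prop := fun j => ∃ a ≤ Kh + 1, IsNear τ τh v d Cs a j
  have h0 : P 0 := ⟨0, Nat.zero_le _, by simp [IsNear, hτh.zero, H.seg.zero, H.v_zero]⟩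
  refine ⟨Nat.findGreatest P (k - 1), ?_, Nat.findGreatest_spec (Nat.zero_le _) h0, ?_⟩
  · have := Nat.findGreatest_le (P := P) (k - 1)
    omega
  · intro i hji hik t ht hn
    exact Nat.findGreatest_is_greatest hji (by omega) ⟨t, ht, hn⟩

/-- Every minimiser of the penalised cost has the correct number of changepoints, and each
changepoint has an estimate in its large window. -/
theorem consistent (H : SearchBounds n K τ v d E Cs Cl bs bl c2 c3 c4 Cγ)
    (hτh : IsAdmissible n d Kh τh)
    (hmin : ∀ K' τ', IsAdmissible n d K' τ' →
      segSum E (Kh + 1) τh + Cγ * d * Kh ≤ segSum E (K' + 1) τ' + Cγ * d * K') :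
    Kh = K ∧ ∀ i ∈ Finset.Icc 1 K, ∃ t ∈ Finset.Icc 1 Kh,
      |(τ i : ℝ) - τh t| ≤ Cl * d * v i := by
  classical
  -- Correct counts between consecutive matched changepoints add up from the left boundary, so a
  -- matching estimate has the index of its changepoint. At the right boundary this gives the number
  -- of changepoints.
  have hindex : ∀ k ≤ K + 1, ∀ b ≤ Kh + 1, IsNear τ τh v d Cs b k → b = k := by
    intro k
    induction k using Nat.strong_induction_on with
    | _ k ih =>
      intro hk b hb hbk
      rcases Nat.eq_zero_or_pos k with rfl | hpos
      · by_contra hb0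
        have h1 := hτh.1.lt_of_lt (Nat.pos_of_ne_zero hb0) hb
        simp only [IsNear, H.v_zero, H.seg.zero, mul_zero, Nat.cast_zero, sub_zero,
          abs_nonpos_iff, Nat.cast_eq_zero] at hbk
        omega
      · obtain ⟨j, hjk, ⟨a, ha, haj⟩, hun⟩ := H.exists_last_near hτh.1 hpos
        have h1 := (H.between_of_isNear hτh hmin ha hb hjk hk haj hbk hun).1
        have h2 := ih j hjk (by omega) a ha haj
        have h3 := H.lt_of_isNear hτh.1 ha hjk hk (H.isNear_mono haj) (H.isNear_mono hbk)
        omega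
  have hlast : IsNear τ τh v d Cs (Kh + 1) (K + 1) := by
    simp [IsNear, hτh.1.last, H.seg.last, H.v_last]
  refine ⟨by have := hindex (K + 1) le_rfl (Kh + 1) le_rfl hlast; omega, fun i hi => ?_⟩
  have hi' := Finset.mem_Icc.1 hi
  have hnear : ∃ t ≤ Kh + 1, IsNear τ τh v d Cl t i := by
    by_cases h : ∃ t ≤ Kh + 1, IsNear τ τh v d Cs t i
    · obtain ⟨t, ht, htn⟩ := h
      exact ⟨t, ht, H.isNear_mono htn⟩
    · obtain ⟨j, hji, ⟨a, ha, haj⟩, hun⟩ := H.exists_last_near hτh.1 hi'.1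
      have hex : ∃ k, i < k ∧ ∃ b ≤ Kh + 1, IsNear τ τh v d Cs b k :=
        ⟨K + 1, by omega, Kh + 1, le_rfl, hlast⟩
      obtain ⟨hik, b, hb, hbk⟩ := Nat.find_spec hex
      have hkK : Nat.find hex ≤ K + 1 := Nat.find_min' hex ⟨by omega, Kh + 1, le_rfl, hlast⟩
      refine (H.between_of_isNear hτh hmin ha hb (hji.trans hik) hkK haj hbk ?_).2 i hji hik
      intro i' hji' hik' t ht htn
      rcases lt_trichotomy i' i with hlt | rfl | hgt
      · exact hun i' hji' hlt t ht htn
      · exact h ⟨t, ht, htn⟩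
      · exact Nat.find_min hex hik' ⟨hgt, t, ht, htn⟩
  obtain ⟨t, ht, htn⟩ := hnear
  have hfirst : IsNear τ τh v d Cs 0 0 := by
    simp [IsNear, hτh.1.zero, H.seg.zero, H.v_zero]
  have h1 := H.lt_of_isNear hτh.1 (Nat.zero_le _) hi'.1 (by omega) (H.isNear_mono hfirst) htn
  have h2 := H.lt_of_isNear hτh.1 ht (show i < K + 1 by omega) le_rfl htn (H.isNear_mono hlast)
  refine ⟨t, Finset.mem_Icc.2 ⟨by omega, by omega⟩, ?_⟩
  rw [abs_sub_comm]
  exact htn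

end SearchBounds

end Search

/-! ### Existence of a minimiser -/

section Existence

theorem totalCfLoss_congr {p n M : ℕ} {fit : Finset ℕ → (ℕ → Obs p) → (Fin p → ℝ)} {γ : ℝ}
    {z : ℕ → Obs p} {K : ℕ} {τ τ' : ℕ → ℕ} (h : ∀ t ≤ K + 1, τ t = τ' t) :
    totalCfLoss n M fit γ z K τ = totalCfLoss n M fit γ z K τ' := by
  unfold totalCfLoss
  congr 1
  refine Finset.sum_congr rfl fun k hk => ?_
  have := Finset.mem_Icc.1 hk
  rw [h (k - 1) (by omega), h k (by omega)]

theorem IsSegmentation.lt_length {n K : ℕ} {τ : ℕ → ℕ} (h : IsSegmentation n K τ) : K < n := by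
  have : ∀ k ≤ K + 1, k ≤ τ k := by
    intro k
    induction k with
    | zero => simp
    | succ k ih =>
      intro hk
      have := h.lt k (by omega)
      have := ih (by omega)
      omega
  have := this (K + 1) le_rfl
  rw [h.last] at this
  omega

/-- The complete search has a solution as soon as there is an admissible segmentation. -/
theorem exists_isCfEstimate {p n M : ℕ} (fit : Finset ℕ → (ℕ → Obs p) → (Fin p → ℝ)) (γ : ℝ)
    (z : ℕ → Obs p) {dm : ℝ} {K : ℕ} {τ : ℕ → ℕ} (h : IsAdmissible n dm K τ) :
    ∃ (Kh : ℕ) (τh : ℕ → ℕ), IsCfEstimate n M fit dm γ z Kh τh := by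
  classical
  -- The values of τ after K + 1 are arbitrary, so the admissible pairs are infinite in number; the
  -- losses, however, take finitely many values.
  let V : Set ℝ := {r | ∃ K τ, IsAdmissible n dm K τ ∧ totalCfLoss n M fit γ z K τ = r}
  let Φ : Fin n × (Fin (n + 1) → Fin (n + 1)) → ℝ := fun q =>
    totalCfLoss n M fit γ z q.1 fun t => if ht : t < n + 1 then q.2 ⟨t, ht⟩ else 0
  have hV : V ⊆ Set.range Φ := by
    rintro r ⟨K, τ, hτ, rfl⟩
    have hK := hτ.1.lt_length
    refine ⟨(⟨K, hK⟩, fun t => if ht : (t : ℕ) ≤ K + 1 then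
      ⟨τ t, Nat.lt_succ_of_le (hτ.1.le_last ht)⟩ else 0), ?_⟩
    refine totalCfLoss_congr fun t ht => ?_
    simp only at ht
    simp [show t < n + 1 by omega, ht]
  have hfin : V.Finite := (Set.finite_range Φ).subset hV
  obtain ⟨r, ⟨Kh, τh, hadm, rfl⟩, hr⟩ := hfin.exists_minimal ⟨_, K, τ, h, rfl⟩
  refine ⟨Kh, τh, hadm, fun K' τ' h' => ?_⟩
  by_contra hlt
  exact hlt (hr ⟨K', τ', h', rfl⟩ (not_le.1 hlt).le)

end Existence

/-! ### Split sizes and the reduction to excess losses -/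

section Loss

theorem card_Ioc_inter_splitSet_ge {n M m a w : ℕ} (hm : m ∈ Finset.Icc 1 M) (hw : a + w ≤ n) :
    (w : ℝ) / M - 1 ≤ ((Finset.Ioc a (a + w) ∩ splitSet n M m).card : ℝ) := by
  have hm' := Finset.mem_Icc.1 hm
  have hM : 0 < M := by omega
  have hcard : ((Finset.Ico a (a + w)).filter (fun i => i ≡ m - 1 [MOD M])).card ≤
      (Finset.Ioc a (a + w) ∩ splitSet n M m).card := by
    refine Finset.card_le_card_of_injOn (· + 1) (fun i hi => ?_) fun i _ j _ hij => by
      simpa using hij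
    have hi := Finset.mem_filter.1 hi
    have h1 := Finset.mem_Ico.1 hi.1
    have h2 : i % M = m - 1 := by
      have := hi.2
      rwa [Nat.ModEq, Nat.mod_eq_of_lt (show m - 1 < M by omega)] at this
    simp only [Finset.coe_inter, Set.mem_inter_iff, Finset.mem_coe, splitSet, Finset.mem_filter,
      Finset.mem_Icc, Finset.mem_Ioc, Nat.add_sub_cancel]
    omega
  have hform := Nat.Ico_filter_modEq_card a (a + w) hM (m - 1)
  have h3 : ((w : ℚ) / M - 1) ≤
      ((((Finset.Ico a (a + w)).filter (fun i => i ≡ m - 1 [MOD M])).card : ℤ) : ℚ) := by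
    rw [hform]
    have h4 := Int.le_ceil ((((a + w : ℕ) : ℚ) - ((m - 1 : ℕ) : ℚ)) / (M : ℚ))
    have h5 := Int.ceil_lt_add_one (((a : ℚ) - ((m - 1 : ℕ) : ℚ)) / (M : ℚ))
    have h6 : (((a + w : ℕ) : ℚ) - ((m - 1 : ℕ) : ℚ)) / (M : ℚ) =
        ((a : ℚ) - ((m - 1 : ℕ) : ℚ)) / (M : ℚ) + w / M := by push_cast; ring
    rw [h6] at h4 ⊢
    refine le_trans ?_ (Int.cast_le.2 (le_max_left _ _))
    push_cast at h4 h5 ⊢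
    linarith
  have h7 : ((w : ℝ) / M - 1) ≤
      (((Finset.Ico a (a + w)).filter (fun i => i ≡ m - 1 [MOD M])).card : ℝ) := by
    have h8 := (Rat.cast_le (K := ℝ)).2 h3
    push_cast at h8
    exact h8
  exact h7.trans (by exact_mod_cast hcard)

theorem splitSet_subset (n M m : ℕ) : splitSet n M m ⊆ Finset.Icc 1 n := Finset.filter_subset _ _

/-- The cross-fitted excess loss of the segment `(l, e]` over the true parameters `b`. -/
def cfExcess {p : ℕ} (n M : ℕ) (fit : Finset ℕ → (ℕ → Obs p) → (Fin p → ℝ)) (z : ℕ → Obs p)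
    (b : ℕ → Fin p → ℝ) (l e : ℕ) : ℝ :=
  ∑ m ∈ Finset.Icc 1 M, ∑ i ∈ Finset.Ioc l e ∩ splitSet n M m,
    (sqLoss (z i) (fit (Finset.Ioc l e \ splitSet n M m) z) - sqLoss (z i) (b i))

/-- The loss of the true parameters is written as a difference of partial sums, so that it
telescopes over a segmentation and leaves a constant that does not affect the minimisers. -/
theorem cfLoss_eq {p : ℕ} (n M : ℕ) (fit : Finset ℕ → (ℕ → Obs p) → (Fin p → ℝ)) (z : ℕ → Obs p)
    (b : ℕ → Fin p → ℝ) {l e : ℕ} (hle : l ≤ e) :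
    cfLoss n M fit z l e = cfExcess n M fit z b l e +
      (∑ m ∈ Finset.Icc 1 M, ∑ i ∈ Finset.Ioc 0 e ∩ splitSet n M m, sqLoss (z i) (b i) -
        ∑ m ∈ Finset.Icc 1 M, ∑ i ∈ Finset.Ioc 0 l ∩ splitSet n M m, sqLoss (z i) (b i)) := by
  unfold cfLoss cfExcess empLoss
  rw [← Finset.sum_sub_distrib, ← Finset.sum_add_distrib]
  refine Finset.sum_congr rfl fun m _ => ?_
  have h : ∑ i ∈ Finset.Ioc 0 e ∩ splitSet n M m, sqLoss (z i) (b i) -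
      ∑ i ∈ Finset.Ioc 0 l ∩ splitSet n M m, sqLoss (z i) (b i) =
      ∑ i ∈ Finset.Ioc l e ∩ splitSet n M m, sqLoss (z i) (b i) := by
    simp only [← Finset.sum_ite_mem]
    rw [← Finset.sum_Ioc_consecutive _ (Nat.zero_le l) hle]
    ring
  rw [h, ← Finset.sum_add_distrib]
  simp

theorem totalCfLoss_eq {p : ℕ} (n M : ℕ) (fit : Finset ℕ → (ℕ → Obs p) → (Fin p → ℝ)) (γ : ℝ)
    (z : ℕ → Obs p) (b : ℕ → Fin p → ℝ) {K : ℕ} {τ : ℕ → ℕ} (hτ : IsSegmentation n K τ) :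
    totalCfLoss n M fit γ z K τ = segSum (cfExcess n M fit z b) (K + 1) τ + γ * K +
      (∑ m ∈ Finset.Icc 1 M, ∑ i ∈ Finset.Ioc 0 n ∩ splitSet n M m, sqLoss (z i) (b i) -
        ∑ m ∈ Finset.Icc 1 M, ∑ i ∈ Finset.Ioc 0 0 ∩ splitSet n M m, sqLoss (z i) (b i)) := by
  let F : ℕ → ℝ := fun e =>
    ∑ m ∈ Finset.Icc 1 M, ∑ i ∈ Finset.Ioc 0 e ∩ splitSet n M m, sqLoss (z i) (b i)
  have h1 : ∑ k ∈ Finset.Icc 1 (K + 1), cfLoss n M fit z (τ (k - 1)) (τ k) =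
      ∑ t ∈ Finset.range (K + 1), cfLoss n M fit z (τ t) (τ (t + 1)) := by
    refine Finset.sum_nbij' (· - 1) (· + 1) ?_ ?_ ?_ ?_ ?_
    · intro k hk
      simp only [Finset.mem_Icc, Finset.mem_range] at hk ⊢
      omega
    · intro k hk
      simp only [Finset.mem_Icc, Finset.mem_range] at hk ⊢
      omega
    · intro k hk
      simp only [Finset.mem_Icc] at hk
      omega
    · intro k _
      simp
    · intro k hk
      simp only [Finset.mem_Icc] at hk
      rw [Nat.sub_add_cancel hk.1]
  have h2 : ∑ t ∈ Finset.range (K + 1), cfLoss n M fit z (τ t) (τ (t + 1)) =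
      segSum (cfExcess n M fit z b) (K + 1) τ + (F (τ (K + 1)) - F (τ 0)) := by
    rw [← Finset.sum_range_sub (fun t => F (τ t)), segSum, ← Finset.sum_add_distrib]
    refine Finset.sum_congr rfl fun t ht => ?_
    have := Finset.mem_range.1 ht
    exact cfLoss_eq n M fit z b (hτ.lt t (by omega)).le
  unfold totalCfLoss
  rw [h1, h2, hτ.last, hτ.zero]
  ring

end Loss

/-! ### Simultaneous deviation bounds -/

section Events

variable {Ω : Type*} [MeasurableSpace Ω] {μ : Measure Ω} {n p s K : ℕ} {τ : ℕ → ℕ}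
  {f : ℕ → Fin p → ℝ} {S : Matrix (Fin p) (Fin p) ℝ} {σ : ℝ} {x : ℕ → Ω → Fin p → ℝ}
  {ε y : ℕ → Ω → ℝ} {Cx Ce Cf : ℝ}

/-- The exponent that bounds the excess loss from below with a drift. -/
noncomputable def driftTest (S : Matrix (Fin p) (Fin p) ℝ) (Cx Ce : ℝ) (b g : Fin p → ℝ)
    (w : (Fin p → ℝ) × ℝ) : ℝ :=
  expRate Cx Ce / max 1 (sqNorm S (b - g)) * (sqNorm S (b - g) / 4 - excess b g w)

/-- The exponent that bounds the excess loss from above for parameters within `R`. -/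
noncomputable def upperTest (S : Matrix (Fin p) (Fin p) ℝ) (Cx Ce R : ℝ) (b g : Fin p → ℝ)
    (w : (Fin p → ℝ) × ℝ) : ℝ :=
  open Classical in if sqNorm S (b - g) ≤ R then
    expRate Cx Ce / R * (excess b g w - 8 * Cx ^ 2 * sqNorm S (b - g)) else 0

theorem measurable_sqNorm_sub (b : Fin p → ℝ) :
    Measurable fun q : (Fin p → ℝ) × ((Fin p → ℝ) × ℝ) => sqNorm S (b - q.1) :=
  measurable_sqNorm.comp (measurable_const.sub measurable_fst)

theorem measurable_driftTest (b : Fin p → ℝ) :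
    Measurable (Function.uncurry (driftTest S Cx Ce b)) := by
  have h1 := measurable_sqNorm_sub (S := S) b
  exact (measurable_const.div (measurable_const.max h1)).mul
    ((h1.div_const 4).sub (measurable_excess b))

theorem measurable_upperTest (R : ℝ) (b : Fin p → ℝ) :
    Measurable (Function.uncurry (upperTest S Cx Ce R b)) := by
  have h1 := measurable_sqNorm_sub (S := S) b
  exact Measurable.ite (measurableSet_le h1 measurable_const)
    (((measurable_excess b).sub (h1.const_mul _)).const_mul _) measurable_const

/-- The held-out observations of the segment `(l, e]` in the `m`-th split. -/
def heldOut (n M l e m : ℕ) : Finset ℕ := Finset.Ioc l e ∩ splitSet n M m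

/-- The held-out observations outside of the windows of half-width `h l e k`. -/
def restSet (n M K : ℕ) (τ : ℕ → ℕ) (h : ℕ → ℕ → ℕ → ℕ) (l e m : ℕ) : Finset ℕ :=
  heldOut n M l e m \ (Finset.Icc 1 K).biUnion fun k =>
    Finset.Ioc (τ k - h l e k) (τ k + h l e k)

/-- Deviation bounds, uniform over the segments and the splits, for the held-out losses of the fits
`G l e m` on the observations `w`. -/
structure HeldOutBounds (n M K : ℕ) (τ : ℕ → ℕ) (S : Matrix (Fin p) (Fin p) ℝ) (Cx Ce R t : ℝ)
    (h : ℕ → ℕ → ℕ → ℕ) (b : ℕ → Fin p → ℝ) (G : ℕ → ℕ → ℕ → Fin p → ℝ)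
    (w : ℕ → (Fin p → ℝ) × ℝ) (l e m : ℕ) : Prop where
  rest : ∑ i ∈ restSet n M K τ h l e m, -expRate Cx Ce * excess (b i) (G l e m) (w i) < t
  upper : ∑ i ∈ heldOut n M l e m, upperTest S Cx Ce R (b i) (G l e m) (w i) < t
  left : ∀ k ≤ K, ∑ i ∈ heldOut n M l e m ∩ Finset.Ioc (τ k - h l e k) (τ k),
    driftTest S Cx Ce (b i) (G l e m) (w i) < t
  right : ∀ k ≤ K, ∑ i ∈ heldOut n M l e m ∩ Finset.Ioc (τ k) (τ k + h l e k),
    driftTest S Cx Ce (b i) (G l e m) (w i) < t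

namespace IsLinearModel

theorem lintegral_rest_le [IsProbabilityMeasure μ]
    (hmod : IsLinearModel μ (n := n) s K τ f S σ x ε y Cx Ce Cf) (hCx : 0 < Cx) (hCe : 0 < Ce)
    {i : ℕ} (hi : i ∈ Finset.Icc 1 n) (b g : Fin p → ℝ) :
    ∫⁻ ω, ENNReal.ofReal (Real.exp (-expRate Cx Ce * excess b g (x i ω, ε i ω))) ∂μ ≤ 1 :=
  (hmod.excessConditions hCx hCe hi (b - g)).lower hCx (expRate_pos hCx).le le_rfl

theorem lintegral_driftTest_le [IsProbabilityMeasure μ]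
    (hmod : IsLinearModel μ (n := n) s K τ f S σ x ε y Cx Ce Cf) (hCx : 0 < Cx) (hCe : 0 < Ce)
    {i : ℕ} (hi : i ∈ Finset.Icc 1 n) (b g : Fin p → ℝ) :
    ∫⁻ ω, ENNReal.ofReal (Real.exp (driftTest S Cx Ce b g (x i ω, ε i ω))) ∂μ ≤ 1 := by
  have hmax : 0 < max 1 (sqNorm S (b - g)) := lt_max_of_lt_left one_pos
  exact (hmod.excessConditions hCx hCe hi (b - g)).lower_drift hCx
    (div_pos (expRate_pos hCx) hmax).le (div_mul_cancel₀ _ hmax.ne').le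

/-- Outside the ball of radius R the exponent is 0, with exponential mean one. The test is therefore
valid for every g, and the accuracy of the fit is invoked only afterwards, on the good event. -/
theorem lintegral_upperTest_le [IsProbabilityMeasure μ]
    (hmod : IsLinearModel μ (n := n) s K τ f S σ x ε y Cx Ce Cf) (hCx : 0 < Cx) (hCe : 0 < Ce)
    {i : ℕ} (hi : i ∈ Finset.Icc 1 n) {R : ℝ} (hR : 1 ≤ R) (b g : Fin p → ℝ) :
    ∫⁻ ω, ENNReal.ofReal (Real.exp (upperTest S Cx Ce R b g (x i ω, ε i ω))) ∂μ ≤ 1 := by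
  by_cases h : sqNorm S (b - g) ≤ R
  · have hR0 : 0 < R := one_pos.trans_le hR
    have he := expRate_pos (Ce := Ce) hCx
    simp only [upperTest, if_pos h]
    refine (hmod.excessConditions hCx hCe hi (b - g)).upper hCx (div_pos he hR0).le ?_
    calc expRate Cx Ce / R * max 1 (sqNorm S (b - g)) ≤ expRate Cx Ce / R * R := by
          gcongr
          exact max_le hR h
      _ = _ := div_mul_cancel₀ _ hR0.ne'
  · simp [upperTest, if_neg h]

/-- The deviation bounds hold simultaneously with high probability. -/
theorem measure_not_heldOutBounds_le [IsProbabilityMeasure μ]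
    (hmod : IsLinearModel μ (n := n) s K τ f S σ x ε y Cx Ce Cf) (hCx : 0 < Cx) (hCe : 0 < Ce)
    {b : ℕ → Fin p → ℝ} (hb : ∀ i ∈ Finset.Icc 1 n, ∀ ω, y i ω = x i ω ⬝ᵥ b i + ε i ω)
    {fit : Finset ℕ → (ℕ → Obs p) → (Fin p → ℝ)} (hfit : IsCVLasso fit)
    {R : ℝ} (hR : 1 ≤ R) (t : ℝ) (M : ℕ) (h : ℕ → ℕ → ℕ → ℕ) :
    μ {ω | ¬ ∀ l e m, l < e → e ≤ n → m ∈ Finset.Icc 1 M →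
      HeldOutBounds n M K τ S Cx Ce R t h b
        (fun l e m => fit (Finset.Ioc l e \ splitSet n M m) (sample x y ω))
        (fun i => (x i ω, ε i ω)) l e m} ≤
      ENNReal.ofReal (4 * M * (n : ℝ) ^ 3 * Real.exp (-t)) := by
  classical
  let G : ℕ → ℕ → ℕ → Ω → Fin p → ℝ := fun l e m ω =>
    fit (Finset.Ioc l e \ splitSet n M m) (sample x y ω)
  let w : ℕ → Ω → (Fin p → ℝ) × ℝ := fun i ω => (x i ω, ε i ω)
  let B₁ : ℕ → ℕ → ℕ → Set Ω := fun l e m =>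
    {ω | t ≤ ∑ i ∈ restSet n M K τ h l e m, -expRate Cx Ce * excess (b i) (G l e m ω) (w i ω)}
  let B₂ : ℕ → ℕ → ℕ → Set Ω := fun l e m =>
    {ω | t ≤ ∑ i ∈ heldOut n M l e m, upperTest S Cx Ce R (b i) (G l e m ω) (w i ω)}
  let B₃ : ℕ → ℕ → ℕ → ℕ → Set Ω := fun l e m k =>
    {ω | t ≤ ∑ i ∈ heldOut n M l e m ∩ Finset.Ioc (τ k - h l e k) (τ k),
      driftTest S Cx Ce (b i) (G l e m ω) (w i ω)}
  let B₄ : ℕ → ℕ → ℕ → ℕ → Set Ω := fun l e m k =>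
    {ω | t ≤ ∑ i ∈ heldOut n M l e m ∩ Finset.Ioc (τ k) (τ k + h l e k),
      driftTest S Cx Ce (b i) (G l e m ω) (w i ω)}
  let B : ℕ × ℕ × ℕ × ℕ → Set Ω := fun q =>
    (B₁ q.1 q.2.1 q.2.2.1 ∪ B₂ q.1 q.2.1 q.2.2.1) ∪
      (B₃ q.1 q.2.1 q.2.2.1 q.2.2.2 ∪ B₄ q.1 q.2.1 q.2.2.1 q.2.2.2)
  -- At most n · n · M · n indices, as K + 1 ≤ n, with four events each. The index k = 0 is included
  -- so that the two bounds without k are covered even if K = 0.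
  let Q : Finset (ℕ × ℕ × ℕ × ℕ) :=
    Finset.range n ×ˢ Finset.Icc 1 n ×ˢ Finset.Icc 1 M ×ˢ Finset.range (K + 1)
  have hsub : {ω | ¬ ∀ l e m, l < e → e ≤ n → m ∈ Finset.Icc 1 M →
      HeldOutBounds n M K τ S Cx Ce R t h b (fun l e m => G l e m ω) (fun i => w i ω) l e m} ⊆
      ⋃ q ∈ Q, B q := by
    intro ω hω
    by_contra hnot
    refine hω fun l e m hle hen hm => ?_
    have hmem : ∀ k ≤ K, ω ∉ B (l, e, m, k) := fun k hk hmem => hnot (by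
      refine Set.mem_biUnion (x := (l, e, m, k)) ?_ hmem
      simp only [Q, Finset.coe_product, Set.mem_prod, Finset.mem_coe, Finset.mem_range,
        Finset.mem_Icc] at hm ⊢
      omega)
    have hmem' : ∀ k ≤ K, ω ∉ B₁ l e m ∧ ω ∉ B₂ l e m ∧ ω ∉ B₃ l e m k ∧ ω ∉ B₄ l e m k :=
      fun k hk => by
        have := hmem k hk
        simp only [B, Set.mem_union, not_or] at this
        tauto
    exact ⟨not_le.1 (hmem' 0 (Nat.zero_le _)).1, not_le.1 (hmem' 0 (Nat.zero_le _)).2.1,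
      fun k hk => not_le.1 (hmem' k hk).2.2.1, fun k hk => not_le.1 (hmem' k hk).2.2.2⟩
  have hAT : ∀ l e m, ∀ T ⊆ heldOut n M l e m, Disjoint (Finset.Ioc l e \ splitSet n M m) T :=
    fun l e m T hT => Finset.disjoint_left.2 fun i hi hi' =>
      (Finset.mem_sdiff.1 hi).2 (Finset.mem_inter.1 (hT hi')).2
  have hheld : ∀ l e m, heldOut n M l e m ⊆ Finset.Icc 1 n := fun l e m =>
    Finset.inter_subset_right.trans (splitSet_subset n M m)
  have hA : ∀ l e m, e ≤ n → Finset.Ioc l e \ splitSet n M m ⊆ Finset.Icc 1 n :=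
    fun l e m he i hi => by
      have := Finset.mem_Ioc.1 (Finset.mem_sdiff.1 hi).1
      exact Finset.mem_Icc.2 ⟨by omega, by omega⟩
  have hBq : ∀ q ∈ Q, μ (B q) ≤ ENNReal.ofReal (4 * Real.exp (-t)) := by
    rintro ⟨l, e, m, k⟩ hq
    simp only [Q, Finset.mem_product, Finset.mem_range, Finset.mem_Icc] at hq
    have he : e ≤ n := hq.2.1.2
    have h1 : μ (B₁ l e m) ≤ ENNReal.ofReal (Real.exp (-t)) :=
      have hT : restSet n M K τ h l e m ⊆ heldOut n M l e m := Finset.sdiff_subset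
      hmod.measure_fit_tail_le hb hfit (hA l e m he) (hT.trans (hheld l e m)) (hAT l e m _ hT)
        (ψ := fun i g w => -expRate Cx Ce * excess (b i) g w)
        (fun i _ => (measurable_excess (b i)).const_mul _)
        (fun i hi g => hmod.lintegral_rest_le hCx hCe (hheld l e m (hT hi)) (b i) g) t
    have h2 : μ (B₂ l e m) ≤ ENNReal.ofReal (Real.exp (-t)) :=
      hmod.measure_fit_tail_le hb hfit (hA l e m he) (hheld l e m) (hAT l e m _ subset_rfl)
        (ψ := fun i g w => upperTest S Cx Ce R (b i) g w)
        (fun i _ => measurable_upperTest R (b i))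
        (fun i hi g => hmod.lintegral_upperTest_le hCx hCe (hheld l e m hi) hR (b i) g) t
    have hdrift : ∀ T ⊆ heldOut n M l e m,
        μ {ω | t ≤ ∑ i ∈ T, driftTest S Cx Ce (b i) (G l e m ω) (w i ω)} ≤
          ENNReal.ofReal (Real.exp (-t)) := fun T hT =>
      hmod.measure_fit_tail_le hb hfit (hA l e m he) (hT.trans (hheld l e m)) (hAT l e m _ hT)
        (ψ := fun i g w => driftTest S Cx Ce (b i) g w)
        (fun i _ => measurable_driftTest (b i))
        (fun i hi g => hmod.lintegral_driftTest_le hCx hCe (hheld l e m (hT hi)) (b i) g) t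
    have h3 := hdrift _ (Finset.inter_subset_left (s₁ := heldOut n M l e m)
      (s₂ := Finset.Ioc (τ k - h l e k) (τ k)))
    have h4 := hdrift _ (Finset.inter_subset_left (s₁ := heldOut n M l e m)
      (s₂ := Finset.Ioc (τ k) (τ k + h l e k)))
    calc μ (B (l, e, m, k)) ≤ (μ (B₁ l e m) + μ (B₂ l e m)) + (μ (B₃ l e m k) + μ (B₄ l e m k)) :=
          (measure_union_le _ _).trans (add_le_add (measure_union_le _ _) (measure_union_le _ _))
      _ ≤ (ENNReal.ofReal (Real.exp (-t)) + ENNReal.ofReal (Real.exp (-t))) +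
          (ENNReal.ofReal (Real.exp (-t)) + ENNReal.ofReal (Real.exp (-t))) :=
          add_le_add (add_le_add h1 h2) (add_le_add h3 h4)
      _ = _ := by
          rw [← ENNReal.ofReal_add (by positivity) (by positivity),
            ← ENNReal.ofReal_add (by positivity) (by positivity)]
          congr 1
          ring
  calc _ ≤ μ (⋃ q ∈ Q, B q) := measure_mono hsub
    _ ≤ ∑ q ∈ Q, μ (B q) := measure_biUnion_finset_le _ _
    _ ≤ ∑ q ∈ Q, ENNReal.ofReal (4 * Real.exp (-t)) := Finset.sum_le_sum hBq
    _ = ENNReal.ofReal (Q.card * (4 * Real.exp (-t))) := by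
        rw [Finset.sum_const, nsmul_eq_mul, ENNReal.ofReal_mul (Nat.cast_nonneg _),
          ENNReal.ofReal_natCast]
    _ ≤ _ := by
        refine ENNReal.ofReal_le_ofReal ?_
        have hcard : (Q.card : ℝ) = n * (n * (M * (K + 1))) := by
          simp [Q, Finset.card_product]
        have hK : ((K : ℝ) + 1) ≤ n := by exact_mod_cast hmod.segmentation.lt_length
        rw [hcard]
        calc (n : ℝ) * (n * (M * (K + 1))) * (4 * Real.exp (-t))
            ≤ n * (n * (M * n)) * (4 * Real.exp (-t)) := by gcongr
          _ = _ := by ring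

end IsLinearModel

end Events

/-! ### From deviation bounds to bounds on held-out losses -/

section HeldOut

variable {p n M K : ℕ} {τ : ℕ → ℕ} {S : Matrix (Fin p) (Fin p) ℝ} {Cx Ce R t : ℝ}
  {h : ℕ → ℕ → ℕ → ℕ} {b : ℕ → Fin p → ℝ} {G : ℕ → ℕ → ℕ → Fin p → ℝ}
  {w : ℕ → (Fin p → ℝ) × ℝ} {l e m : ℕ}

/-- The test leaves an error (t / `expRate`) max(1, r). If r ≥ 1, the size of T makes it at most
half of the drift N₀r/4; otherwise it is the constant t / `expRate`. -/
theorem le_sum_excess_of_driftTest (hCx : 0 < Cx) (hS : S.PosDef) {T : Finset ℕ}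
    {F g : Fin p → ℝ} (hT : ∀ i ∈ T, b i = F) (hlt : ∑ i ∈ T, driftTest S Cx Ce (b i) g (w i) < t)
    {N₀ : ℝ} (hN : 8 * (t / expRate Cx Ce) ≤ N₀) (hcard : N₀ ≤ T.card) (ht : 0 ≤ t) :
    N₀ * sqNorm S (F - g) / 8 - t / expRate Cx Ce ≤ ∑ i ∈ T, excess (b i) g (w i) := by
  have he := expRate_pos (Ce := Ce) hCx
  set r := sqNorm S (F - g) with hr
  have hr0 : 0 ≤ r := sqNorm_nonneg hS _
  set a := t / expRate Cx Ce with ha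
  have ha0 : 0 ≤ a := div_nonneg ht he.le
  have hmax : 0 < max 1 r := lt_max_of_lt_left one_pos
  have hsum : ∑ i ∈ T, driftTest S Cx Ce (b i) g (w i) =
      expRate Cx Ce / max 1 r * (T.card * r / 4 - ∑ i ∈ T, excess (b i) g (w i)) := by
    rw [Finset.sum_congr rfl (g := fun i => expRate Cx Ce / max 1 r *
      (r / 4 - excess (b i) g (w i))) fun i hi => by simp only [driftTest, hT i hi, hr],
      ← Finset.mul_sum, Finset.sum_sub_distrib, Finset.sum_const, nsmul_eq_mul]
    ring
  rw [hsum, div_mul_eq_mul_div, div_lt_iff₀ hmax] at hlt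
  have h1 : T.card * r / 4 - ∑ i ∈ T, excess (b i) g (w i) < a * max 1 r := by
    rw [ha, div_mul_eq_mul_div, lt_div_iff₀ he]
    linarith
  have h2 : N₀ * r ≤ T.card * r := by gcongr
  have h3 : 8 * a * r ≤ N₀ * r := by gcongr
  rcases le_total 1 r with h4 | h4
  · rw [max_eq_right h4] at h1
    nlinarith
  · rw [max_eq_left h4] at h1
    have : 0 ≤ N₀ * r := mul_nonneg (le_trans (by positivity) hN) hr0
    nlinarith

theorem sum_excess_le_of_upperTest (hCx : 0 < Cx) (hR : 1 ≤ R) {T : Finset ℕ} {g : Fin p → ℝ}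
    (hlt : ∑ i ∈ T, upperTest S Cx Ce R (b i) g (w i) < t)
    (hle : ∀ i ∈ T, sqNorm S (b i - g) ≤ R) :
    ∑ i ∈ T, excess (b i) g (w i) ≤
      8 * Cx ^ 2 * ∑ i ∈ T, sqNorm S (b i - g) + t * R / expRate Cx Ce := by
  have he := expRate_pos (Ce := Ce) hCx
  have hR0 : 0 < R := one_pos.trans_le hR
  have hsum : ∑ i ∈ T, upperTest S Cx Ce R (b i) g (w i) = expRate Cx Ce / R *
      (∑ i ∈ T, excess (b i) g (w i) - 8 * Cx ^ 2 * ∑ i ∈ T, sqNorm S (b i - g)) := by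
    rw [Finset.mul_sum, ← Finset.sum_sub_distrib, Finset.mul_sum]
    exact Finset.sum_congr rfl fun i hi => by rw [upperTest, if_pos (hle i hi)]
  rw [hsum, div_mul_eq_mul_div, div_lt_iff₀ hR0] at hlt
  have h1 : ∑ i ∈ T, excess (b i) g (w i) - 8 * Cx ^ 2 * ∑ i ∈ T, sqNorm S (b i - g) <
      t * R / expRate Cx Ce := by
    rw [lt_div_iff₀ he]
    linarith
  linarith

/-- The held-out loss splits into the windows around the changepoints and the rest. -/
theorem sum_heldOut_eq {H : ℕ → ℕ} (hh : h l e = H)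
    (hdisj : ∀ j k, 1 ≤ j → j < k → k ≤ K → τ j + H j ≤ τ k - H k)
    (F : ℕ → ℝ) :
    ∑ i ∈ heldOut n M l e m, F i = ∑ i ∈ restSet n M K τ h l e m, F i +
      ∑ k ∈ Finset.Icc 1 K, (∑ i ∈ heldOut n M l e m ∩ Finset.Ioc (τ k - H k) (τ k), F i +
        ∑ i ∈ heldOut n M l e m ∩ Finset.Ioc (τ k) (τ k + H k), F i) := by
  classical
  subst hh
  have h1 : ∑ i ∈ heldOut n M l e m, F i = ∑ i ∈ restSet n M K τ h l e m, F i +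
      ∑ i ∈ heldOut n M l e m ∩ (Finset.Icc 1 K).biUnion fun k =>
        Finset.Ioc (τ k - h l e k) (τ k + h l e k), F i := by
    rw [restSet, add_comm, ← Finset.sum_inter_add_sum_sdiff]
  rw [h1, Finset.inter_biUnion, Finset.sum_biUnion]
  · congr 1
    refine Finset.sum_congr rfl fun k _ => ?_
    rw [← Finset.Ioc_union_Ioc_eq_Ioc (Nat.sub_le (τ k) (h l e k)) (Nat.le_add_right (τ k) _),
      Finset.inter_union_distrib_left, Finset.sum_union]
    refine Finset.disjoint_left.2 fun i hi hi' => ?_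
    simp only [Finset.mem_inter, Finset.mem_Ioc] at hi hi'
    omega
  · intro j hj k hk hjk
    refine Finset.disjoint_left.2 fun i hi hi' => ?_
    simp only [Finset.mem_inter, Finset.mem_Ioc, Finset.coe_Icc, Set.mem_Icc] at hi hi' hj hk
    rcases Nat.lt_or_gt_of_ne hjk with hlt | hlt
    · have := hdisj j k hj.1 hlt hk.2
      omega
    · have := hdisj k j hk.1 hlt hj.2
      omega

end HeldOut

/-! ### Piecewise constant signals: costs of segments -/

/-- The parameters of a piecewise constant signal: `b` is the parameter of each observation and `v`
is the inverse squared jump size at each changepoint. -/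
structure JumpSignal {p : ℕ} (n K : ℕ) (τ : ℕ → ℕ) (S : Matrix (Fin p) (Fin p) ℝ)
    (f : ℕ → Fin p → ℝ) (b : ℕ → Fin p → ℝ) (v : ℕ → ℝ) (d Cg : ℝ) : Prop where
  seg : IsSegmentation n K τ
  posDef : S.PosDef
  param : ∀ k ∈ Finset.Icc 1 (K + 1), ∀ i ∈ Finset.Ioc (τ (k - 1)) (τ k), b i = f k
  jump_pos : ∀ k ∈ Finset.Icc 1 K, 0 < sqNorm S (f k - f (k + 1))
  v_eq : ∀ k ∈ Finset.Icc 1 K, v k = (sqNorm S (f k - f (k + 1)))⁻¹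
  v_zero : v 0 = 0
  v_last : v (K + 1) = 0
  v_nonneg : ∀ k, 0 ≤ v k
  d_pos : 0 < d
  Cg_nonneg : 0 ≤ Cg
  gap : ∀ j k, j < k → k ≤ K + 1 → Cg * d * (v j + v k + 2) ≤ (τ k : ℝ) - τ j

/-- The width of the window around the `k`-th changepoint that fits into `(l, e]`. -/
noncomputable def windowWidth (τ : ℕ → ℕ) (v : ℕ → ℝ) (d Cs Cl : ℝ) (l e k : ℕ) : ℕ :=
  if (l : ℝ) + Cl * d * v k < τ k ∧ (τ k : ℝ) + Cl * d * v k < e then ⌊Cl * d * v k⌋₊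
  else if (l : ℝ) + Cs * d * v k < τ k ∧ (τ k : ℝ) + Cs * d * v k < e then ⌊Cs * d * v k⌋₊ else 0

namespace JumpSignal

variable {p n M K : ℕ} {τ : ℕ → ℕ} {S : Matrix (Fin p) (Fin p) ℝ} {f b : ℕ → Fin p → ℝ}
  {v : ℕ → ℝ} {d Cg Cs Cl : ℝ} {Cx Ce R t : ℝ} {G : ℕ → ℕ → ℕ → Fin p → ℝ}
  {w : ℕ → (Fin p → ℝ) × ℝ} {l e m : ℕ}

theorem windowWidth_le (J : JumpSignal n K τ S f b v d Cg) (hCs : 0 ≤ Cs) (hsl : Cs ≤ Cl)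
    (hlg : Cl ≤ Cg) (k : ℕ) : (windowWidth τ v d Cs Cl l e k : ℝ) ≤ Cg * d * v k := by
  have hd := J.d_pos
  have hv := J.v_nonneg k
  have hCl := hCs.trans hsl
  unfold windowWidth
  split_ifs
  · exact (Nat.floor_le (by positivity)).trans (by gcongr)
  · exact (Nat.floor_le (by positivity)).trans (by gcongr; linarith)
  · have := J.Cg_nonneg
    simp only [Nat.cast_zero]
    positivity

/-- A window inside the segment has a held-out loss proportional to its width. -/
theorem le_sum_window (J : JumpSignal n K τ S f b v d Cg) (hCx : 0 < Cx) (hM : 1 ≤ M) {C : ℝ}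
    (hC : 0 ≤ C) (hCg : C ≤ Cg) (hen : e ≤ n) (hm : m ∈ Finset.Icc 1 M) (ht : 0 ≤ t) {k : ℕ}
    (hk : k ∈ Finset.Icc 1 K)
    (hin : (l : ℝ) + C * d * v k < τ k ∧ (τ k : ℝ) + C * d * v k < e)
    (hC1 : 4 * M ≤ C * d * v k) (hC2 : 8 * (t / expRate Cx Ce) ≤ C * d * v k / (2 * M))
    (hl : ∑ i ∈ heldOut n M l e m ∩ Finset.Ioc (τ k - ⌊C * d * v k⌋₊) (τ k),
      driftTest S Cx Ce (b i) (G l e m) (w i) < t)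
    (hr : ∑ i ∈ heldOut n M l e m ∩ Finset.Ioc (τ k) (τ k + ⌊C * d * v k⌋₊),
      driftTest S Cx Ce (b i) (G l e m) (w i) < t) :
    C * d / (32 * M) - 2 * (t / expRate Cx Ce) ≤
      ∑ i ∈ heldOut n M l e m ∩ Finset.Ioc (τ k - ⌊C * d * v k⌋₊) (τ k),
          excess (b i) (G l e m) (w i) +
        ∑ i ∈ heldOut n M l e m ∩ Finset.Ioc (τ k) (τ k + ⌊C * d * v k⌋₊),
          excess (b i) (G l e m) (w i) := by
  have hk' := Finset.mem_Icc.1 hk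
  have hd := J.d_pos
  have hv := J.v_nonneg k
  have hM0 : (1 : ℝ) ≤ M := by exact_mod_cast hM
  set u := C * d * v k with hu
  have hu0 : 0 ≤ u := by positivity
  set q := ⌊u⌋₊ with hq
  have hqle : (q : ℝ) ≤ u := Nat.floor_le hu0
  have hqge : u < q + 1 := Nat.lt_floor_add_one u
  have hlq : l + q ≤ τ k := by
    have : ((l + q : ℕ) : ℝ) ≤ τ k := by push_cast; linarith [hin.1]
    exact_mod_cast this
  have hqe : τ k + q ≤ e := by
    have : ((τ k + q : ℕ) : ℝ) ≤ e := by push_cast; linarith [hin.2]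
    exact_mod_cast this
  have hleft : τ (k - 1) + q ≤ τ k := by
    have h1 := J.gap (k - 1) k (by omega) (by omega)
    have h2 := J.v_nonneg (k - 1)
    have h3 : u ≤ Cg * d * (v (k - 1) + v k + 2) := by
      rw [hu]
      have := J.Cg_nonneg
      have h4 : C * d * v k ≤ Cg * d * v k := by gcongr
      have h5 : Cg * d * v k ≤ Cg * d * (v (k - 1) + v k + 2) := by gcongr; linarith
      linarith
    have : ((τ (k - 1) + q : ℕ) : ℝ) ≤ τ k := by push_cast; linarith
    exact_mod_cast this
  have hright : τ k + q ≤ τ (k + 1) := by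
    have h1 := J.gap k (k + 1) (by omega) (by omega)
    have h2 := J.v_nonneg (k + 1)
    have h3 : u ≤ Cg * d * (v k + v (k + 1) + 2) := by
      rw [hu]
      have := J.Cg_nonneg
      have h4 : C * d * v k ≤ Cg * d * v k := by gcongr
      have h5 : Cg * d * v k ≤ Cg * d * (v k + v (k + 1) + 2) := by gcongr; linarith
      linarith
    have : ((τ k + q : ℕ) : ℝ) ≤ τ (k + 1) := by push_cast; linarith
    exact_mod_cast this
  -- Since u ≥ 4M, rounding and the incomplete residue period cost at most half of the share u/M of
  -- a split.
  have hcount : u / (2 * M) ≤ (q : ℝ) / M - 1 := by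
    have hM1 : (0 : ℝ) < M := by linarith
    have e1 : (q : ℝ) / M - 1 = (q - M) / M := by field_simp
    rw [e1, div_le_div_iff₀ (by positivity) hM1]
    nlinarith
  have hcardl : u / (2 * M) ≤ ((heldOut n M l e m ∩ Finset.Ioc (τ k - q) (τ k)).card : ℝ) := by
    have h1 := card_Ioc_inter_splitSet_ge (n := n) (a := τ k - q) (w := q) hm (by omega)
    refine (hcount.trans h1).trans (by
      refine Nat.cast_le.2 (Finset.card_le_card fun i hi => ?_)
      simp only [heldOut, Finset.mem_inter, Finset.mem_Ioc] at hi ⊢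
      refine ⟨⟨by omega, hi.2⟩, by omega⟩)
  have hcardr : u / (2 * M) ≤ ((heldOut n M l e m ∩ Finset.Ioc (τ k) (τ k + q)).card : ℝ) := by
    have h1 := card_Ioc_inter_splitSet_ge (n := n) (a := τ k) (w := q) hm (by omega)
    refine (hcount.trans h1).trans (by
      refine Nat.cast_le.2 (Finset.card_le_card fun i hi => ?_)
      simp only [heldOut, Finset.mem_inter, Finset.mem_Ioc] at hi ⊢
      refine ⟨⟨by omega, hi.2⟩, by omega⟩)
  have hl' := le_sum_excess_of_driftTest hCx J.posDef (F := f k) (fun i hi => by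
    simp only [Finset.mem_inter, Finset.mem_Ioc] at hi
    exact J.param k (by simp; omega) i (by simp; omega)) hl hC2 hcardl ht
  have hr' := le_sum_excess_of_driftTest hCx J.posDef (F := f (k + 1)) (fun i hi => by
    simp only [Finset.mem_inter, Finset.mem_Ioc] at hi
    exact J.param (k + 1) (by simp; omega) i (by simp; omega)) hr hC2 hcardr ht
  -- The squared distances of g to the two parameters add up to at least Δ_k/2. The window width u
  -- satisfies uΔ_k = C d, so the signal strength cancels.
  have htri := sqNorm_sub_le J.posDef (f k) (G l e m) (f (k + 1))
  rw [sqNorm_sub_comm (G l e m)] at htri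
  have hΔ := J.jump_pos k hk
  have hmain : C * d / (32 * M) = u / (2 * M) * sqNorm S (f k - f (k + 1)) / 16 := by
    rw [hu, J.v_eq k hk]
    field_simp
    ring
  have hmul := mul_le_mul_of_nonneg_left htri (show 0 ≤ u / (2 * M) by positivity)
  rw [hmain]
  nlinarith

/-- Valid for every fit: the windows are disjoint by the spacing and contribute their gains, and all
other observations together lose at most t / `expRate`. -/
theorem le_sum_heldOut (J : JumpSignal n K τ S f b v d Cg) (hCx : 0 < Cx) (hM : 1 ≤ M)
    (hCs : 0 ≤ Cs) (hsl : Cs ≤ Cl) (hlg : Cl ≤ Cg) (hen : e ≤ n)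
    (hm : m ∈ Finset.Icc 1 M) (ht : 0 ≤ t)
    (hC1 : ∀ k ∈ Finset.Icc 1 K, 4 * M ≤ Cs * d * v k)
    (hC2 : ∀ k ∈ Finset.Icc 1 K, 8 * (t / expRate Cx Ce) ≤ Cs * d * v k / (2 * M))
    (H : HeldOutBounds n M K τ S Cx Ce R t (windowWidth τ v d Cs Cl) b G w l e m) :
    ∑ k ∈ Finset.Icc 1 K, windowGain τ v d Cs Cl (Cs * d / (32 * M) - 2 * (t / expRate Cx Ce))
        (Cl * d / (32 * M) - 2 * (t / expRate Cx Ce)) l e k - t / expRate Cx Ce ≤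
      ∑ i ∈ heldOut n M l e m, excess (b i) (G l e m) (w i) := by
  have he := expRate_pos (Ce := Ce) hCx
  have hd := J.d_pos
  rw [sum_heldOut_eq (K := K) (τ := τ) (h := windowWidth τ v d Cs Cl) rfl]
  · have hrest : -(t / expRate Cx Ce) ≤ ∑ i ∈ restSet n M K τ (windowWidth τ v d Cs Cl) l e m,
        excess (b i) (G l e m) (w i) := by
      have h1 := H.rest
      rw [← Finset.mul_sum] at h1
      rw [← neg_div, div_le_iff₀ he]
      linarith
    have hwin : ∑ k ∈ Finset.Icc 1 K,
        windowGain τ v d Cs Cl (Cs * d / (32 * M) - 2 * (t / expRate Cx Ce))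
          (Cl * d / (32 * M) - 2 * (t / expRate Cx Ce)) l e k ≤
        ∑ k ∈ Finset.Icc 1 K,
          (∑ i ∈ heldOut n M l e m ∩
              Finset.Ioc (τ k - windowWidth τ v d Cs Cl l e k) (τ k),
              excess (b i) (G l e m) (w i) +
            ∑ i ∈ heldOut n M l e m ∩
              Finset.Ioc (τ k) (τ k + windowWidth τ v d Cs Cl l e k),
              excess (b i) (G l e m) (w i)) := by
      refine Finset.sum_le_sum fun k hk => ?_
      have hv := J.v_nonneg k
      have hL := H.left k (Finset.mem_Icc.1 hk).2
      have hR := H.right k (Finset.mem_Icc.1 hk).2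
      have hmono : Cs * d * v k ≤ Cl * d * v k := by gcongr
      have hmono' : Cs * d * v k / (2 * M) ≤ Cl * d * v k / (2 * M) := by gcongr
      unfold windowGain
      by_cases hbig : (l : ℝ) + Cl * d * v k < τ k ∧ (τ k : ℝ) + Cl * d * v k < e
      · rw [windowWidth, if_pos hbig] at hL hR ⊢
        rw [if_pos hbig]
        exact J.le_sum_window hCx hM (hCs.trans hsl) hlg hen hm ht hk hbig
          ((hC1 k hk).trans hmono) ((hC2 k hk).trans hmono') hL hR
      · by_cases hsmall : (l : ℝ) + Cs * d * v k < τ k ∧ (τ k : ℝ) + Cs * d * v k < e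
        · rw [windowWidth, if_neg hbig, if_pos hsmall] at hL hR ⊢
          rw [if_neg hbig, if_pos hsmall]
          exact J.le_sum_window hCx hM hCs (hsl.trans hlg) hen hm ht hk hsmall (hC1 k hk)
            (hC2 k hk) hL hR
        · rw [windowWidth, if_neg hbig, if_neg hsmall, if_neg hbig, if_neg hsmall]
          simp
    linarith
  · intro j k _ hjk hk
    have h1 := J.gap j k hjk (by omega)
    have h2 := J.windowWidth_le (l := l) (e := e) hCs hsl hlg j
    have h3 := J.windowWidth_le (l := l) (e := e) hCs hsl hlg k
    have h4 : 0 ≤ Cg * d := mul_nonneg J.Cg_nonneg hd.le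
    have h5 : ((τ j + windowWidth τ v d Cs Cl l e j + windowWidth τ v d Cs Cl l e k : ℕ) : ℝ) ≤
        τ k := by
      push_cast
      nlinarith
    have h6 : τ j + windowWidth τ v d Cs Cl l e j + windowWidth τ v d Cs Cl l e k ≤ τ k := by
      exact_mod_cast h5
    omega

/-- On a nearly homogeneous segment the parameters are those of three neighbouring segments, and
their sum of squared distances to the central one is small. -/
theorem nearlyHomogeneous (J : JumpSignal n K τ S f b v d Cg) {k : ℕ}
    (hk : k ∈ Finset.Icc 1 (K + 1)) (hen : e ≤ n) {D₁ D₂ : ℝ} (hD₁ : 0 ≤ D₁) (hD₁' : D₁ ≤ Cg)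
    (hD₂ : 0 ≤ D₂) (hD₂' : D₂ ≤ Cg) (h₁ : |(l : ℝ) - τ (k - 1)| ≤ D₁ * d * v (k - 1))
    (h₂ : |(e : ℝ) - τ k| ≤ D₂ * d * v k) :
    (∀ i ∈ Finset.Ioc l e, (i ≤ τ (k - 1) → k - 1 ∈ Finset.Icc 1 K ∧ b i = f (k - 1)) ∧
      (τ k < i → k ∈ Finset.Icc 1 K ∧ b i = f (k + 1)) ∧
      (τ (k - 1) < i → i ≤ τ k → b i = f k)) ∧
    ∑ i ∈ Finset.Ioc l e, sqNorm S (b i - f k) ≤ (D₁ + D₂) * d := by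
  classical
  have hk' := Finset.mem_Icc.1 hk
  have hd := J.d_pos
  have hz : sqNorm S (0 : Fin p → ℝ) = 0 := by simp [sqNorm]
  have hleft : ∀ i ∈ Finset.Ioc l e, i ≤ τ (k - 1) →
      k - 1 ∈ Finset.Icc 1 K ∧ b i = f (k - 1) := fun i hi hik => by
    have hi' := Finset.mem_Ioc.1 hi
    have hk1 : k - 1 ≠ 0 := fun h0 => by
      rw [h0, J.seg.zero] at hik
      omega
    have hg := J.gap (k - 1 - 1) (k - 1) (by omega) (by omega)
    have h3 := (abs_le.1 h₁).1
    have h4 : D₁ * d * v (k - 1) ≤ Cg * d * (v (k - 1 - 1) + v (k - 1) + 2) := by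
      have := J.v_nonneg (k - 1)
      have := J.v_nonneg (k - 1 - 1)
      have := J.Cg_nonneg
      gcongr
      linarith
    have h5 : (τ (k - 1 - 1) : ℝ) ≤ l := by linarith
    have h6 : τ (k - 1 - 1) ≤ l := by exact_mod_cast h5
    refine ⟨Finset.mem_Icc.2 ⟨by omega, by omega⟩, J.param (k - 1) ?_ i ?_⟩
    · exact Finset.mem_Icc.2 ⟨by omega, by omega⟩
    · exact Finset.mem_Ioc.2 ⟨by omega, hik⟩
  have hright : ∀ i ∈ Finset.Ioc l e, τ k < i →
      k ∈ Finset.Icc 1 K ∧ b i = f (k + 1) := fun i hi hik => by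
    have hi' := Finset.mem_Ioc.1 hi
    have hkK : k ≠ K + 1 := fun h0 => by
      rw [h0, J.seg.last] at hik
      omega
    have hg := J.gap k (k + 1) (by omega) (by omega)
    have h3 := (abs_le.1 h₂).2
    have h4 : D₂ * d * v k ≤ Cg * d * (v k + v (k + 1) + 2) := by
      have := J.v_nonneg k
      have := J.v_nonneg (k + 1)
      have := J.Cg_nonneg
      gcongr
      linarith
    have h5 : (e : ℝ) ≤ τ (k + 1) := by linarith
    have h6 : e ≤ τ (k + 1) := by exact_mod_cast h5
    refine ⟨Finset.mem_Icc.2 ⟨by omega, by omega⟩, J.param (k + 1) ?_ i ?_⟩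
    · exact Finset.mem_Icc.2 ⟨by omega, by omega⟩
    · exact Finset.mem_Ioc.2 ⟨by simpa using hik, by omega⟩
  have hmid : ∀ i, τ (k - 1) < i → i ≤ τ k → b i = f k := fun i h1 h2 =>
    J.param k hk i (Finset.mem_Ioc.2 ⟨h1, h2⟩)
  refine ⟨fun i hi => ⟨hleft i hi, hright i hi, hmid i⟩, ?_⟩
  have hpoint : ∀ i ∈ Finset.Ioc l e, sqNorm S (b i - f k) ≤
      (if i ≤ τ (k - 1) then sqNorm S (f (k - 1) - f (k - 1 + 1)) else 0) +
        (if τ k < i then sqNorm S (f k - f (k + 1)) else 0) := fun i hi => by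
    have hlt := J.seg.lt_of_lt (show k - 1 < k by omega) hk'.2
    by_cases h1 : i ≤ τ (k - 1)
    · rw [if_pos h1, if_neg (by omega), (hleft i hi h1).2, Nat.sub_add_cancel hk'.1, add_zero]
    · by_cases h2 : τ k < i
      · rw [if_neg h1, if_pos h2, (hright i hi h2).2, zero_add, sqNorm_sub_comm]
      · rw [if_neg h1, if_neg h2, hmid i (by omega) (by omega), sub_self, hz, add_zero]
  -- An overhang of at most D₁ d/Δ observations, each at squared distance Δ, contributes at most D₁
  -- d.
  have hsumleft : ∑ i ∈ Finset.Ioc l e,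
      (if i ≤ τ (k - 1) then sqNorm S (f (k - 1) - f (k - 1 + 1)) else 0) ≤ D₁ * d := by
    rw [← Finset.sum_filter, Finset.sum_const, nsmul_eq_mul]
    rcases ((Finset.Ioc l e).filter fun i => i ≤ τ (k - 1)).eq_empty_or_nonempty with h0 | ⟨i, hi⟩
    · rw [h0]
      simp only [Finset.card_empty, Nat.cast_zero, zero_mul]
      positivity
    · have hi' := Finset.mem_filter.1 hi
      have hk1 := (hleft i hi'.1 hi'.2).1
      have hlτ : l ≤ τ (k - 1) := by
        have := Finset.mem_Ioc.1 hi'.1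
        omega
      have hc : (((Finset.Ioc l e).filter fun i => i ≤ τ (k - 1)).card : ℝ) ≤
          D₁ * d * v (k - 1) := by
        have h3 : ((Finset.Ioc l e).filter fun i => i ≤ τ (k - 1)).card ≤ τ (k - 1) - l := by
          rw [← Nat.card_Ioc l (τ (k - 1))]
          refine Finset.card_le_card fun i hi => ?_
          simp only [Finset.mem_filter, Finset.mem_Ioc] at hi ⊢
          omega
        have h4 : (((Finset.Ioc l e).filter fun i => i ≤ τ (k - 1)).card : ℝ) ≤
            (τ (k - 1) : ℝ) - l := by
          rw [← Nat.cast_sub hlτ]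
          exact_mod_cast h3
        linarith [(abs_le.1 h₁).1]
      have hΔ := J.jump_pos (k - 1) hk1
      refine (mul_le_mul_of_nonneg_right hc hΔ.le).trans (le_of_eq ?_)
      rw [J.v_eq (k - 1) hk1]
      field_simp
  have hsumright : ∑ i ∈ Finset.Ioc l e,
      (if τ k < i then sqNorm S (f k - f (k + 1)) else 0) ≤ D₂ * d := by
    rw [← Finset.sum_filter, Finset.sum_const, nsmul_eq_mul]
    rcases ((Finset.Ioc l e).filter fun i => τ k < i).eq_empty_or_nonempty with h0 | ⟨i, hi⟩
    · rw [h0]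
      simp only [Finset.card_empty, Nat.cast_zero, zero_mul]
      positivity
    · have hi' := Finset.mem_filter.1 hi
      have hk1 := (hright i hi'.1 hi'.2).1
      have hτe : τ k ≤ e := by
        have := Finset.mem_Ioc.1 hi'.1
        omega
      have hc : (((Finset.Ioc l e).filter fun i => τ k < i).card : ℝ) ≤ D₂ * d * v k := by
        have h3 : ((Finset.Ioc l e).filter fun i => τ k < i).card ≤ e - τ k := by
          rw [← Nat.card_Ioc (τ k) e]
          refine Finset.card_le_card fun i hi => ?_
          simp only [Finset.mem_filter, Finset.mem_Ioc] at hi ⊢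
          omega
        have h4 : (((Finset.Ioc l e).filter fun i => τ k < i).card : ℝ) ≤ (e : ℝ) - τ k := by
          rw [← Nat.cast_sub hτe]
          exact_mod_cast h3
        linarith [(abs_le.1 h₂).2]
      have hΔ := J.jump_pos k hk1
      refine (mul_le_mul_of_nonneg_right hc hΔ.le).trans (le_of_eq ?_)
      rw [J.v_eq k hk1]
      field_simp
  refine (Finset.sum_le_sum hpoint).trans ?_
  rw [Finset.sum_add_distrib]
  linarith

/-- On a nearly homogeneous segment, an accurate estimate of the mean parameter is close to all the
parameters of the segment. -/
theorem sqNorm_sub_of_accurate (J : JumpSignal n K τ S f b v d Cg) {k : ℕ}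
    (hk : k ∈ Finset.Icc 1 (K + 1)) (hle : l < e) (hen : e ≤ n) {D₁ D₂ Ca Q : ℝ} (hD₁ : 0 ≤ D₁)
    (hD₁' : D₁ ≤ Cs) (hD₂ : 0 ≤ D₂) (hD₂' : D₂ ≤ Cs) (hCg : 3 * Cs + Ca ≤ Cg) (hCa : 0 < Ca)
    (h₁ : |(l : ℝ) - τ (k - 1)| ≤ D₁ * d * v (k - 1)) (h₂ : |(e : ℝ) - τ k| ≤ D₂ * d * v k)
    (hQ : ∀ k ∈ Finset.Icc 1 K, sqNorm S (f k - f (k + 1)) ≤ Q) (hQ0 : 0 ≤ Q) {g : Fin p → ℝ}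
    (hg : sqNorm S (g - ((Finset.Ioc l e).card : ℝ)⁻¹ • ∑ i ∈ Finset.Ioc l e, b i) ≤
      Ca * d / (Finset.Ioc l e).card) :
    ∑ i ∈ Finset.Ioc l e, sqNorm S (b i - g) ≤ 2 * (D₁ + D₂ + Ca) * d ∧
      ∀ i ∈ Finset.Ioc l e, sqNorm S (b i - g) ≤ 2 * Q + 2 := by
  have hk' := Finset.mem_Icc.1 hk
  have hd := J.d_pos
  have hCs : 0 ≤ Cs := hD₁.trans hD₁'
  obtain ⟨hpar, hsum⟩ := J.nearlyHomogeneous hk hen hD₁ (by linarith) hD₂ (by linarith) h₁ h₂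
  have hne : (Finset.Ioc l e).Nonempty := Finset.nonempty_Ioc.2 hle
  have hcard : (0 : ℝ) < (Finset.Ioc l e).card := by exact_mod_cast hne.card_pos
  set o := ((Finset.Ioc l e).card : ℝ)⁻¹ • ∑ i ∈ Finset.Ioc l e, b i with ho
  have hmean := sum_sqNorm_sub_mean_le J.posDef (Finset.Ioc l e) hne b (f k)
  have hbound : ∑ i ∈ Finset.Ioc l e, sqNorm S (b i - g) ≤ 2 * (D₁ + D₂ + Ca) * d := by
    have h3 : ∑ i ∈ Finset.Ioc l e, sqNorm S (b i - g) ≤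
        ∑ i ∈ Finset.Ioc l e, (2 * sqNorm S (b i - o) + 2 * sqNorm S (o - g)) :=
      Finset.sum_le_sum fun i _ => sqNorm_sub_le J.posDef (b i) o g
    rw [Finset.sum_add_distrib, ← Finset.mul_sum, Finset.sum_const, nsmul_eq_mul,
      sqNorm_sub_comm o g] at h3
    have h4 : ((Finset.Ioc l e).card : ℝ) * (2 * sqNorm S (g - o)) ≤ 2 * (Ca * d) := by
      rw [le_div_iff₀ hcard] at hg
      linarith
    linarith
  refine ⟨hbound, ?_⟩
  -- Averaging: at least 2 Cg d observations of the segment have parameter f k, while the total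
  -- squared distance is at most 2 (D₁ + D₂ + Ca) d ≤ 2 Cg d.
  have hmid : sqNorm S (f k - g) ≤ 1 := by
    have hgap := J.gap (k - 1) k (by omega) hk'.2
    have h3 := (abs_le.1 h₁).2
    have h4 := (abs_le.1 h₂).1
    have hv1 := J.v_nonneg (k - 1)
    have hv2 := J.v_nonneg k
    have hv1' : 0 ≤ d * v (k - 1) := mul_nonneg hd.le hv1
    have hv2' : 0 ≤ d * v k := mul_nonneg hd.le hv2
    have hlen : 2 * Cg * d ≤ ((min e (τ k) : ℕ) : ℝ) - (max l (τ (k - 1)) : ℕ) := by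
      have h5 : D₁ * d * v (k - 1) ≤ Cg * (d * v (k - 1)) := by
        rw [mul_assoc]; gcongr; linarith
      have h6 : D₂ * d * v k ≤ Cg * (d * v k) := by
        rw [mul_assoc]; gcongr; linarith
      have h7 : Cg * d * (v (k - 1) + v k + 2) =
          Cg * (d * v (k - 1)) + Cg * (d * v k) + 2 * Cg * d := by ring
      have h8 : 0 ≤ D₁ * d * v (k - 1) := by positivity
      have h9 : 0 ≤ D₂ * d * v k := by positivity
      rw [Nat.cast_min, Nat.cast_max]
      rcases min_choice (e : ℝ) (τ k) with h | h <;> rcases max_choice (l : ℝ) (τ (k - 1)) with h' | h'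
        <;> rw [h, h'] <;> linarith
    set A := Finset.Ioc (max l (τ (k - 1))) (min e (τ k)) with hA
    have hsub : A ⊆ Finset.Ioc l e := Finset.Ioc_subset_Ioc (le_max_left _ _) (min_le_left _ _)
    have hA1 : ∑ i ∈ A, sqNorm S (b i - g) = A.card * sqNorm S (f k - g) := by
      rw [Finset.sum_congr rfl (g := fun _ => sqNorm S (f k - g)), Finset.sum_const, nsmul_eq_mul]
      intro i hi
      have hi' := Finset.mem_Ioc.1 hi
      rw [(hpar i (hsub hi)).2.2 (by omega) (by omega)]
    have hA2 : ∑ i ∈ A, sqNorm S (b i - g) ≤ ∑ i ∈ Finset.Ioc l e, sqNorm S (b i - g) :=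
      Finset.sum_le_sum_of_subset_of_nonneg hsub fun i _ _ => sqNorm_nonneg J.posDef _
    have hA3 : ((min e (τ k) : ℕ) : ℝ) - (max l (τ (k - 1)) : ℕ) ≤ A.card := by
      rw [hA, Nat.card_Ioc]
      have : ((min e (τ k) : ℕ) : ℝ) ≤
          ((min e (τ k) - max l (τ (k - 1)) + max l (τ (k - 1)) : ℕ) : ℝ) := by
        exact_mod_cast Nat.le_add_of_sub_le le_rfl
      push_cast at this ⊢
      linarith
    have hA4 : 2 * Cg * d ≤ A.card := by linarith
    by_contra hgt
    have hgt := not_le.1 hgt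
    have hCa' : 2 * (D₁ + D₂ + Ca) * d ≤ 2 * Cg * d := by gcongr; linarith
    have hCg0 : 0 < Cg * d := mul_pos (by linarith) hd
    have hApos : (0 : ℝ) < A.card := by linarith
    nlinarith
  intro i hi
  have hi' := Finset.mem_Ioc.1 hi
  obtain ⟨hp1, hp2, hp3⟩ := hpar i hi
  by_cases h3 : i ≤ τ (k - 1)
  · obtain ⟨hk1, hbi⟩ := hp1 h3
    have h4 := hQ (k - 1) hk1
    have h5 := sqNorm_sub_le J.posDef (b i) (f k) g
    rw [hbi] at h5 ⊢
    rw [Nat.sub_add_cancel hk'.1] at h4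
    linarith
  · by_cases h4 : τ k < i
    · obtain ⟨hk1, hbi⟩ := hp2 h4
      have h4 := hQ k hk1
      have h5 := sqNorm_sub_le J.posDef (b i) (f k) g
      rw [hbi] at h5 ⊢
      rw [sqNorm_sub_comm (f (k + 1)) (f k)] at h5
      linarith
    · rw [hp3 (by omega) (by omega)]
      linarith

end JumpSignal

/-! ### Choice of the constants and conclusion -/

section Assembly

/-- An exponent that makes the union bound negligible against `n ^ (-c)`. -/
theorem exists_exponent (M : ℕ) {c : ℝ} (hc : 0 < c) : ∃ A : ℝ, 0 < A ∧ ∀ n : ℕ, 2 ≤ n →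
    1 - (n : ℝ) ^ (-(c / 2)) + 4 * M * (n : ℝ) ^ 3 * Real.exp (-(A * Real.log n)) ≤
      1 - (n : ℝ) ^ (-c) := by
  have hη : 0 < (2 : ℝ) ^ (c / 2) - 1 := by
    have := Real.one_lt_rpow (x := (2 : ℝ)) (z := c / 2) one_lt_two (by positivity)
    linarith
  set η := (2 : ℝ) ^ (c / 2) - 1 with hηdef
  have hlog2 : 0 < Real.log 2 := Real.log_pos one_lt_two
  set B := 4 * M / (η * Real.log 2) with hB
  have hB0 : 0 ≤ B := by positivity
  -- The 3 cancels n³, the c produces n^(-c), and B shrinks 4M to η. For n ≥ 2 there is room for η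
  -- n^(-c), since n^(-c/2) ≥ (1 + η) n^(-c).
  refine ⟨3 + c + B, by positivity, fun n hn => ?_⟩
  have hn' : (2 : ℝ) ≤ n := by exact_mod_cast hn
  have hn0 : (0 : ℝ) < n := by linarith
  have hlogn : Real.log 2 ≤ Real.log n := Real.log_le_log two_pos hn'
  have h1 : Real.exp (-((3 + c + B) * Real.log n)) = ((n : ℝ) ^ 3)⁻¹ * (n : ℝ) ^ (-c) *
      Real.exp (-(B * Real.log n)) := by
    rw [Real.rpow_def_of_pos hn0, ← Real.exp_log (x := ((n : ℝ) ^ 3)⁻¹) (by positivity),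
      Real.log_inv, Real.log_pow, ← Real.exp_add, ← Real.exp_add]
    congr 1
    push_cast
    ring
  have h2 : 4 * M * Real.exp (-(B * Real.log n)) ≤ η := by
    rw [Real.exp_neg, ← div_eq_mul_inv, div_le_iff₀ (Real.exp_pos _)]
    have h3 : B * Real.log 2 * η = 4 * M := by rw [hB]; field_simp
    have h4 : B * Real.log 2 ≤ Real.exp (B * Real.log n) := by
      have h5 := Real.add_one_le_exp (B * Real.log n)
      have h6 : B * Real.log 2 ≤ B * Real.log n := by gcongr
      linarith
    nlinarith
  have h3 : (n : ℝ) ^ (-(c / 2)) = (n : ℝ) ^ (-c) * (n : ℝ) ^ (c / 2) := by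
    rw [← Real.rpow_add hn0]; congr 1; ring
  have h4 : 1 + η ≤ (n : ℝ) ^ (c / 2) := by
    have := Real.rpow_le_rpow two_pos.le hn' (by positivity : 0 ≤ c / 2)
    linarith
  have h5 : 0 < (n : ℝ) ^ (-c) := Real.rpow_pos_of_pos hn0 _
  have h6 : 4 * M * (n : ℝ) ^ 3 * Real.exp (-((3 + c + B) * Real.log n)) =
      (n : ℝ) ^ (-c) * (4 * M * Real.exp (-(B * Real.log n))) := by
    rw [h1]; field_simp
  rw [h6, h3]
  nlinarith

theorem windowGain_mul_le {τ : ℕ → ℕ} {v : ℕ → ℝ} {d Cs Cl bs bl bs' bl' a a' : ℝ}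
    (hs : bs * a ≤ a' * bs') (hl : bl * a ≤ a' * bl') (l e k : ℕ) :
    windowGain τ v d Cs Cl bs bl l e k * a ≤ a' * windowGain τ v d Cs Cl bs' bl' l e k := by
  unfold windowGain
  split_ifs <;> simp [hs, hl]

namespace IsLinearModel

variable {Ω : Type*} [MeasurableSpace Ω] {μ : Measure Ω} [IsProbabilityMeasure μ] {n p s K : ℕ}
  {τ : ℕ → ℕ} {f : ℕ → Fin p → ℝ} {S : Matrix (Fin p) (Fin p) ℝ} {σ : ℝ}
  {x : ℕ → Ω → Fin p → ℝ} {ε y : ℕ → Ω → ℝ} {Cx Ce Cf : ℝ}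

theorem jumpSignal (h : IsLinearModel μ (n := n) s K τ f S σ x ε y Cx Ce Cf) (hCx : 0 < Cx)
    (hCe : 0 < Ce) {b : ℕ → Fin p → ℝ}
    (hb : ∀ k ∈ Finset.Icc 1 (K + 1), ∀ i ∈ Finset.Ioc (τ (k - 1)) (τ k), b i = f k) {Cg : ℝ}
    (hCg : 0 ≤ Cg) (hd : 0 < rate s p) (hsp : Spacing μ x y s K τ f (2 * Cg)) :
    JumpSignal n K τ S f b (signalInv μ x y K τ f) (rate s p) Cg where
  seg := h.segmentation
  posDef := h.cov_posDef
  param := hb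
  jump_pos k hk := by
    rw [← h.signal_eq hCx hCe hk]
    exact h.signal_pos hCx hCe hk
  v_eq k hk := by
    rw [signalInv, if_pos (Finset.mem_Icc.1 hk), h.signal_eq hCx hCe hk]
  v_zero := by simp [signalInv]
  v_last := by simp [signalInv]
  v_nonneg k := by
    unfold signalInv
    split_ifs with hk
    · exact (inv_pos.2 (h.signal_pos hCx hCe (Finset.mem_Icc.2 hk))).le
    · exact le_rfl
  d_pos := hd
  Cg_nonneg := hCg
  gap j k hjk hk := by
    set v := signalInv μ x y K τ f with hv
    have hCd : 0 ≤ Cg * rate s p := mul_nonneg hCg hd.le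
    have key : ∀ i, i + 1 ≤ K + 1 →
        Cg * rate s p * (2 * max (v i) 1 + 2 * max (v (i + 1)) 1) ≤ (τ (i + 1) : ℝ) - τ i :=
      fun i hi => by
        have := hsp (i + 1) (Finset.mem_Icc.2 ⟨by omega, hi⟩)
        rw [Nat.add_sub_cancel] at this
        linarith
    have hmax : ∀ i, v i + 1 ≤ 2 * max (v i) 1 := fun i => by
      linarith [le_max_left (v i) 1, le_max_right (v i) 1]
    have hmax1 : ∀ i, 1 ≤ max (v i) 1 := fun i => le_max_right _ _
    -- For distant changepoints, the segment after j supplies the share of v j and the segment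
    -- before k that of v k. The factor 2 in the spacing constant turns v ∨ 1 into v + 1.
    rcases Nat.lt_or_eq_of_le (show j + 1 ≤ k from hjk) with hlt | rfl
    · have h1 := key j (by omega)
      have h2 := key (k - 1) (by omega)
      rw [Nat.sub_add_cancel (by omega)] at h2
      have h3 : (τ (j + 1) : ℝ) ≤ τ (k - 1) := by
        exact_mod_cast h.segmentation.le_of_le (by omega) (by omega)
      have h4 : Cg * rate s p * (v j + 1) ≤
          Cg * rate s p * (2 * max (v j) 1 + 2 * max (v (j + 1)) 1) :=
        mul_le_mul_of_nonneg_left (by linarith [hmax j, hmax1 (j + 1)]) hCd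
      have h5 : Cg * rate s p * (v k + 1) ≤
          Cg * rate s p * (2 * max (v (k - 1)) 1 + 2 * max (v k) 1) :=
        mul_le_mul_of_nonneg_left (by linarith [hmax k, hmax1 (k - 1)]) hCd
      linarith
    · exact (mul_le_mul_of_nonneg_left (by linarith [hmax j, hmax (j + 1)]) hCd).trans (key j hk)

/-- Up to the noise variance, the expected loss is a sum of squared distances to the parameters,
which their mean minimises. The accuracy condition, stated for all oracles, thus applies to the
mean. -/
theorem isOracle_mean (h : IsLinearModel μ (n := n) s K τ f S σ x ε y Cx Ce Cf) (hCx : 0 < Cx)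
    (hCe : 0 < Ce) {b : ℕ → Fin p → ℝ}
    (hb : ∀ k ∈ Finset.Icc 1 (K + 1), ∀ i ∈ Finset.Ioc (τ (k - 1)) (τ k), b i = f k) {l e : ℕ}
    (hle : l < e) (hen : e ≤ n) : IsOracle μ x y (Finset.Ioc l e)
      (((Finset.Ioc l e).card : ℝ)⁻¹ • ∑ i ∈ Finset.Ioc l e, b i) := by
  have hloss : ∀ g, ∑ i ∈ Finset.Ioc l e, expLoss μ x y i g =
      ∑ i ∈ Finset.Ioc l e, sqNorm S (b i - g) + ∑ i ∈ Finset.Ioc l e, σ ^ 2 := fun g => by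
    rw [← Finset.sum_add_distrib]
    refine Finset.sum_congr rfl fun i hi => ?_
    have hi' := Finset.mem_Ioc.1 hi
    obtain ⟨k, hk, hik⟩ := h.segmentation.exists_segment (i := i) (by omega) (by omega)
    rw [h.expLoss_eq hCx hCe hk hik, hb k hk i hik]
  intro g _
  simp only [Set.mem_ofPred_eq]
  rw [hloss, hloss]
  have := sum_sqNorm_sub_mean_le h.cov_posDef (Finset.Ioc l e) (Finset.nonempty_Ioc.2 hle) b g
  linarith

end IsLinearModel

/-- The constants of the search bounds, and the relations between them. -/
structure SearchConstants (M : ℕ) (Cx Ce Ca c₀ Cb A Cs Cl bs bl c2 c3 c4 Cγ Cg : ℝ) : Prop where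
  A_pos : 0 < A
  Cs_pos : 0 < Cs
  Cγ_pos : 0 < Cγ
  Cs_le : Cs ≤ Cl
  bs_eq : bs = Cs / 32 - 2 * c2
  bl_eq : bl = Cl / 32 - 2 * c2
  c2_eq : c2 = M * (A / expRate Cx Ce) / c₀
  c3_eq : c3 = M * (16 * Cx ^ 2 * Ca + A / expRate Cx Ce * (2 * Cb + 2 / c₀))
  c4_eq : c4 = M * (16 * Cx ^ 2)
  bs_nonneg : 0 ≤ bs
  bs_ge : c2 + c3 ≤ bs
  bs_le : bs ≤ bl
  H_nonneg : 0 ≤ c3 + c2 + 2 * c4 * Cs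
  Cγ_ge : c2 + (c3 + c2 + 2 * c4 * Cs) + 1 ≤ Cγ
  bl_ge : Cγ + c3 + (c3 + c2 + 2 * c4 * Cs) + 1 ≤ bl
  Cs_ge₁ : 4 * M * Cb ≤ Cs * Real.log 2
  Cs_ge₂ : 16 * M * (A / expRate Cx Ce) * Cb ≤ Cs
  Cg_ge₁ : Cl + 1 ≤ Cg
  Cg_ge₂ : 3 * Cs + Ca ≤ Cg

/-- The order of choice avoids circularity: c2, c3, c4 depend on the given constants and A only; Cs
comes next, then Cγ, which must exceed the misalignment cost 2 c4 Cs, then Cl, and finally the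
spacing constant Cg. -/
theorem exists_searchConstants (M : ℕ) {Cx Ce Ca c₀ Cb A : ℝ} (hCx : 0 < Cx)
    (hCa : 0 < Ca) (hc₀ : 0 < c₀) (hCb : 0 < Cb) (hA : 0 < A) :
    ∃ Cs Cl bs bl c2 c3 c4 Cγ Cg,
      SearchConstants M Cx Ce Ca c₀ Cb A Cs Cl bs bl c2 c3 c4 Cγ Cg := by
  have he := expRate_pos (Ce := Ce) hCx
  have hlog2 : 0 < Real.log 2 := Real.log_pos one_lt_two
  set a := A / expRate Cx Ce with ha
  have ha0 : 0 < a := div_pos hA he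
  obtain ⟨c2, hc2⟩ : ∃ c2, c2 = M * a / c₀ := ⟨_, rfl⟩
  obtain ⟨c3, hc3⟩ : ∃ c3, c3 = M * (16 * Cx ^ 2 * Ca + a * (2 * Cb + 2 / c₀)) := ⟨_, rfl⟩
  obtain ⟨c4, hc4⟩ : ∃ c4, c4 = M * (16 * Cx ^ 2) := ⟨_, rfl⟩
  have hc2' : 0 ≤ c2 := by rw [hc2]; positivity
  have hc3' : 0 ≤ c3 := by rw [hc3]; positivity
  have hc4' : 0 ≤ c4 := by rw [hc4]; positivity
  have i1 : 0 ≤ 4 * M * Cb / Real.log 2 := by positivity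
  have i2 : 0 ≤ 16 * M * a * Cb := by positivity
  obtain ⟨Cs, hCs⟩ : ∃ Cs, Cs = 4 * M * Cb / Real.log 2 + 16 * M * a * Cb +
    32 * (3 * c2 + c3) + 1 := ⟨_, rfl⟩
  have hCs' : 0 < Cs := by rw [hCs]; positivity
  have i3 : 0 ≤ c4 * Cs := by positivity
  obtain ⟨Cγ, hCγ⟩ : ∃ Cγ, Cγ = c2 + (c3 + c2 + 2 * c4 * Cs) + 1 := ⟨_, rfl⟩
  obtain ⟨Cl, hCl⟩ : ∃ Cl, Cl = 32 * (Cγ + c3 + (c3 + c2 + 2 * c4 * Cs) + 1 + 2 * c2) + Cs :=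
    ⟨_, rfl⟩
  refine ⟨Cs, Cl, Cs / 32 - 2 * c2, Cl / 32 - 2 * c2, c2, c3, c4, Cγ, Cl + 1 + 3 * Cs + Ca, ?_⟩
  have hlast : 4 * M * Cb ≤ Cs * Real.log 2 := by
    rw [← div_le_iff₀ hlog2]
    linarith
  constructor <;> first | assumption | rfl | linarith

theorem corollary1 (M : ℕ) (hM : 2 ≤ M)
    (Cx Ce Cf Ca c c₀ Cb : ℝ) (hCx : 0 < Cx) (hCe : 0 < Ce) (hCf : 0 < Cf)
    (hCa : 0 < Ca) (hc : 0 < c) (hc₀ : 0 < c₀) (hCb : 0 < Cb) :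
    ∃ Ct Cm Cγ Csnr C : ℝ, 0 < Ct ∧ 0 < Cm ∧ 0 < Cγ ∧ 0 < Csnr ∧ 0 < C ∧
      ∀ (Ω : Type*) [MeasurableSpace Ω] (μ : Measure Ω) [IsProbabilityMeasure μ]
        (n p s K : ℕ) (τ : ℕ → ℕ) (f : ℕ → Fin p → ℝ) (S : Matrix (Fin p) (Fin p) ℝ) (σ : ℝ)
        (x : ℕ → Ω → Fin p → ℝ) (ε y : ℕ → Ω → ℝ)
        (fit : Finset ℕ → (ℕ → Obs p) → (Fin p → ℝ)),
        IsLinearModel μ (n := n) s K τ f S σ x ε y Cx Ce Cf →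
        c₀ * Real.log (n : ℝ) ≤ rate s p →
        (∀ k ∈ Finset.Icc 1 K, signal μ x y τ f k * Real.log (n : ℝ) ≤ Cb * rate s p) →
        IsCVLasso fit →
        PredictiveAccuracy μ x y n M s K τ f S fit Ct Ca c →
        Spacing μ x y s K τ f Csnr →
        ENNReal.ofReal (1 - (n : ℝ) ^ (-C)) ≤
          μ {ω |
            (∃ (Khat : ℕ) (τhat : ℕ → ℕ),
              IsCfEstimate n M fit (Cm * rate s p) (Cγ * rate s p) (sample x y ω) Khat τhat) ∧
            ∀ (Khat : ℕ) (τhat : ℕ → ℕ),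
              IsCfEstimate n M fit (Cm * rate s p) (Cγ * rate s p) (sample x y ω) Khat τhat →
                Khat = K ∧
                ∀ k ∈ Finset.Icc 1 K, ∃ j ∈ Finset.Icc 1 Khat,
                  signal μ x y τ f k * |(τ k : ℝ) - (τhat j : ℝ)| ≤ Ct * rate s p} := by
  obtain ⟨A, hA, hAn⟩ := exists_exponent M hc
  obtain ⟨Cs, Cl, bs, bl, c2, c3, c4, Cγ, Cg, hcon⟩ :=
    exists_searchConstants (Ce := Ce) M hCx hCa hc₀ hCb hA
  have he := expRate_pos (Ce := Ce) hCx
  have hCs := hcon.Cs_pos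
  have hsl := hcon.Cs_le
  have hCl : 0 < Cl := hCs.trans_le hsl
  have hCg : 0 < Cg := by linarith [hcon.Cg_ge₁]
  have hM1 : 1 ≤ M := by omega
  have hMr : (1 : ℝ) ≤ M := by exact_mod_cast hM1
  -- The localisation constant is the large window, and the minimal segment length is the rate
  -- itself.
  refine ⟨Cl, 1, Cγ, 2 * Cg, c / 2, hCl, one_pos, hcon.Cγ_pos, by positivity, by positivity, ?_⟩
  intro Ω _ μ _ n p s K τ f S σ x ε y fit hmod hrate hsig hfit hacc hsp
  have hn1 : 1 ≤ n := by have := hmod.segmentation.lt_length; omega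
  rcases hn1.eq_or_lt with rfl | hn2
  -- For n = 1 the required probability is 0.
  · simp
  have hn2 : 2 ≤ n := hn2
  have hnr : (2 : ℝ) ≤ n := by exact_mod_cast hn2
  have hlog2 : 0 < Real.log 2 := Real.log_pos one_lt_two
  have hlogn : Real.log 2 ≤ Real.log n := Real.log_le_log two_pos hnr
  have hlog : 0 < Real.log n := hlog2.trans_le hlogn
  set d := rate s p
  have hd : 0 < d := (mul_pos hc₀ hlog).trans_le hrate
  obtain ⟨b, hb⟩ := hmod.segmentation.exists_pointwise f
  have hy : ∀ i ∈ Finset.Icc 1 n, ∀ ω, y i ω = x i ω ⬝ᵥ b i + ε i ω := fun i hi ω => by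
    have hi' := Finset.mem_Icc.1 hi
    obtain ⟨k, hk, hik⟩ := hmod.segmentation.exists_segment (i := i) (by omega) hi'.2
    rw [hmod.response k hk i hik ω, hb k hk i hik]
  set v := signalInv μ x y K τ f with hv_def
  have J : JumpSignal n K τ S f b v d Cg := hmod.jumpSignal hCx hCe hb hCg.le hd hsp
  obtain ⟨t, ht⟩ : ∃ t, t = A * Real.log n := ⟨_, rfl⟩
  have ht0 : 0 ≤ t := by rw [ht]; positivity
  -- Q bounds every jump by the assumption on Δ_k log n. With R = 2Q + 2 and t of order log n, the
  -- error tR / `expRate` of the upper bound remains of order d.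
  obtain ⟨Q, hQ⟩ : ∃ Q, Q = Cb * d / Real.log n := ⟨_, rfl⟩
  have hQ0 : 0 ≤ Q := by rw [hQ]; positivity
  have hQk : ∀ k ∈ Finset.Icc 1 K, sqNorm S (f k - f (k + 1)) ≤ Q := fun k hk => by
    rw [hQ, le_div_iff₀ hlog, ← hmod.signal_eq hCx hCe hk]
    exact hsig k hk
  have hdv : ∀ k ∈ Finset.Icc 1 K, Real.log n / Cb ≤ d * v k := fun k hk => by
    have h1 := J.jump_pos k hk
    have h2 := hQk k hk
    rw [hQ, le_div_iff₀ hlog] at h2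
    rw [J.v_eq k hk, ← div_eq_mul_inv, div_le_div_iff₀ hCb h1]
    linarith
  have hR : 1 ≤ 2 * Q + 2 := by linarith
  have ha : t / expRate Cx Ce = A / expRate Cx Ce * Real.log n := by rw [ht]; ring
  have ha0 : 0 < A / expRate Cx Ce := div_pos hA he
  have hlogd : Real.log n ≤ d / c₀ := by rw [le_div_iff₀ hc₀]; linarith
  have htc2 : M * (t / expRate Cx Ce) ≤ c2 * d := by
    rw [ha, hcon.c2_eq]
    calc M * (A / expRate Cx Ce * Real.log n) ≤ M * (A / expRate Cx Ce * (d / c₀)) := by gcongr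
      _ = _ := by ring
  have htR : t * (2 * Q + 2) / expRate Cx Ce ≤ A / expRate Cx Ce * (2 * Cb + 2 / c₀) * d := by
    have h1 : t * (2 * Q + 2) / expRate Cx Ce =
        A / expRate Cx Ce * (2 * Cb * d + 2 * Real.log n) := by
      rw [ht, hQ]; field_simp
    have h2 : 2 / c₀ * d = 2 * (d / c₀) := by ring
    rw [h1, mul_assoc (A / expRate Cx Ce)]
    exact mul_le_mul_of_nonneg_left (by linarith) ha0.le
  set h := windowWidth τ v d Cs Cl with hh
  have hprob := hmod.measure_not_heldOutBounds_le hCx hCe hy hfit hR t M h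
  set bad : Set Ω := {ω | ¬ ∀ l e m, l < e → e ≤ n → m ∈ Finset.Icc 1 M →
    HeldOutBounds n M K τ S Cx Ce (2 * Q + 2) t h b
      (fun l e m => fit (Finset.Ioc l e \ splitSet n M m) (sample x y ω))
      (fun i => (x i ω, ε i ω)) l e m}
  have hfinal := hAn n hn2
  rw [← ht] at hfinal
  have hpow : 0 ≤ 1 - (n : ℝ) ^ (-(c / 2)) := by
    have := Real.rpow_le_one_of_one_le_of_nonpos (by linarith : (1 : ℝ) ≤ n)
      (by linarith : -(c / 2) ≤ 0)
    linarith
  -- Adding the failure probability to both sides avoids complements: the accuracy event lies in the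
  -- union of the target and `bad`, and neither needs to be measurable.
  refine (ENNReal.add_le_add_iff_right
    (a := ENNReal.ofReal (4 * M * (n : ℝ) ^ 3 * Real.exp (-t))) ENNReal.ofReal_ne_top).1 ?_
  rw [← ENNReal.ofReal_add hpow (by positivity)]
  refine (ENNReal.ofReal_le_ofReal hfinal).trans (hacc.trans ?_)
  refine le_trans ?_ (add_le_add_right hprob _)
  refine le_trans (measure_mono ?_) (measure_union_le _ _)
  intro ω hω
  by_cases hωbad : ω ∈ bad
  · exact Or.inr hωbad
  refine Or.inl ?_
  have hgood : ∀ l e m, l < e → e ≤ n → m ∈ Finset.Icc 1 M →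
      HeldOutBounds n M K τ S Cx Ce (2 * Q + 2) t h b
        (fun l e m => fit (Finset.Ioc l e \ splitSet n M m) (sample x y ω))
        (fun i => (x i ω, ε i ω)) l e m := not_not.1 hωbad
  set z := sample x y ω with hz
  have hE : ∀ l e, cfExcess n M fit z b l e = ∑ m ∈ Finset.Icc 1 M,
      ∑ i ∈ heldOut n M l e m,
        excess (b i) (fit (Finset.Ioc l e \ splitSet n M m) z) (x i ω, ε i ω) := fun l e => by
    refine Finset.sum_congr rfl fun m _ => Finset.sum_congr rfl fun i hi => ?_
    exact sqLoss_sub_sqLoss (hy i (splitSet_subset n M m (Finset.mem_inter.1 hi).2) ω)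
  have hMsum : ∀ r : ℝ, ∑ m ∈ Finset.Icc 1 M, r = M * r := fun r => by simp
  have H : SearchBounds n K τ v d (cfExcess n M fit z b) Cs Cl bs bl c2 c3 c4 Cγ :=
    { seg := hmod.segmentation
      d_pos := hd
      v_nonneg := J.v_nonneg
      v_zero := J.v_zero
      v_last := J.v_last
      Cs_nonneg := hCs.le
      Cs_le := hsl
      bs_nonneg := hcon.bs_nonneg
      bs_ge := hcon.bs_ge
      bs_le := hcon.bs_le
      H_nonneg := hcon.H_nonneg
      Cγ_ge := hcon.Cγ_ge
      bl_ge := hcon.bl_ge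
      gap := fun j k hjk hk => by
        refine le_trans ?_ (J.gap j k hjk hk)
        have h1 := J.v_nonneg j
        have h2 := J.v_nonneg k
        have h3 := hcon.Cg_ge₁
        gcongr
      lower := fun l e hle hen => by
        have hstep : ∀ m ∈ Finset.Icc 1 M, _ := fun m hm =>
          J.le_sum_heldOut hCx hM1 hCs.le hsl (by linarith [hcon.Cg_ge₁]) hen hm ht0
            (fun k hk => by
              have h1 := hdv k hk
              have h2 : Cs * (Real.log n / Cb) ≤ Cs * (d * v k) := by gcongr
              have h3 : 4 * M * Cb ≤ Cs * Real.log n := hcon.Cs_ge₁.trans (by gcongr)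
              have h4 : 4 * (M : ℝ) ≤ Cs * (Real.log n / Cb) := by
                rw [← mul_div_assoc, le_div_iff₀ hCb]
                exact h3
              linarith)
            (fun k hk => by
              have h1 := hdv k hk
              have h2 : Cs * (Real.log n / Cb) ≤ Cs * (d * v k) := by gcongr
              have h3 : 16 * M * (A / expRate Cx Ce) * Cb * Real.log n ≤ Cs * Real.log n := by
                have := hcon.Cs_ge₂
                gcongr
              have h4 : 16 * M * (A / expRate Cx Ce) * Real.log n ≤ Cs * (Real.log n / Cb) := by
                rw [← mul_div_assoc Cs, le_div_iff₀ hCb]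
                linarith
              rw [ha, le_div_iff₀ (by positivity)]
              linarith)
            (hgood l e m hle hen hm)
        rw [hE]
        refine le_trans ?_ (Finset.sum_le_sum hstep)
        rw [hMsum, mul_sub, Finset.mul_sum, Finset.sum_mul]
        have hgain : ∀ C, (C / 32 - 2 * c2) * d ≤
            M * (C * d / (32 * M) - 2 * (t / expRate Cx Ce)) := fun C => by
          have : (M : ℝ) * (C * d / (32 * M)) = C / 32 * d := by field_simp
          rw [mul_sub, this]
          linarith
        refine sub_le_sub (Finset.sum_le_sum fun k _ => windowGain_mul_le ?_ ?_ l e k) htc2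
        · rw [hcon.bs_eq]
          exact hgain Cs
        · rw [hcon.bl_eq]
          exact hgain Cl
      upper := fun k hk l e hle hen D₁ D₂ hD₁ hD₁' hD₂ hD₂' h₁ h₂ => by
        have hstep : ∀ m ∈ Finset.Icc 1 M, ∑ i ∈ heldOut n M l e m,
            excess (b i) (fit (Finset.Ioc l e \ splitSet n M m) z) (x i ω, ε i ω) ≤
            (16 * Cx ^ 2 * (D₁ + D₂ + Ca) + A / expRate Cx Ce * (2 * Cb + 2 / c₀)) * d :=
          fun m hm => by
            have hnear : IsNearlyHomogeneous μ x y n K τ f Cl d l e := by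
              refine ⟨hle, hen, k, hk, h₁.trans ?_, h₂.trans ?_⟩
              · have := J.v_nonneg (k - 1)
                have := hD₁'.trans hsl
                gcongr
              · have := J.v_nonneg k
                have := hD₂'.trans hsl
                gcongr
            have hg := hω m hm l e hnear _ (hmod.isOracle_mean hCx hCe hb hle hen)
            obtain ⟨h3, h4⟩ := J.sqNorm_sub_of_accurate hk hle hen hD₁ hD₁' hD₂ hD₂'
              hcon.Cg_ge₂ hCa h₁ h₂ hQk hQ0 hg
            have hsub : heldOut n M l e m ⊆ Finset.Ioc l e := Finset.inter_subset_left
            have h5 := sum_excess_le_of_upperTest hCx hR (hgood l e m hle hen hm).upper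
              fun i hi => h4 i (hsub hi)
            -- Each split is bounded by the sum over the whole segment, because the fit differs
            -- between splits; this is the factor M in c3 and c4.
            have h6 := (Finset.sum_le_sum_of_subset_of_nonneg hsub fun i _ _ =>
              sqNorm_nonneg J.posDef
                (b i - fit (Finset.Ioc l e \ splitSet n M m) z)).trans h3
            have h7 := mul_le_mul_of_nonneg_left h6 (show 0 ≤ 8 * Cx ^ 2 by positivity)
            linarith
        rw [hE]
        refine (Finset.sum_le_sum hstep).trans (le_of_eq ?_)
        rw [hMsum, hcon.c3_eq, hcon.c4_eq]
        ring }
  have hadm : IsAdmissible n (1 * d) K τ := by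
    refine ⟨hmod.segmentation, fun k hk => ?_⟩
    have h1 := H.gap k (k + 1) (by omega) (by omega)
    have h2 : 1 * d ≤ (Cl + 1) * d * (v k + v (k + 1) + 2) := by
      have h3 := J.v_nonneg k
      have h4 := J.v_nonneg (k + 1)
      have h5 : 0 < Cl * d := by positivity
      nlinarith [mul_nonneg h5.le h3, mul_nonneg h5.le h4, mul_nonneg hd.le h3,
        mul_nonneg hd.le h4]
    linarith
  refine ⟨exists_isCfEstimate fit _ z hadm, fun Kh τh hest => ?_⟩
  obtain ⟨hadmh, hmin⟩ := hest
  rw [one_mul] at hadmh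
  obtain ⟨hK, hloc⟩ := H.consistent hadmh fun K' τ' h' => by
    have h1 := hmin K' τ' (by rwa [one_mul])
    rw [totalCfLoss_eq n M fit _ z b hadmh.1, totalCfLoss_eq n M fit _ z b h'.1] at h1
    linarith
  refine ⟨hK, fun k hk => ?_⟩
  obtain ⟨j, hj, hjk⟩ := hloc k hk
  refine ⟨j, hj, ?_⟩
  have hpos := hmod.signal_pos hCx hCe hk
  refine (mul_le_mul_of_nonneg_left hjk hpos.le).trans (le_of_eq ?_)
  rw [hv_def, signalInv, if_pos (Finset.mem_Icc.1 hk)]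
  field_simp

end Assembly
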